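/- Let $m,n\ge 0$ and let $\mathbb C[x|\theta]=\mathbb C[x_0,\dots,x_m|\theta_1,\dots,\theta_n]=\mathbb C[x_0,\dots,x_m]\otimes_{\mathbb C}\wedge^\bullet\mathbb C^n$ be the polynomial superalgebra in $m+1$ even and $n$ odd variables, all of degree one. Let $\mathbb P^{m|n}_{\mathbb C}=(\mathbb C^{m+1|n}\setminus\{0\})/\mathbb C^\times$ be complex projective superspace: its underlying space is $\mathbb P^m_{\mathbb C}$, and its sections over an open $U\subset\mathbb P^m_{\mathbb C}$ are the holomorphic superfunctions $f(x|\theta)$ on the preimage of $U$ in $\mathbb C^{m+1}\setminus\{0\}$ with $f(\lambda x|\lambda\theta)=f(x|\theta)$ for all $\lambda\in\mathbb C^\times$. Let $I\subset\mathbb C[x|\theta]$ be a $\mathbb Z/2$-graded ideal that is generated by finitely many homogeneous elements $P^\alpha(x|\theta)$ of degree one, and let $\mathcal V\subset\mathbb P^{m|n}_{\mathbb C}$ be the linear (degree-one) subvariety that $I$ defines: its underlying space is $V=\{[v]\in\mathbb P^m_{\mathbb C}: P(v|0)=0 \text{ for all } P\in I\}$, and its structure sheaf $\mathcal O_{\mathcal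 V}$ is the restriction to $V$ of $\mathcal O_{\mathbb P^{m|n}}/\widetilde I$, where $\widetilde I$ is the ideal sheaf generated locally by the fractions $P(x|\theta)/Q(x)$ with $P\in I$ homogeneous and even or odd, $Q\in\mathbb C[x]$ homogeneous of the same degree as $P$, and $Q$ nowhere zero. Then $\mathcal V$ is split: there are a structure of a (Hausdorff, second countable) complex manifold on the topological space $V$, with sheaf of holomorphic functions $\mathcal O_V$, a locally free sheaf $T^*$ of $\mathcal O_V$-modules of finite rank, and a global isomorphism $\mathcal O_{\mathcal V}\cong\wedge^\bullet_{\mathcal O_V}T^*$ of sheaves of $\mathbb Z/2$-graded $\mathbb C$-algebras. -/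

import Mathlib

open TopologicalSpace Filter Topology Manifold
open scoped ContDiff TensorProduct LinearAlgebra.Projectivization

noncomputable section

namespace SuperGeometry

/-! ### Auxiliary algebra -/

/-- Germs along a filter of functions into a `ℂ`-algebra form a `ℂ`-algebra. -/
instance germAlgebra {α A : Type*} (l : Filter α) [Ring A] [Algebra ℂ A] :
    Algebra ℂ (Germ l A) :=
  Algebra.ofModule
    (fun c x y => by
      induction x using Germ.inductionOn with | _ f => ?_
      induction y using Germ.inductionOn with | _ g => ?_
      rw [← Germ.coe_smul, ← Germ.coe_mul, ← Germ.coe_mul, ← Germ.coe_smul, smul_mul_assoc])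
    (fun c x y => by
      induction x using Germ.inductionOn with | _ f => ?_
      induction y using Germ.inductionOn with | _ g => ?_
      rw [← Germ.coe_smul, ← Germ.coe_mul, ← Germ.coe_mul, ← Germ.coe_smul, mul_smul_comm])

/-- The degree `i : ZMod 2` part of the exterior algebra of a module. -/
abbrev extParity (R M : Type*) [CommRing R] [AddCommGroup M] [Module R M] (i : ZMod 2) :
    Submodule R (ExteriorAlgebra R M) :=
  CliffordAlgebra.evenOdd (0 : QuadraticForm R M) i

lemma ι_mul_eq {R M : Type*} [CommRing R] [AddCommGroup M] [Module R M] (v : M)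
    (b : ExteriorAlgebra R M) :
    ExteriorAlgebra.ι R v * b = CliffordAlgebra.involute b * ExteriorAlgebra.ι R v := by
  induction b using ExteriorAlgebra.induction with
  | algebraMap r => rw [AlgHom.commutes]; exact (Algebra.commutes r _).symm
  | ι w =>
    have h := ExteriorAlgebra.ι_add_mul_swap (R := R) v w
    have h2 : CliffordAlgebra.involute (Q := (0 : QuadraticForm R M)) (ExteriorAlgebra.ι R w)
      = - ExteriorAlgebra.ι R w := CliffordAlgebra.involute_ι w
    rw [h2, neg_mul]
    exact eq_neg_of_add_eq_zero_left h
  | mul a b ha hb => rw [← mul_assoc, ha, mul_assoc, hb, ← mul_assoc, map_mul]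
  | add a b ha hb => rw [mul_add, ha, hb, map_add, add_mul]

lemma ι_mul_ι_mul_comm {R M : Type*} [CommRing R] [AddCommGroup M] [Module R M] (v w : M)
    (b : ExteriorAlgebra R M) : ExteriorAlgebra.ι R v * ExteriorAlgebra.ι R w * b =
      b * (ExteriorAlgebra.ι R v * ExteriorAlgebra.ι R w) := by
  rw [mul_assoc, ι_mul_eq w b, ← mul_assoc, ι_mul_eq v, CliffordAlgebra.involute_involute,
    mul_assoc]

lemma even_mul_comm {R M : Type*} [CommRing R] [AddCommGroup M] [Module R M]
    {a : ExteriorAlgebra R M} (ha : a ∈ extParity R M 0) (b : ExteriorAlgebra R M) :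
    a * b = b * a := by
  induction a, ha using CliffordAlgebra.even_induction with
  | algebraMap r => exact Algebra.commutes r b
  | add x y _ _ hx hy => rw [add_mul, mul_add, hx, hy]
  | ι_mul_ι_mul m₁ m₂ x _ hx =>
    change ExteriorAlgebra.ι R m₁ * ExteriorAlgebra.ι R m₂ * x * b =
      b * (ExteriorAlgebra.ι R m₁ * ExteriorAlgebra.ι R m₂ * x)
    rw [mul_assoc, hx, ← mul_assoc, ι_mul_ι_mul_comm, mul_assoc b]

lemma odd_mul_comm {R M : Type*} [CommRing R] [AddCommGroup M] [Module R M]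
    {a b : ExteriorAlgebra R M} (ha : a ∈ extParity R M 1) (hb : b ∈ extParity R M 1) :
    a * b = -(b * a) := by
  induction a, ha using CliffordAlgebra.odd_induction with
  | ι v =>
    have := ι_mul_eq v b
    rw [CliffordAlgebra.involute_eq_of_mem_odd hb, neg_mul] at this
    exact this
  | add x y _ _ hx hy => rw [add_mul, mul_add, hx, hy, neg_add]
  | ι_mul_ι_mul m₁ m₂ x _ hx =>
    change ExteriorAlgebra.ι R m₁ * ExteriorAlgebra.ι R m₂ * x * b =
      -(b * (ExteriorAlgebra.ι R m₁ * ExteriorAlgebra.ι R m₂ * x))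
    rw [mul_assoc, hx, mul_neg, ← mul_assoc, ι_mul_ι_mul_comm, mul_assoc b]

/-! ### Superspaces -/

/-- A (complex) superspace: a topological space together with a sheaf of supercommutative
`ℂ`-superalgebras. The sheaf is presented by its stalks and by the local predicate saying which
families of stalk elements are its sections (as Mathlib does for the structure sheaf of `Spec`). -/
structure Superspace where
  /-- the underlying topological space -/
  carrier : TopCat.{0}
  /-- the stalks of the structure sheaf -/
  stalk : carrier → Type
  [ring : ∀ x, Ring (stalk x)]
  [algebra : ∀ x, Algebra ℂ (stalk x)]
  /-- the structure sheaf -/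
  sheaf : TopCat.LocalPredicate stalk
  /-- every element of a stalk is the germ of a section -/
  germ_surjective : ∀ (x : carrier) (a : stalk x), ∃ (U : Opens carrier) (hx : x ∈ U)
    (s : ∀ y : U, stalk y), sheaf.pred s ∧ s ⟨x, hx⟩ = a
  /-- two sections with the same germ at a point agree near that point -/
  germ_injective : ∀ (U : Opens carrier) (s t : ∀ y : U, stalk y), sheaf.pred s → sheaf.pred t →
    ∀ x : U, s x = t x → ∃ (V : Opens carrier) (_ : x.1 ∈ V) (h : V ≤ U),
      ∀ y : V, s ⟨y, h y.2⟩ = t ⟨y, h y.2⟩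
  algebraMap_mem : ∀ (U : Opens carrier) (c : ℂ),
    sheaf.pred (fun y : U => algebraMap ℂ (stalk y) c)
  add_mem : ∀ (U : Opens carrier) (s t : ∀ y : U, stalk y), sheaf.pred s → sheaf.pred t →
    sheaf.pred (fun y => s y + t y)
  mul_mem : ∀ (U : Opens carrier) (s t : ∀ y : U, stalk y), sheaf.pred s → sheaf.pred t →
    sheaf.pred (fun y => s y * t y)
  /-- the even (`i = 0`) and odd (`i = 1`) parts of the stalks -/
  parity : ∀ x, ZMod 2 → Submodule ℂ (stalk x)
  parity_isCompl : ∀ x, IsCompl (parity x 0) (parity x 1)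
  parity_one : ∀ x, 1 ∈ parity x 0
  parity_mul : ∀ x i j, ∀ a ∈ parity x i, ∀ b ∈ parity x j, a * b ∈ parity x (i + j)
  /-- the even and the odd component of a section are sections -/
  parity_sections : ∀ (U : Opens carrier) (s s₀ s₁ : ∀ y : U, stalk y), sheaf.pred s →
    (∀ y : U, s₀ y ∈ parity y 0) → (∀ y : U, s₁ y ∈ parity y 1) → (∀ y, s y = s₀ y + s₁ y) →
    sheaf.pred s₀ ∧ sheaf.pred s₁
  even_comm : ∀ x, ∀ a ∈ parity x 0, ∀ b, a * b = b * a
  odd_comm : ∀ x, ∀ a ∈ parity x 1, ∀ b ∈ parity x 1, a * b = -(b * a)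

attribute [instance] Superspace.ring Superspace.algebra

/-- A sheaf of `ℤ/2`-graded (two-sided) ideals in the structure sheaf of a superspace, given by
its stalks. -/
structure IdealSheaf (X : Superspace) where
  ideal : ∀ x : X.carrier, TwoSidedIdeal (X.stalk x)
  /-- an element of the ideal at `x` is the germ of a section lying in the ideal near `x` -/
  spread : ∀ x, ∀ a ∈ ideal x, ∃ (U : Opens X.carrier) (hx : x ∈ U) (s : ∀ y : U, X.stalk y),
    X.sheaf.pred s ∧ s ⟨x, hx⟩ = a ∧ ∀ y : U, s y ∈ ideal y
  /-- the ideals contain the even and odd components of their elements -/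
  graded : ∀ x, ∀ a ∈ ideal x, ∃ a₀ ∈ ideal x, ∃ a₁ ∈ ideal x,
    a₀ ∈ X.parity x 0 ∧ a₁ ∈ X.parity x 1 ∧ a = a₀ + a₁

/-- The presheaf whose sections are the restrictions to `Z` of classes of sections of `X`. -/
def IdealSheaf.prelocal {X : Superspace} (J : IdealSheaf X) (Z : Set X.carrier) :
    TopCat.PrelocalPredicate (X := TopCat.of Z)
      (fun x => (J.ideal x.1).ringCon.Quotient) where
  pred {W} s := ∃ (U : Opens X.carrier) (t : ∀ y : U, X.stalk y), X.sheaf.pred t ∧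
    ∀ x : W, ∃ h : x.1.1 ∈ U, s x = (J.ideal x.1.1).ringCon.mk' (t ⟨x.1.1, h⟩)
  res {_ _} i _ := fun ⟨U, t, ht, h⟩ => ⟨U, t, ht, fun x => h ⟨x.1, i.le x.2⟩⟩

lemma IdealSheaf.mk'_eq {X : Superspace} (J : IdealSheaf X) {x : X.carrier} (a b : X.stalk x) :
    (J.ideal x).ringCon.mk' a = (J.ideal x).ringCon.mk' b ↔ a - b ∈ J.ideal x := by
  rw [← TwoSidedIdeal.rel_iff]; exact RingCon.eq _

lemma Superspace.res {X : Superspace} {U V : Opens X.carrier} (h : V ≤ U)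
    {s : ∀ y : U, X.stalk y} (hs : X.sheaf.pred s) :
    X.sheaf.pred (fun y : V => s ⟨y, h y.2⟩) :=
  X.sheaf.res (CategoryTheory.homOfLE h) s hs

lemma IdealSheaf.disjoint_aux {X : Superspace} (J : IdealSheaf X) {x : X.carrier}
    {a b : X.stalk x} (ha : a ∈ X.parity x 0) (hb : b ∈ X.parity x 1)
    (hab : a - b ∈ J.ideal x) : a ∈ J.ideal x ∧ b ∈ J.ideal x := by
  obtain ⟨a₀, h₀, a₁, h₁, p₀, p₁, e⟩ := J.graded x _ hab
  have key : a - a₀ = b + a₁ := by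
    have : a = a₀ + a₁ + b := by rw [← e]; abel
    rw [this]; abel
  have z := Submodule.disjoint_def.1 (X.parity_isCompl x).disjoint (a - a₀)
    (Submodule.sub_mem _ ha p₀) (key ▸ Submodule.add_mem _ hb p₁)
  have hb' : b = -a₁ := by rw [z] at key; exact eq_neg_of_add_eq_zero_left key.symm
  exact ⟨sub_eq_zero.1 z ▸ h₀, hb' ▸ (J.ideal x).neg_mem h₁⟩

lemma Superspace.sub_mem' {X : Superspace} (U : Opens X.carrier) (s t : ∀ y : U, X.stalk y)
    (hs : X.sheaf.pred s) (ht : X.sheaf.pred t) : X.sheaf.pred (fun y => s y - t y) := by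
  have := X.add_mem U _ _ hs (X.mul_mem U _ _ (X.algebraMap_mem U (-1)) ht)
  simpa [sub_eq_add_neg] using this

/-- The subspace of a superspace `X` on the subset `Z`, with structure sheaf the restriction to
`Z` of the quotient of the structure sheaf of `X` by the ideal sheaf `J`. -/
def Superspace.subspace (X : Superspace) (J : IdealSheaf X) (Z : Set X.carrier) : Superspace where
  carrier := TopCat.of Z
  stalk x := (J.ideal x.1).ringCon.Quotient
  sheaf := (J.prelocal Z).sheafify
  germ_surjective x a := by
    obtain ⟨a, rfl⟩ := RingCon.mk'_surjective _ a
    obtain ⟨U, hx, s, hs, rfl⟩ := X.germ_surjective x.1 a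
    refine ⟨⟨Subtype.val ⁻¹' U, U.2.preimage continuous_subtype_val⟩, hx,
      fun y => (J.ideal y.1.1).ringCon.mk' (s ⟨y.1.1, y.2⟩), ?_, rfl⟩
    exact TopCat.PrelocalPredicate.sheafifyOf ⟨U, s, hs, fun y => ⟨y.2, rfl⟩⟩
  germ_injective W s t hs ht x hxy := by
    obtain ⟨V₁, m₁, i₁, U₁, s', hs', e₁⟩ := hs x
    obtain ⟨V₂, m₂, i₂, U₂, t', ht', e₂⟩ := ht x
    obtain ⟨k₁, f₁⟩ := e₁ ⟨x.1, m₁⟩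
    obtain ⟨k₂, f₂⟩ := e₂ ⟨x.1, m₂⟩
    have hd : s' ⟨x.1.1, k₁⟩ - t' ⟨x.1.1, k₂⟩ ∈ J.ideal x.1.1 := by
      rw [← J.mk'_eq, ← f₁, ← f₂]; exact hxy
    obtain ⟨U₃, k₃, r, hr, er, hrJ⟩ := J.spread _ _ hd
    let U := (U₁ ⊓ U₂) ⊓ U₃
    have l₁ : U ≤ U₁ := inf_le_left.trans inf_le_left
    have l₂ : U ≤ U₂ := inf_le_left.trans inf_le_right
    have l₃ : U ≤ U₃ := inf_le_right
    obtain ⟨O, hO, hOU, hOe⟩ := X.germ_injective U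
      (fun y => s' ⟨y, l₁ y.2⟩ - t' ⟨y, l₂ y.2⟩) (fun y => r ⟨y, l₃ y.2⟩)
      (X.sub_mem' U _ _ (X.res l₁ hs') (X.res l₂ ht')) (X.res l₃ hr)
      ⟨x.1.1, ⟨k₁, k₂⟩, k₃⟩ er.symm
    refine ⟨V₁ ⊓ V₂ ⊓ ⟨Subtype.val ⁻¹' O, O.2.preimage continuous_subtype_val⟩,
      ⟨⟨m₁, m₂⟩, hO⟩, fun y hy => i₁.le hy.1.1, fun y => ?_⟩
    obtain ⟨_, g₁⟩ := e₁ ⟨y.1, y.2.1.1⟩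
    obtain ⟨_, g₂⟩ := e₂ ⟨y.1, y.2.1.2⟩
    refine (g₁.trans ?_).trans g₂.symm
    rw [J.mk'_eq]
    have h3 := hOe ⟨y.1.1, y.2.2⟩
    exact h3 ▸ hrJ _
  algebraMap_mem W c := TopCat.PrelocalPredicate.sheafifyOf
    ⟨⊤, fun y => algebraMap ℂ (X.stalk y) c, X.algebraMap_mem ⊤ c, fun _ => ⟨trivial, rfl⟩⟩
  add_mem W s t hs ht :=
    (J.prelocal Z).sheafify_inductionOn₂' (J.prelocal Z) (J.prelocal Z)
      (fun {x} (a b : (J.ideal x.1).ringCon.Quotient) => a + b)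
      (fun {U V a b} ⟨U₁, s', hs', e₁⟩ ⟨U₂, t', ht', e₂⟩ => by
        refine ⟨U₁ ⊓ U₂, fun y => s' ⟨y, y.2.1⟩ + t' ⟨y, y.2.2⟩,
          X.add_mem _ _ _ (X.res inf_le_left hs') (X.res inf_le_right ht'), fun x => ?_⟩
        obtain ⟨k₁, f₁⟩ := e₁ ⟨x.1, x.2.1⟩
        obtain ⟨k₂, f₂⟩ := e₂ ⟨x.1, x.2.2⟩
        exact ⟨⟨k₁, k₂⟩, ((congrArg₂ (· + ·) f₁ f₂).trans (map_add _ _ _).symm :)⟩) hs ht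
  mul_mem W s t hs ht :=
    (J.prelocal Z).sheafify_inductionOn₂' (J.prelocal Z) (J.prelocal Z)
      (fun {x} (a b : (J.ideal x.1).ringCon.Quotient) => a * b)
      (fun {U V a b} ⟨U₁, s', hs', e₁⟩ ⟨U₂, t', ht', e₂⟩ => by
        refine ⟨U₁ ⊓ U₂, fun y => s' ⟨y, y.2.1⟩ * t' ⟨y, y.2.2⟩,
          X.mul_mem _ _ _ (X.res inf_le_left hs') (X.res inf_le_right ht'), fun x => ?_⟩
        obtain ⟨k₁, f₁⟩ := e₁ ⟨x.1, x.2.1⟩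
        obtain ⟨k₂, f₂⟩ := e₂ ⟨x.1, x.2.2⟩
        exact ⟨⟨k₁, k₂⟩, ((congrArg₂ (· * ·) f₁ f₂).trans (map_mul _ _ _).symm :)⟩) hs ht
  parity x i := (X.parity x.1 i).map ((J.ideal x.1).ringCon.mkₐ (α := ℂ)).toLinearMap
  parity_isCompl x := by
    constructor
    · rw [Submodule.disjoint_def]
      rintro _ ⟨a, ha, rfl⟩ ⟨b, hb, hab⟩
      have hd : a - b ∈ J.ideal x.1 := (J.mk'_eq a b).1 hab.symm
      have := (J.disjoint_aux ha hb hd).1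
      have h2 := (J.mk'_eq a 0).2 (by simpa using this)
      exact h2.trans (map_zero _)
    · rw [codisjoint_iff, ← Submodule.map_sup, (X.parity_isCompl x.1).sup_eq_top,
        Submodule.map_top, LinearMap.range_eq_top]
      exact RingCon.mkₐ_surjective (α := ℂ) _
  parity_one x := ⟨1, X.parity_one x.1, map_one (RingCon.mkₐ (α := ℂ) _)⟩
  parity_mul x i j := by
    rintro _ ⟨a, ha, rfl⟩ _ ⟨b, hb, rfl⟩
    exact ⟨a * b, X.parity_mul x.1 i j a ha b hb, map_mul (RingCon.mkₐ (α := ℂ) _) _ _⟩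
  parity_sections W s s₀ s₁ hs h₀ h₁ e := by
    have main : ∀ x : W, ∃ (V : Opens (TopCat.of Z)) (_ : x.1 ∈ V) (i : V ⟶ W),
        (J.prelocal Z).pred (fun y : V => s₀ ⟨y.1, i.le y.2⟩) ∧
        (J.prelocal Z).pred (fun y : V => s₁ ⟨y.1, i.le y.2⟩) := by
      intro x
      obtain ⟨V, m, i, U, t, ht, f⟩ := hs x
      have hc : ∀ y : U, ∃ a₀ a₁, a₀ ∈ X.parity y 0 ∧ a₁ ∈ X.parity y 1 ∧ t y = a₀ + a₁ := by
        intro y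
        obtain ⟨a, ha, b, hb, hab⟩ := Submodule.mem_sup.1
          ((X.parity_isCompl y.1).sup_eq_top ▸ Submodule.mem_top : t y ∈ _)
        exact ⟨a, b, ha, hb, hab.symm⟩
      choose t₀ t₁ p₀ p₁ et using hc
      obtain ⟨q₀, q₁⟩ := X.parity_sections U t t₀ t₁ ht p₀ p₁ et
      have key : ∀ y : V, ∃ h : y.1.1 ∈ U,
          s₀ ⟨y.1, i.le y.2⟩ = (J.ideal y.1.1).ringCon.mk' (t₀ ⟨y.1.1, h⟩) ∧
          s₁ ⟨y.1, i.le y.2⟩ = (J.ideal y.1.1).ringCon.mk' (t₁ ⟨y.1.1, h⟩) := by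
        intro y
        obtain ⟨hy, fy⟩ := f y
        refine ⟨hy, ?_⟩
        obtain ⟨a, ha, ea⟩ := h₀ ⟨y.1, i.le y.2⟩
        obtain ⟨b, hb, eb⟩ := h₁ ⟨y.1, i.le y.2⟩
        have ea' : (J.ideal y.1.1).ringCon.mk' a = s₀ ⟨y.1, i.le y.2⟩ := ea
        have eb' : (J.ideal y.1.1).ringCon.mk' b = s₁ ⟨y.1, i.le y.2⟩ := eb
        have e1 : (J.ideal y.1.1).ringCon.mk' (a + b) =
            (J.ideal y.1.1).ringCon.mk' (t ⟨y.1.1, hy⟩) := by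
          rw [map_add, ea', eb', ← e ⟨y.1, i.le y.2⟩]; exact fy
        rw [J.mk'_eq, et] at e1
        have e2 : (a - t₀ ⟨y.1.1, hy⟩) - (t₁ ⟨y.1.1, hy⟩ - b) ∈ J.ideal y.1.1 := by
          convert! e1 using 1; abel
        have e3 := J.disjoint_aux (Submodule.sub_mem _ ha (p₀ ⟨y.1.1, hy⟩))
          (Submodule.sub_mem (X.parity y.1.1 1) (p₁ ⟨y.1.1, hy⟩) hb) e2
        constructor
        · rw [← ea', J.mk'_eq]; exact e3.1
        · rw [← eb', eq_comm, J.mk'_eq]; exact e3.2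
      exact ⟨V, m, i, ⟨U, t₀, q₀, fun y => ⟨(key y).1, (key y).2.1⟩⟩,
        ⟨U, t₁, q₁, fun y => ⟨(key y).1, (key y).2.2⟩⟩⟩
    exact ⟨fun x => let ⟨V, m, i, h, _⟩ := main x; ⟨V, m, i, h⟩,
      fun x => let ⟨V, m, i, _, h⟩ := main x; ⟨V, m, i, h⟩⟩
  even_comm x := by
    rintro _ ⟨a, ha, rfl⟩ b
    obtain ⟨b, rfl⟩ := RingCon.mkₐ_surjective (α := ℂ) _ b
    change RingCon.mkₐ (α := ℂ) _ a * _ = _ * RingCon.mkₐ (α := ℂ) _ a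
    rw [← map_mul, ← map_mul, X.even_comm x.1 a ha]
  odd_comm x := by
    rintro _ ⟨a, ha, rfl⟩ _ ⟨b, hb, rfl⟩
    change RingCon.mkₐ (α := ℂ) _ a * RingCon.mkₐ (α := ℂ) _ b =
      -(RingCon.mkₐ (α := ℂ) _ b * RingCon.mkₐ (α := ℂ) _ a)
    rw [← map_mul, ← map_mul, X.odd_comm x.1 a ha b hb, map_neg]

lemma Superspace.exists_parts {X : Superspace} {x : X.carrier} (a : X.stalk x) :
    ∃ a₀ ∈ X.parity x 0, ∃ a₁ ∈ X.parity x 1, a = a₀ + a₁ := by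
  obtain ⟨a₀, h₀, a₁, h₁, e⟩ := Submodule.mem_sup.1
    ((X.parity_isCompl x).sup_eq_top ▸ Submodule.mem_top : a ∈ _)
  exact ⟨a₀, h₀, a₁, h₁, e.symm⟩

/-- The ideal sheaf whose stalk at `x` is the ideal generated by a set `S x` of germs, where the
elements of `S` are even or odd and are germs of sections with values in `S`. -/
def IdealSheaf.span (X : Superspace) (S : ∀ x : X.carrier, Set (X.stalk x))
    (hS : ∀ x, ∀ a ∈ S x, ∃ (U : Opens X.carrier) (hx : x ∈ U) (s : ∀ y : U, X.stalk y),
      X.sheaf.pred s ∧ s ⟨x, hx⟩ = a ∧ ∀ y : U, s y ∈ S y)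
    (hP : ∀ x, ∀ a ∈ S x, ∃ i, a ∈ X.parity x i) : IdealSheaf X where
  ideal x := TwoSidedIdeal.span (S x)
  spread x a ha := by
    induction ha using TwoSidedIdeal.span_induction with
    | mem a h =>
      obtain ⟨U, hx, s, hs, e, h⟩ := hS x a h
      exact ⟨U, hx, s, hs, e, fun y => TwoSidedIdeal.subset_span (h y)⟩
    | zero =>
      refine ⟨⊤, trivial, fun q => algebraMap ℂ _ 0, X.algebraMap_mem ⊤ 0,
        map_zero _, fun q => ?_⟩
      simp only [map_zero]; exact TwoSidedIdeal.zero_mem _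
    | add a b _ _ iha ihb =>
      obtain ⟨U, hU, s, hs, rfl, h⟩ := iha
      obtain ⟨V, hV, t, ht, rfl, h'⟩ := ihb
      exact ⟨U ⊓ V, ⟨hU, hV⟩, fun y => s ⟨y, y.2.1⟩ + t ⟨y, y.2.2⟩,
        X.add_mem _ _ _ (X.res inf_le_left hs) (X.res inf_le_right ht), rfl,
        fun y => TwoSidedIdeal.add_mem _ (h _) (h' _)⟩
    | neg a _ iha =>
      obtain ⟨U, hU, s, hs, rfl, h⟩ := iha
      exact ⟨U, hU, fun y => algebraMap ℂ _ (-1) * s y, X.mul_mem _ _ _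
        (X.algebraMap_mem U (-1)) hs, by simp,
        fun y => TwoSidedIdeal.mul_mem_left _ _ _ (h _)⟩
    | left_absorb b a _ iha =>
      obtain ⟨U, hU, s, hs, rfl, h⟩ := iha
      obtain ⟨V, hV, t, ht, rfl⟩ := X.germ_surjective x b
      exact ⟨V ⊓ U, ⟨hV, hU⟩, fun y => t ⟨y, y.2.1⟩ * s ⟨y, y.2.2⟩,
        X.mul_mem _ _ _ (X.res inf_le_left ht) (X.res inf_le_right hs), rfl,
        fun y => TwoSidedIdeal.mul_mem_left _ _ _ (h _)⟩
    | right_absorb b a _ iha =>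
      obtain ⟨U, hU, s, hs, rfl, h⟩ := iha
      obtain ⟨V, hV, t, ht, rfl⟩ := X.germ_surjective x b
      exact ⟨U ⊓ V, ⟨hU, hV⟩, fun y => s ⟨y, y.2.1⟩ * t ⟨y, y.2.2⟩,
        X.mul_mem _ _ _ (X.res inf_le_left hs) (X.res inf_le_right ht), rfl,
        fun y => TwoSidedIdeal.mul_mem_right _ _ _ (h _)⟩
  graded x a ha := by
    have mul := X.parity_mul x
    induction ha using TwoSidedIdeal.span_induction with
    | mem a h =>
      have hs := TwoSidedIdeal.subset_span h
      obtain ⟨i, hi⟩ := hP x a h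
      have h01 : ∀ j : ZMod 2, j = 0 ∨ j = 1 := by decide
      rcases h01 i with rfl | rfl
      · exact ⟨a, hs, 0, TwoSidedIdeal.zero_mem _, hi, Submodule.zero_mem _, (add_zero a).symm⟩
      · exact ⟨0, TwoSidedIdeal.zero_mem _, a, hs, Submodule.zero_mem _, hi, (zero_add a).symm⟩
    | zero => exact ⟨0, TwoSidedIdeal.zero_mem _, 0, TwoSidedIdeal.zero_mem _,
        Submodule.zero_mem _, Submodule.zero_mem _, (add_zero 0).symm⟩
    | add a b _ _ iha ihb =>
      obtain ⟨a₀, h₀, a₁, h₁, k₀, k₁, rfl⟩ := iha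
      obtain ⟨b₀, l₀, b₁, l₁, r₀, r₁, rfl⟩ := ihb
      exact ⟨a₀ + b₀, TwoSidedIdeal.add_mem _ h₀ l₀, a₁ + b₁, TwoSidedIdeal.add_mem _ h₁ l₁,
        Submodule.add_mem _ k₀ r₀, Submodule.add_mem _ k₁ r₁, add_add_add_comm _ _ _ _⟩
    | neg a _ iha =>
      obtain ⟨a₀, h₀, a₁, h₁, k₀, k₁, rfl⟩ := iha
      exact ⟨-a₀, TwoSidedIdeal.neg_mem _ h₀, -a₁, TwoSidedIdeal.neg_mem _ h₁,
        Submodule.neg_mem _ k₀, Submodule.neg_mem _ k₁, neg_add _ _⟩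
    | left_absorb b a _ iha =>
      obtain ⟨a₀, h₀, a₁, h₁, k₀, k₁, rfl⟩ := iha
      obtain ⟨b₀, r₀, b₁, r₁, rfl⟩ := Superspace.exists_parts b
      exact ⟨b₀ * a₀ + b₁ * a₁, TwoSidedIdeal.add_mem _ (TwoSidedIdeal.mul_mem_left _ _ _ h₀)
          (TwoSidedIdeal.mul_mem_left _ _ _ h₁),
        b₀ * a₁ + b₁ * a₀, TwoSidedIdeal.add_mem _ (TwoSidedIdeal.mul_mem_left _ _ _ h₁)
          (TwoSidedIdeal.mul_mem_left _ _ _ h₀),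
        Submodule.add_mem _ (mul 0 0 _ r₀ _ k₀) (mul 1 1 _ r₁ _ k₁),
        Submodule.add_mem _ (mul 0 1 _ r₀ _ k₁) (mul 1 0 _ r₁ _ k₀), by noncomm_ring⟩
    | right_absorb b a _ iha =>
      obtain ⟨a₀, h₀, a₁, h₁, k₀, k₁, rfl⟩ := iha
      obtain ⟨b₀, r₀, b₁, r₁, rfl⟩ := Superspace.exists_parts b
      exact ⟨a₀ * b₀ + a₁ * b₁, TwoSidedIdeal.add_mem _ (TwoSidedIdeal.mul_mem_right _ _ _ h₀)
          (TwoSidedIdeal.mul_mem_right _ _ _ h₁),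
        a₁ * b₀ + a₀ * b₁, TwoSidedIdeal.add_mem _ (TwoSidedIdeal.mul_mem_right _ _ _ h₁)
          (TwoSidedIdeal.mul_mem_right _ _ _ h₀),
        Submodule.add_mem _ (mul 0 0 _ k₀ _ r₀) (mul 1 1 _ k₁ _ r₁),
        Submodule.add_mem _ (mul 1 0 _ k₁ _ r₀) (mul 0 1 _ k₀ _ r₁), by noncomm_ring⟩

/-! ### Projective superspace -/

/-- The vector space `ℂ^{m+1}` with coordinates `x₀, …, x_m`. -/
abbrev CSpace (m : ℕ) : Type := Fin (m + 1) → ℂ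

/-- The exterior algebra `ℂ[θ₁, …, θ_n]` on `n` odd coordinates. -/
abbrev OddAlg (n : ℕ) : Type := ExteriorAlgebra ℂ (Fin n → ℂ)

/-- Complex projective space `ℙ^m`. -/
abbrev ProjSpace (m : ℕ) : Type := ℙ ℂ (CSpace m)

/-- `ℙ^m` carries the quotient topology of `ℂ^{m+1} ∖ {0}`. -/
instance projTopology (m : ℕ) : TopologicalSpace (ProjSpace m) :=
  TopologicalSpace.coinduced (Projectivization.mk' ℂ : {v : CSpace m // v ≠ 0} → ProjSpace m)
    inferInstance

/-- The preimage in `ℂ^{m+1} ∖ {0}` of a subset of `ℙ^m`. -/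
def cone {m : ℕ} (U : Set (ProjSpace m)) : Set (CSpace m) :=
  {v | ∃ h : v ≠ 0, Projectivization.mk ℂ v h ∈ U}

/-- The action of a scalar `c` on the odd coordinates, `θ_a ↦ c θ_a`. -/
def scaleOdd {n : ℕ} (c : ℂ) : OddAlg n →ₐ[ℂ] OddAlg n :=
  ExteriorAlgebra.map (c • LinearMap.id)

/-- Superfunctions on the open subset `U` of `ℙ^{m|n} = (ℂ^{m+1|n} ∖ {0}) / ℂˣ`: holomorphic
superfunctions `f(x|θ)` on the preimage of `U` in `ℂ^{m+1|n}` (holomorphic functions of `x` with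
values in `ℂ[θ]`) that are invariant, `f(cx|cθ) = f(x|θ)`, under the scaling action of `ℂˣ`. -/
structure IsSuperfunction {m n : ℕ} (U : Set (ProjSpace m)) (f : CSpace m → OddAlg n) : Prop where
  holomorphic : ∀ φ : Module.Dual ℂ (OddAlg n), DifferentiableOn ℂ (fun v => φ (f v)) (cone U)
  invariant : ∀ v ∈ cone U, ∀ c : ℂˣ, scaleOdd (c : ℂ) (f ((c : ℂ) • v)) = f v

/-- The filter on `ℂ^{m+1}` generated by the preimages of the neighbourhoods of `p ∈ ℙ^m`. -/
def coneNhds {m : ℕ} (p : ProjSpace m) : Filter (CSpace m) :=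
  Filter.map Subtype.val
    (Filter.comap (Projectivization.mk' ℂ : {v : CSpace m // v ≠ 0} → ProjSpace m) (𝓝 p))

lemma cone_mono {m : ℕ} {U V : Set (ProjSpace m)} (h : U ⊆ V) : cone U ⊆ cone V :=
  fun _ ⟨hv, hm⟩ => ⟨hv, h hm⟩

lemma mem_coneNhds {m : ℕ} {p : ProjSpace m} {A : Set (CSpace m)} :
    A ∈ coneNhds p ↔ ∃ U : Opens (ProjSpace m), p ∈ U ∧ cone (U : Set (ProjSpace m)) ⊆ A := by
  rw [coneNhds, Filter.mem_map, Filter.mem_comap]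
  constructor
  · rintro ⟨t, ht, hA⟩
    obtain ⟨U, hUt, hU, hp⟩ := mem_nhds_iff.1 ht
    exact ⟨⟨U, hU⟩, hp, fun v ⟨hv, hm⟩ => @hA ⟨v, hv⟩ (hUt hm)⟩
  · rintro ⟨U, hp, hA⟩
    exact ⟨U, U.2.mem_nhds hp, fun v hv => hA ⟨v.2, hv⟩⟩

lemma germ_eq_iff {m n : ℕ} {p : ProjSpace m} {f g : CSpace m → OddAlg n} :
    (f : Germ (coneNhds p) (OddAlg n)) = g ↔
      ∃ U : Opens (ProjSpace m), p ∈ U ∧ ∀ v ∈ cone (U : Set (ProjSpace m)), f v = g v := by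
  rw [Germ.coe_eq]
  exact mem_coneNhds

lemma IsSuperfunction.mono {m n : ℕ} {U V : Set (ProjSpace m)} {f : CSpace m → OddAlg n}
    (hf : IsSuperfunction V f) (h : U ⊆ V) : IsSuperfunction U f :=
  ⟨fun φ => (hf.holomorphic φ).mono (cone_mono h),
    fun v hv c => hf.invariant v (cone_mono h hv) c⟩

lemma isSuperfunction_const {m n : ℕ} (U : Set (ProjSpace m)) (c : ℂ) :
    IsSuperfunction U (fun _ => algebraMap ℂ (OddAlg n) c) :=
  ⟨fun _ => differentiableOn_const _, fun _ _ _ => AlgHom.commutes _ _⟩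

lemma IsSuperfunction.add {m n : ℕ} {U : Set (ProjSpace m)} {f g : CSpace m → OddAlg n}
    (hf : IsSuperfunction U f) (hg : IsSuperfunction U g) : IsSuperfunction U (f + g) :=
  ⟨fun φ => by simpa using! (hf.holomorphic φ).add (hg.holomorphic φ),
    fun v hv c => by simp [hf.invariant v hv c, hg.invariant v hv c]⟩

/-- The monomial basis of `ℂ[θ₁, …, θ_n]`. -/
def oddBasis (n : ℕ) : Module.Basis (Finset (Fin n)) ℂ (OddAlg n) :=
  (Pi.basisFun ℂ (Fin n)).ExteriorAlgebra

lemma IsSuperfunction.mul {m n : ℕ} {U : Set (ProjSpace m)} {f g : CSpace m → OddAlg n}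
    (hf : IsSuperfunction U f) (hg : IsSuperfunction U g) : IsSuperfunction U (f * g) where
  holomorphic φ := by
    have e : (fun v => φ ((f * g) v)) = fun v => ∑ i, ∑ j,
        ((oddBasis n).coord i (f v) * (oddBasis n).coord j (g v)) *
          φ (oddBasis n i * oddBasis n j) := by
      funext v
      conv_lhs => rw [Pi.mul_apply, ← (oddBasis n).sum_repr (f v), ← (oddBasis n).sum_repr (g v)]
      simp only [Finset.sum_mul_sum, map_sum, smul_mul_smul_comm, map_smul, smul_eq_mul,
        Module.Basis.coord_apply]
    rw [e]
    exact DifferentiableOn.fun_sum fun i _ => DifferentiableOn.fun_sum fun j _ =>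
      ((hf.holomorphic _).mul (hg.holomorphic _)).mul_const _
  invariant v hv c := by simp [hf.invariant v hv c, hg.invariant v hv c]

lemma IsSuperfunction.component {m n : ℕ} {U : Set (ProjSpace m)} {f : CSpace m → OddAlg n}
    (hf : IsSuperfunction U f) (a : ℂ) :
    IsSuperfunction U (fun v => (2 : ℂ)⁻¹ • (f v + a • CliffordAlgebra.involute (f v))) where
  holomorphic φ := by
    have := ((hf.holomorphic φ).add ((hf.holomorphic
      (φ ∘ₗ (CliffordAlgebra.involute : OddAlg n →ₐ[ℂ] OddAlg n).toLinearMap)).const_smul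
        a)).const_smul (2 : ℂ)⁻¹
    simpa using! this
  invariant v hv c := by
    have h : ∀ w : OddAlg n, scaleOdd (c : ℂ) (CliffordAlgebra.involute w) =
        CliffordAlgebra.involute (scaleOdd (c : ℂ) w) := by
      intro w
      have : (scaleOdd (c : ℂ)).comp (CliffordAlgebra.involute : OddAlg n →ₐ[ℂ] OddAlg n) =
          (CliffordAlgebra.involute : OddAlg n →ₐ[ℂ] OddAlg n).comp (scaleOdd (c : ℂ)) := by
        apply ExteriorAlgebra.hom_ext
        ext i
        have e : ∀ x : Fin n → ℂ, CliffordAlgebra.involute (ExteriorAlgebra.ι ℂ x) =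
          - ExteriorAlgebra.ι ℂ x := fun x => CliffordAlgebra.involute_ι x
        simp [scaleOdd, e]
      exact DFunLike.congr_fun this w
    simp only [map_smul, map_add, h, hf.invariant v hv c]

lemma involute_even {n : ℕ} {a : OddAlg n} (ha : a ∈ extParity ℂ (Fin n → ℂ) 0) :
    CliffordAlgebra.involute a = a := CliffordAlgebra.involute_eq_of_mem_even ha

lemma involute_odd {n : ℕ} {a : OddAlg n} (ha : a ∈ extParity ℂ (Fin n → ℂ) 1) :
    CliffordAlgebra.involute a = -a := CliffordAlgebra.involute_eq_of_mem_odd ha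

lemma even_component {n : ℕ} {a b : OddAlg n} (ha : a ∈ extParity ℂ (Fin n → ℂ) 0)
    (hb : b ∈ extParity ℂ (Fin n → ℂ) 1) :
    (2 : ℂ)⁻¹ • ((a + b) + (1 : ℂ) • CliffordAlgebra.involute (a + b)) = a := by
  rw [map_add, involute_even ha, involute_odd hb, one_smul, add_add_add_comm, add_neg_cancel,
    add_zero, ← two_smul ℂ a, smul_smul]
  norm_num

lemma odd_component {n : ℕ} {a b : OddAlg n} (ha : a ∈ extParity ℂ (Fin n → ℂ) 0)
    (hb : b ∈ extParity ℂ (Fin n → ℂ) 1) :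
    (2 : ℂ)⁻¹ • ((a + b) + (-1 : ℂ) • CliffordAlgebra.involute (a + b)) = b := by
  have e : (a + b) + (-1 : ℂ) • (a + -b) = (2 : ℂ) • b := by module
  rw [map_add, involute_even ha, involute_odd hb, e, smul_smul]
  norm_num

lemma germ_algebraMap {m n : ℕ} (p : ProjSpace m) (c : ℂ) :
    algebraMap ℂ (Germ (coneNhds p) (OddAlg n)) c =
      ((fun _ => algebraMap ℂ (OddAlg n) c : CSpace m → OddAlg n) : Germ _ _) := by
  rw [Algebra.algebraMap_eq_smul_one]
  refine Eq.trans (b := ((c • (1 : CSpace m → OddAlg n) : CSpace m → OddAlg n) : Germ _ _)) rfl ?_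
  refine Germ.coe_eq.2 (Filter.Eventually.of_forall fun v => ?_)
  exact (Algebra.algebraMap_eq_smul_one c).symm

/-- The stalk at `p` of the structure sheaf of `ℙ^{m|n}`: germs of superfunctions. -/
def projStalk (m n : ℕ) (p : ProjSpace m) : Subalgebra ℂ (Germ (coneNhds p) (OddAlg n)) where
  carrier := {g | ∃ U : Opens (ProjSpace m), p ∈ U ∧ ∃ f : CSpace m → OddAlg n,
    IsSuperfunction (U : Set (ProjSpace m)) f ∧ g = f}
  mul_mem' := by
    rintro _ _ ⟨U, hU, f, hf, rfl⟩ ⟨V, hV, g, hg, rfl⟩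
    exact ⟨U ⊓ V, ⟨hU, hV⟩, f * g,
      (hf.mono Set.inter_subset_left).mul (hg.mono Set.inter_subset_right), rfl⟩
  add_mem' := by
    rintro _ _ ⟨U, hU, f, hf, rfl⟩ ⟨V, hV, g, hg, rfl⟩
    exact ⟨U ⊓ V, ⟨hU, hV⟩, f + g,
      (hf.mono Set.inter_subset_left).add (hg.mono Set.inter_subset_right), rfl⟩
  algebraMap_mem' c := ⟨⊤, trivial, _, isSuperfunction_const _ c, germ_algebraMap p c⟩

/-- The germ at `p` of a superfunction on a neighbourhood of `p`. -/
def IsSuperfunction.germ {m n : ℕ} {U : Opens (ProjSpace m)} {f : CSpace m → OddAlg n}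
    (hf : IsSuperfunction (U : Set (ProjSpace m)) f) {p : ProjSpace m} (hp : p ∈ U) :
    projStalk m n p :=
  ⟨f, U, hp, f, hf, rfl⟩

/-- The even and odd germs: those taking values in the even, respectively odd, part of `ℂ[θ]`. -/
def projParity (m n : ℕ) (p : ProjSpace m) (i : ZMod 2) : Submodule ℂ (projStalk m n p) where
  carrier := {g | Germ.LiftPred (fun w => w ∈ extParity ℂ (Fin n → ℂ) i) g.1}
  add_mem' := by
    rintro ⟨_, U, hU, f, hf, rfl⟩ ⟨_, V, hV, g, hg, rfl⟩ h₁ h₂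
    have h₁ : ∀ᶠ v in coneNhds p, f v ∈ extParity ℂ (Fin n → ℂ) i := h₁
    have h₂ : ∀ᶠ v in coneNhds p, g v ∈ extParity ℂ (Fin n → ℂ) i := h₂
    change ∀ᶠ v in coneNhds p, f v + g v ∈ extParity ℂ (Fin n → ℂ) i
    filter_upwards [h₁, h₂] with v h h' using Submodule.add_mem _ h h'
  zero_mem' := show ∀ᶠ _ in coneNhds p, (0 : OddAlg n) ∈ extParity ℂ (Fin n → ℂ) i from Filter.Eventually.of_forall fun _ => Submodule.zero_mem _
  smul_mem' := by
    rintro c ⟨_, U, hU, f, hf, rfl⟩ h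
    have h : ∀ᶠ v in coneNhds p, f v ∈ extParity ℂ (Fin n → ℂ) i := h
    change ∀ᶠ v in coneNhds p, c • f v ∈ extParity ℂ (Fin n → ℂ) i
    filter_upwards [h] with v h using Submodule.smul_mem _ _ h

/-- The presheaf of superfunctions on `ℙ^m`. -/
def projPrelocal (m n : ℕ) :
    TopCat.PrelocalPredicate (X := TopCat.of (ProjSpace m)) (fun p => projStalk m n p) where
  pred {U} s := ∃ f : CSpace m → OddAlg n, IsSuperfunction (U : Set (ProjSpace m)) f ∧
    ∀ p : U, (s p).1 = (f : Germ (coneNhds p.1) (OddAlg n))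
  res {_ _} i _ := fun ⟨f, hf, h⟩ => ⟨f, hf.mono i.le, fun p => h ⟨p.1, i.le p.2⟩⟩

lemma germ_mem_parity {m n : ℕ} {p : ProjSpace m} {i : ZMod 2} {g : projStalk m n p}
    {f : CSpace m → OddAlg n} (hg : g.1 = f) :
    g ∈ projParity m n p i ↔ ∃ U : Opens (ProjSpace m), p ∈ U ∧
      ∀ v ∈ cone (U : Set (ProjSpace m)), f v ∈ extParity ℂ (Fin n → ℂ) i := by
  change Germ.LiftPred _ g.1 ↔ _
  rw [hg, Germ.liftPred_coe]
  exact mem_coneNhds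

lemma exists_components {n : ℕ} (w : OddAlg n) :
    ∃ a ∈ extParity ℂ (Fin n → ℂ) 0, ∃ b ∈ extParity ℂ (Fin n → ℂ) 1, w = a + b := by
  obtain ⟨a, ha, b, hb, hab⟩ := Submodule.mem_sup.1
    ((CliffordAlgebra.evenOdd_isCompl (0 : QuadraticForm ℂ (Fin n → ℂ))).sup_eq_top ▸
      Submodule.mem_top : w ∈ _)
  exact ⟨a, ha, b, hb, hab.symm⟩

/-- Projective superspace `ℙ^{m|n}`. -/
def projSuperspace (m n : ℕ) : Superspace where
  carrier := TopCat.of (ProjSpace m)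
  stalk p := projStalk m n p
  sheaf := (projPrelocal m n).sheafify
  germ_surjective := by
    rintro p ⟨_, U, hp, f, hf, rfl⟩
    exact ⟨U, hp, fun q => hf.germ q.2,
      TopCat.PrelocalPredicate.sheafifyOf ⟨f, hf, fun _ => rfl⟩, rfl⟩
  germ_injective U s t hs ht x hxy := by
    obtain ⟨V₁, m₁, i₁, f, hf, e₁⟩ := hs x
    obtain ⟨V₂, m₂, i₂, g, hg, e₂⟩ := ht x
    have e : (f : Germ (coneNhds x.1) (OddAlg n)) = g := by
      rw [← e₁ ⟨x.1, m₁⟩, ← e₂ ⟨x.1, m₂⟩]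
      exact congrArg Subtype.val hxy
    obtain ⟨O, hO, h⟩ := germ_eq_iff.1 e
    refine ⟨V₁ ⊓ V₂ ⊓ O, ⟨⟨m₁, m₂⟩, hO⟩, fun y hy => i₁.le hy.1.1, fun y => Subtype.ext ?_⟩
    exact ((e₁ ⟨y.1, y.2.1.1⟩).trans (germ_eq_iff.2 ⟨O, y.2.2, h⟩)).trans
      (e₂ ⟨y.1, y.2.1.2⟩).symm
  algebraMap_mem U c := TopCat.PrelocalPredicate.sheafifyOf
    ⟨_, isSuperfunction_const _ c, fun p => germ_algebraMap p.1 c⟩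
  add_mem U s t hs ht :=
    (projPrelocal m n).sheafify_inductionOn₂' (projPrelocal m n) (projPrelocal m n)
      (fun {p} (a b : projStalk m n p) => a + b)
      (fun {U V a b} ⟨f, hf, e₁⟩ ⟨g, hg, e₂⟩ =>
        ⟨f + g, (hf.mono Set.inter_subset_left).add (hg.mono Set.inter_subset_right),
          fun x => (congrArg₂ (· + ·) (e₁ ⟨x.1, x.2.1⟩) (e₂ ⟨x.1, x.2.2⟩) :)⟩) hs ht
  mul_mem U s t hs ht :=
    (projPrelocal m n).sheafify_inductionOn₂' (projPrelocal m n) (projPrelocal m n)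
      (fun {p} (a b : projStalk m n p) => a * b)
      (fun {U V a b} ⟨f, hf, e₁⟩ ⟨g, hg, e₂⟩ =>
        ⟨f * g, (hf.mono Set.inter_subset_left).mul (hg.mono Set.inter_subset_right),
          fun x => (congrArg₂ (· * ·) (e₁ ⟨x.1, x.2.1⟩) (e₂ ⟨x.1, x.2.2⟩) :)⟩) hs ht
  parity p := projParity m n p
  parity_isCompl p := by
    constructor
    · rw [Submodule.disjoint_def]
      rintro ⟨_, U, hU, f, hf, rfl⟩ h₀ h₁
      apply Subtype.ext
      refine Germ.coe_eq.2 ?_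
      filter_upwards [Germ.liftPred_coe.1 h₀, Germ.liftPred_coe.1 h₁] with v h h'
      exact Submodule.disjoint_def.1
        (CliffordAlgebra.evenOdd_isCompl (0 : QuadraticForm ℂ (Fin n → ℂ))).disjoint _ h h'
    · rw [codisjoint_iff, eq_top_iff]
      rintro ⟨_, U, hU, f, hf, rfl⟩ -
      refine Submodule.mem_sup.2 ⟨(hf.component 1).germ hU, ?_, (hf.component (-1)).germ hU, ?_, ?_⟩
      · refine (germ_mem_parity rfl).2 ⟨⊤, trivial, fun v _ => ?_⟩
        obtain ⟨a, ha, b, hb, e⟩ := exists_components (f v)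
        simp only [e, even_component ha hb, ha]
      · refine (germ_mem_parity rfl).2 ⟨⊤, trivial, fun v _ => ?_⟩
        obtain ⟨a, ha, b, hb, e⟩ := exists_components (f v)
        simp only [e, odd_component ha hb, hb]
      · refine Subtype.ext (germ_eq_iff.2 ⟨⊤, trivial, fun v _ => ?_⟩)
        obtain ⟨a, ha, b, hb, e⟩ := exists_components (f v)
        simp only [e, even_component ha hb, odd_component ha hb]
  parity_one p := show ∀ᶠ _ in coneNhds p, (1 : OddAlg n) ∈ extParity ℂ (Fin n → ℂ) 0 from Filter.Eventually.of_forall fun _ => SetLike.GradedOne.one_mem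
  parity_mul p i j := by
    rintro ⟨_, U, hU, f, hf, rfl⟩ h₁ ⟨_, V, hV, g, hg, rfl⟩ h₂
    change ∀ᶠ v in coneNhds p, f v * g v ∈ _
    filter_upwards [Germ.liftPred_coe.1 h₁, Germ.liftPred_coe.1 h₂] with v h h'
    exact SetLike.GradedMul.mul_mem h h'
  parity_sections U s s₀ s₁ hs h₀ h₁ e := by
    have main : ∀ x : U, ∃ (V : Opens (TopCat.of (ProjSpace m))) (_ : x.1 ∈ V) (i : V ⟶ U),
        (projPrelocal m n).pred (fun y : V => s₀ ⟨y.1, i.le y.2⟩) ∧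
        (projPrelocal m n).pred (fun y : V => s₁ ⟨y.1, i.le y.2⟩) := by
      intro x
      obtain ⟨V, hx, i, f, hf, hs⟩ := hs x
      have key : ∀ y : V, (s₀ ⟨y.1, i.le y.2⟩) = (hf.component 1).germ y.2 ∧
          (s₁ ⟨y.1, i.le y.2⟩) = (hf.component (-1)).germ y.2 := by
        intro y
        have k₀ := h₀ ⟨y.1, i.le y.2⟩
        have k₁ := h₁ ⟨y.1, i.le y.2⟩
        have ke := e ⟨y.1, i.le y.2⟩
        have ks : (s ⟨y.1, i.le y.2⟩).1 = (f : Germ (coneNhds y.1) (OddAlg n)) := hs y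
        rw [ke] at ks
        generalize s₀ ⟨y.1, i.le y.2⟩ = a at *
        generalize s₁ ⟨y.1, i.le y.2⟩ = b at *
        obtain ⟨_, U₁, hU₁, a, ha, rfl⟩ := a
        obtain ⟨_, U₂, hU₂, b, hb, rfl⟩ := b
        have ks' : ∀ᶠ v in coneNhds y.1, a v + b v = f v := Germ.coe_eq.1 ks
        constructor
        · refine Subtype.ext (Germ.coe_eq.2 ?_)
          filter_upwards [ks', Germ.liftPred_coe.1 k₀, Germ.liftPred_coe.1 k₁] with v q q₀ q₁
          rw [← q, even_component q₀ q₁]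
        · refine Subtype.ext (Germ.coe_eq.2 ?_)
          filter_upwards [ks', Germ.liftPred_coe.1 k₀, Germ.liftPred_coe.1 k₁] with v q q₀ q₁
          rw [← q, odd_component q₀ q₁]
      exact ⟨V, hx, i, ⟨_, hf.component 1, fun y => congrArg Subtype.val (key y).1⟩,
        ⟨_, hf.component (-1), fun y => congrArg Subtype.val (key y).2⟩⟩
    exact ⟨fun x => let ⟨V, m, i, h, _⟩ := main x; ⟨V, m, i, h⟩,
      fun x => let ⟨V, m, i, _, h⟩ := main x; ⟨V, m, i, h⟩⟩
  even_comm p := by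
    rintro ⟨_, U, hU, f, hf, rfl⟩ h₁ ⟨_, V, hV, g, hg, rfl⟩
    refine Subtype.ext (Germ.coe_eq.2 ?_)
    filter_upwards [Germ.liftPred_coe.1 h₁] with v h using even_mul_comm h _
  odd_comm p := by
    rintro ⟨_, U, hU, f, hf, rfl⟩ h₁ ⟨_, V, hV, g, hg, rfl⟩ h₂
    refine Subtype.ext (Germ.coe_eq.2 ?_)
    filter_upwards [Germ.liftPred_coe.1 h₁, Germ.liftPred_coe.1 h₂] with v h h'
      using odd_mul_comm h h'

/-! ### Subvarieties of projective superspace -/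

/-- The polynomial superalgebra `ℂ[x₀, …, x_m | θ₁, …, θ_n]`. -/
abbrev SuperPoly (m n : ℕ) : Type := MvPolynomial (Fin (m + 1)) ℂ ⊗[ℂ] OddAlg n

/-- The superpolynomials that are homogeneous of degree `d`, where all the `x_i` and `θ_a` have
degree one: the coefficient of a monomial of length `j` in the `θ_a` is homogeneous of degree
`d - j` (and zero if `j > d`). -/
def homogeneousPart (m n d : ℕ) : Submodule ℂ (SuperPoly m n) :=
  Submodule.span ℂ {P | ∃ i j : ℕ, i + j = d ∧
    ∃ p ∈ MvPolynomial.homogeneousSubmodule (Fin (m + 1)) ℂ i,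
    ∃ w ∈ ⋀[ℂ]^j (Fin n → ℂ), P = p ⊗ₜ[ℂ] w}

/-- The even (`i = 0`) and odd (`i = 1`) superpolynomials. -/
def polyParity (m n : ℕ) (i : ZMod 2) : Submodule ℂ (SuperPoly m n) :=
  Submodule.span ℂ {P | ∃ p, ∃ w ∈ extParity ℂ (Fin n → ℂ) i, P = p ⊗ₜ[ℂ] w}

/-- An ideal of the polynomial superalgebra is `ℤ/2`-graded if it contains the even and odd
components of its elements. -/
def IsParityGraded {m n : ℕ} (I : TwoSidedIdeal (SuperPoly m n)) : Prop :=
  ∀ P ∈ I, ∃ P₀ ∈ I, ∃ P₁ ∈ I, P₀ ∈ polyParity m n 0 ∧ P₁ ∈ polyParity m n 1 ∧ P = P₀ + P₁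

/-- The ideal `I` is generated by finitely many homogeneous superpolynomials of degree `d`; the
subvariety of `ℙ^{m|n}` that it defines is then of degree `d`. -/
def HasDegree {m n : ℕ} (I : TwoSidedIdeal (SuperPoly m n)) (d : ℕ) : Prop :=
  ∃ (k : ℕ) (P : Fin k → SuperPoly m n), (∀ α, P α ∈ homogeneousPart m n d) ∧
    I = TwoSidedIdeal.span (Set.range P)

/-- Evaluation `P(x|θ) ↦ P(v|θ)` of a superpolynomial at a point `v ∈ ℂ^{m+1}`. -/
def superEval {m n : ℕ} (v : CSpace m) : SuperPoly m n →ₐ[ℂ] OddAlg n :=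
  Algebra.TensorProduct.lift ((Algebra.ofId ℂ (OddAlg n)).comp (MvPolynomial.aeval v))
    (AlgHom.id ℂ (OddAlg n)) (fun p w => by
      rw [AlgHom.comp_apply]; exact Algebra.commutes _ _)

lemma superEval_tmul {m n : ℕ} (v : CSpace m) (p : MvPolynomial (Fin (m + 1)) ℂ) (w : OddAlg n) :
    superEval v (p ⊗ₜ[ℂ] w) = MvPolynomial.eval v p • w := by
  simp [superEval, Algebra.ofId_apply, Algebra.smul_def, MvPolynomial.aeval_eq_eval]

/-- The fraction `P / Q` of a superpolynomial `P` and a polynomial `Q`, as a function on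
`ℂ^{m+1}` with values in `ℂ[θ]`. -/
def superFrac {m n : ℕ} (P : SuperPoly m n) (Q : MvPolynomial (Fin (m + 1)) ℂ) :
    CSpace m → OddAlg n :=
  fun v => (MvPolynomial.eval v Q)⁻¹ • superEval v P

lemma scaleOdd_of_mem {n j : ℕ} (c : ℂ) {w : OddAlg n} (hw : w ∈ ⋀[ℂ]^j (Fin n → ℂ)) :
    scaleOdd c w = c ^ j • w := by
  induction hw using Submodule.pow_induction_on_left' with
  | algebraMap r => simp
  | add x y i _ _ hx hy => rw [map_add, hx, hy, smul_add]
  | mem_mul a ha i x _ hx =>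
    obtain ⟨v, rfl⟩ := ha
    have : scaleOdd c (ExteriorAlgebra.ι ℂ v) = c • ExteriorAlgebra.ι ℂ v := by
      simp [scaleOdd]
    rw [map_mul, hx, this, smul_mul_smul_comm, Nat.succ_eq_add_one, pow_succ']

lemma eval_smul_of_isHomogeneous {m i : ℕ} {p : MvPolynomial (Fin (m + 1)) ℂ}
    (hp : p.IsHomogeneous i) (c : ℂ) (v : CSpace m) :
    MvPolynomial.eval (c • v) p = c ^ i * MvPolynomial.eval v p := by
    rw [MvPolynomial.eval_eq, MvPolynomial.eval_eq, Finset.mul_sum]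
    refine Finset.sum_congr rfl fun e he => ?_
    have hd : e.degree = i := by
      rw [Finsupp.degree_eq_weight_one]; exact hp (MvPolynomial.mem_support_iff.1 he)
    simp only [Pi.smul_apply, smul_eq_mul, mul_pow, Finset.prod_mul_distrib,
      Finset.prod_pow_eq_pow_sum]
    rw [show ∑ a ∈ e.support, e a = i from hd]
    ring

lemma scaleOdd_superEval {m n d : ℕ} {P : SuperPoly m n} (hP : P ∈ homogeneousPart m n d)
    (c : ℂ) (v : CSpace m) : scaleOdd c (superEval (c • v) P) = c ^ d • superEval v P := by
  induction hP using Submodule.span_induction with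
  | mem P hP =>
    obtain ⟨i, j, rfl, p, hp, w, hw, rfl⟩ := hP
    have hp : p.IsHomogeneous i := hp
    have e := eval_smul_of_isHomogeneous hp c v
    rw [superEval_tmul, superEval_tmul, map_smul, scaleOdd_of_mem c hw, e, smul_smul, smul_smul,
      pow_add]
    congr 1; ring
  | zero => simp
  | add P P' _ _ h h' => simp only [map_add, h, h', smul_add]
  | smul a P _ h => simp only [map_smul, h, smul_comm a]

lemma differentiable_eval {m : ℕ} (p : MvPolynomial (Fin (m + 1)) ℂ) :
    Differentiable ℂ (fun v : CSpace m => MvPolynomial.eval v p) := by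
  induction p using MvPolynomial.induction_on with
  | C a => simp
  | add p q hp hq => simp only [map_add]; exact hp.add hq
  | mul_X p i hp => simp only [map_mul, MvPolynomial.eval_X]; exact hp.mul (differentiable_apply i)

lemma differentiable_superEval {m n : ℕ} (P : SuperPoly m n) (φ : Module.Dual ℂ (OddAlg n)) :
    Differentiable ℂ (fun v => φ (superEval v P)) := by
  induction P using TensorProduct.induction_on with
  | zero => simp
  | tmul p w =>
    simp only [superEval_tmul, map_smul]
    exact (differentiable_eval p).smul_const _
  | add P P' h h' => simp only [map_add]; exact h.add h'

lemma even_superEval {m n : ℕ} {i : ZMod 2} {P : SuperPoly m n} (hP : P ∈ polyParity m n i)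
    (v : CSpace m) : superEval v P ∈ extParity ℂ (Fin n → ℂ) i := by
  induction hP using Submodule.span_induction with
  | mem P hP =>
    obtain ⟨p, w, hw, rfl⟩ := hP
    rw [superEval_tmul]
    exact Submodule.smul_mem _ _ hw
  | zero => rw [map_zero]; exact Submodule.zero_mem _
  | add P P' _ _ h h' => rw [map_add]; exact Submodule.add_mem _ h h'
  | smul a P _ h => rw [map_smul]; exact Submodule.smul_mem _ _ h

/-- The open subset of `ℙ^m` on which a homogeneous polynomial does not vanish. -/
def nonvanishing {m d : ℕ} {Q : MvPolynomial (Fin (m + 1)) ℂ} (hQ : Q.IsHomogeneous d) :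
    Opens (ProjSpace m) where
  carrier := {p | MvPolynomial.eval p.rep Q ≠ 0}
  is_open' := by
    refine isOpen_coinduced.2 ?_
    have : (Projectivization.mk' ℂ : {v : CSpace m // v ≠ 0} → ProjSpace m) ⁻¹'
        {p | MvPolynomial.eval p.rep Q ≠ 0} = {v | MvPolynomial.eval v.1 Q ≠ 0} := by
      ext ⟨v, hv⟩
      obtain ⟨a, ha⟩ := Projectivization.exists_smul_eq_mk_rep ℂ v hv
      change MvPolynomial.eval (Projectivization.mk ℂ v hv).rep Q ≠ 0 ↔ MvPolynomial.eval v Q ≠ 0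
      rw [← ha, Units.smul_def, eval_smul_of_isHomogeneous hQ]
      simp
    rw [this]
    exact isOpen_ne_fun ((differentiable_eval Q).continuous.comp continuous_subtype_val)
      continuous_const

lemma eval_ne_zero_of_mem_cone {m d : ℕ} {Q : MvPolynomial (Fin (m + 1)) ℂ}
    (hQ : Q.IsHomogeneous d) {v : CSpace m}
    (hv : v ∈ cone (nonvanishing hQ : Set (ProjSpace m))) : MvPolynomial.eval v Q ≠ 0 := by
  obtain ⟨h0, hv⟩ := hv
  obtain ⟨a, ha⟩ := Projectivization.exists_smul_eq_mk_rep ℂ v h0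
  change MvPolynomial.eval (Projectivization.mk ℂ v h0).rep Q ≠ 0 at hv
  rw [← ha, Units.smul_def, eval_smul_of_isHomogeneous hQ] at hv
  exact right_ne_zero_of_mul hv

lemma isSuperfunction_superFrac {m n d : ℕ} {P : SuperPoly m n}
    {Q : MvPolynomial (Fin (m + 1)) ℂ} (hP : P ∈ homogeneousPart m n d)
    (hQ : Q.IsHomogeneous d) :
    IsSuperfunction (nonvanishing hQ : Set (ProjSpace m)) (superFrac P Q) where
  holomorphic φ := by
    simp only [superFrac, map_smul]
    exact ((differentiable_eval Q).differentiableOn.inv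
      fun v hv => eval_ne_zero_of_mem_cone hQ hv).smul (differentiable_superEval P φ).differentiableOn
  invariant v hv c := by
    simp only [superFrac, map_smul]
    rw [scaleOdd_superEval hP, eval_smul_of_isHomogeneous hQ, mul_inv, smul_smul, mul_right_comm,
      inv_mul_cancel₀ (pow_ne_zero _ c.ne_zero), one_mul]

/-- The germs at `p` of the fractions `P / Q` with `P` in the ideal `I`, homogeneous and of
definite parity, and `Q(x)` homogeneous of the same degree with `Q(p) ≠ 0`. -/
def fracGerms {m n : ℕ} (I : TwoSidedIdeal (SuperPoly m n)) (p : ProjSpace m) :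
    Set (projStalk m n p) :=
  {g | ∃ (d : ℕ) (i : ZMod 2), ∃ P ∈ I, P ∈ homogeneousPart m n d ∧ P ∈ polyParity m n i ∧
    ∃ Q : MvPolynomial (Fin (m + 1)) ℂ, Q.IsHomogeneous d ∧ MvPolynomial.eval p.rep Q ≠ 0 ∧
      g.1 = (superFrac P Q : Germ (coneNhds p) (OddAlg n))}

/-- The ideal sheaf on `ℙ^{m|n}` defined by an ideal `I` of `ℂ[x|θ]`: its stalk at `p` is
generated by the germs at `p` of the degree-zero fractions with numerator in `I`. -/
def projIdealSheaf {m n : ℕ} (I : TwoSidedIdeal (SuperPoly m n)) :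
    IdealSheaf (projSuperspace m n) :=
  IdealSheaf.span (projSuperspace m n) (fun p => fracGerms I p)
    (by
      rintro p a ⟨d, i, P, hPI, hP, hPi, Q, hQ, hp, e⟩
      exact ⟨nonvanishing hQ, hp, fun q => (isSuperfunction_superFrac hP hQ).germ q.2,
        TopCat.PrelocalPredicate.sheafifyOf ⟨_, isSuperfunction_superFrac hP hQ, fun _ => rfl⟩,
        Subtype.ext e.symm, fun q => ⟨d, i, P, hPI, hP, hPi, Q, hQ, q.2, rfl⟩⟩)
    (by
      rintro p a ⟨d, i, P, hPI, hP, hPi, Q, hQ, hp, e⟩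
      exact ⟨i, (germ_mem_parity e).2
        ⟨⊤, trivial, fun v _ => Submodule.smul_mem _ _ (even_superEval hPi v)⟩⟩)

/-- The zero locus `V ⊆ ℙ^m` of the polynomials `P(x|0)`, `P ∈ I`. -/
def zeroLocus {m n : ℕ} (I : TwoSidedIdeal (SuperPoly m n)) : Set (ProjSpace m) :=
  {p | ∀ P ∈ I, ∀ v : CSpace m, ∀ hv : v ≠ 0, Projectivization.mk ℂ v hv = p →
    ExteriorAlgebra.algebraMapInv (superEval v P) = 0}

/-- The subvariety of `ℙ^{m|n}` defined by an ideal `I` of `ℂ[x|θ]`: its underlying space is the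
zero locus of `I`, and its structure sheaf is the quotient of that of `ℙ^{m|n}` by the ideal
sheaf of `I`. -/
def projSubvariety {m n : ℕ} (I : TwoSidedIdeal (SuperPoly m n)) : Superspace :=
  (projSuperspace m n).subspace (projIdealSheaf I) (zeroLocus I)

/-! ### Supergeometries and splitting -/

section Supergeometry

variable (k : ℕ) (X : Type) [TopologicalSpace X] [ChartedSpace (EuclideanSpace ℂ (Fin k)) X]

/-- The stalk at `x` of the sheaf of holomorphic functions on a `k`-dimensional complex
manifold. -/
def holStalk (x : X) : Subalgebra ℂ (Germ (𝓝 x) ℂ) where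
  carrier := {g | ∃ f : X → ℂ,
    ContMDiffAt 𝓘(ℂ, EuclideanSpace ℂ (Fin k)) 𝓘(ℂ) ω f x ∧ g = f}
  mul_mem' := by
    rintro _ _ ⟨f, hf, rfl⟩ ⟨g, hg, rfl⟩
    exact ⟨f * g, hf.mul hg, rfl⟩
  add_mem' := by
    rintro _ _ ⟨f, hf, rfl⟩ ⟨g, hg, rfl⟩
    exact ⟨f + g, hf.add hg, rfl⟩
  algebraMap_mem' c := ⟨fun _ => c, contMDiffAt_const, by
    rw [Algebra.algebraMap_eq_smul_one]
    refine Eq.trans (b := ((c • (1 : X → ℂ) : X → ℂ) : Germ _ _)) rfl ?_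
    exact Germ.coe_eq.2 (Filter.Eventually.of_forall fun v => by simp)⟩

/-- A family of germs on the open set `U` is a section of the sheaf of holomorphic functions. -/
def IsHolSection (U : Opens X) (s : ∀ x : U, holStalk k X x) : Prop :=
  ∃ f : X → ℂ, ContMDiffOn 𝓘(ℂ, EuclideanSpace ℂ (Fin k)) 𝓘(ℂ) ω f U ∧
    ∀ x : U, (s x).1 = (f : Germ (𝓝 x.1) ℂ)

/-- A locally free sheaf of modules of rank `r` over the sheaf of holomorphic functions of a
complex manifold `X` (the sheaf of sections of a holomorphic vector bundle), presented by its
stalks and its sections. -/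
structure LocallyFreeSheaf (r : ℕ) where
  stalk : TopCat.of X → Type
  [addCommGroup : ∀ x, AddCommGroup (stalk x)]
  [module : ∀ x : X, Module (holStalk k X x) (stalk x)]
  sheaf : TopCat.LocalPredicate stalk
  /-- near every point there is a frame: a family of `r` sections that is a basis of every stalk,
  and the sections are the combinations of the frame with holomorphic coefficients -/
  frame : ∀ x : X, ∃ (U : Opens X) (_ : x ∈ U)
    (b : ∀ y : U, Module.Basis (Fin r) (holStalk k X y) (stalk y.1)),
    ∀ (W : Opens X) (h : W ≤ U) (s : ∀ y : W, stalk y.1),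
      sheaf.pred (U := W) s ↔
        ∀ i : Fin r, IsHolSection k X W (fun y => (b ⟨y.1, h y.2⟩).repr (s y) i)

attribute [instance] LocallyFreeSheaf.addCommGroup LocallyFreeSheaf.module

variable {k X}

/-- The stalk at `x` of the sheaf of exterior algebras `⋀^• T`. -/
abbrev LocallyFreeSheaf.extStalk {r : ℕ} (T : LocallyFreeSheaf k X r) (x : X) : Type :=
  ExteriorAlgebra (holStalk k X x) (T.stalk x)

/-- Sections of the sheaf `⋀^• T`: families of elements of the stalks that are locally sums of
products of holomorphic functions and sections of `T`. -/
def LocallyFreeSheaf.IsExtSection {r : ℕ} (T : LocallyFreeSheaf k X r) (U : Opens X)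
    (s : ∀ x : U, T.extStalk x) : Prop :=
  ∀ x : U, ∃ (W : Opens X) (_ : x.1 ∈ W) (h : W ≤ U),
    (fun y : W => s ⟨y.1, h y.2⟩) ∈ Subring.closure
      ({a : ∀ y : W, T.extStalk y | ∃ f : ∀ y : W, holStalk k X y, IsHolSection k X W f ∧
          a = fun y : W => algebraMap (holStalk k X y) (T.extStalk y) (f y)} ∪
        {a | ∃ t : ∀ y : W, T.stalk y.1, T.sheaf.pred (U := W) t ∧
          a = fun y : W => ExteriorAlgebra.ι (holStalk k X y) (t y)})

end Supergeometry

/-- An isomorphism of sheaves of `ℂ`-superalgebras from the structure sheaf of the superspace `X`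
to `⋀^• T`, where `T` is a locally free sheaf on a complex manifold with the same underlying
topological space as `X`. -/
structure Superspace.SplittingIso (X : Superspace) {k r : ℕ}
    [ChartedSpace (EuclideanSpace ℂ (Fin k)) X.carrier] (T : LocallyFreeSheaf k X.carrier r) where
  /-- the isomorphisms of stalks -/
  iso : ∀ x : X.carrier, X.stalk x ≃+* T.extStalk x
  /-- they are `ℂ`-linear -/
  map_algebraMap : ∀ (x : X.carrier) (c : ℂ), iso x (algebraMap ℂ (X.stalk x) c) =
    algebraMap (holStalk k X.carrier x) (T.extStalk x) (algebraMap ℂ (holStalk k X.carrier x) c)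
  /-- they preserve the parity -/
  map_parity : ∀ (x : X.carrier) (i : ZMod 2) (a : X.stalk x),
    a ∈ X.parity x i ↔ iso x a ∈ extParity (holStalk k X.carrier x) (T.stalk x) i
  /-- they identify the sections of the two sheaves -/
  map_section : ∀ (U : Opens X.carrier) (s : ∀ x : U, X.stalk x),
    X.sheaf.pred s ↔ T.IsExtSection U (fun x => iso x (s x))

/-- A superspace `X` is split (or: is the split model of a supergeometry) if its underlying space
carries the structure of a complex manifold and a locally free sheaf `T` of finite rank on this
manifold such that the structure sheaf of `X` is globally isomorphic to `⋀^• T`. -/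
def Superspace.IsSplit (X : Superspace) : Prop :=
  T2Space X.carrier ∧ SecondCountableTopology X.carrier ∧
    ∃ (k : ℕ) (_ : ChartedSpace (EuclideanSpace ℂ (Fin k)) X.carrier),
      IsManifold 𝓘(ℂ, EuclideanSpace ℂ (Fin k)) ω X.carrier ∧
      ∃ (r : ℕ) (T : LocallyFreeSheaf k X.carrier r), Nonempty (X.SplittingIso T)

end SuperGeometry

end

noncomputable section

namespace SuperGeometry

/-! ### Holomorphic functions of several variables -/

/-! A superpolynomial of degree one is the sum of a linear form in `x` and a linear form in `θ`, and
in a graded ideal both summands of a generator lie in the ideal. So `I` is generated by even and odd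
linear forms. Let `L ⊆ ℂ^{m+1}` be the common kernel of the even ones. If `L = 0`, the zero locus is
empty and there is nothing to split. Otherwise put `k + 1 = dim L` and let `r` be the codimension of
the space of odd forms in `I`. Then the subvariety is a copy of `ℙ^{k|r}` (`LinearParam.projIso`),
and `ℙ^{k|r}` is split (`Superspace.ProjIso.isSplit`).

For the first claim, choose a parametrization of `L` with a linear left inverse, and the quotient
map on odd coordinates with a linear section. Pulling back along these gives a restriction and an
extension of germs. Restriction after extension is the identity, and restriction kills the ideal
sheaf. That extension after restriction is the identity modulo the ideal sheaf need only be checked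
on scalar functions and on the `θ_a / x_j`, which generate the stalks. For a scalar function `F`
this is Hadamard's lemma: with `A` the retraction onto `L`, `F(x) - F(A x)` is a combination of the
degree-zero fractions `(x - A x)_b / x_j`, integrated along the segment from `A x` to `x`
(`IsScalarFunction.eq_add_sum`, `scalar_sub_mem`). For `θ_a / x_j` it is an explicit identity
(`odd_sub_mem`).

For the second claim, invariance under scaling makes the coefficient of a monomial of length `d` in
the `θ_a` homogeneous of degree `-d`. Hence the structure sheaf is the exterior algebra of
`𝒪(-1)^r`, with the `θ_a / x_j` as a frame where `x_j ≠ 0` (`extToStalk_bijective`, `pred_sum_iff`,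
`pred_iff_isExtSection`).

Superfunctions are only required to be complex differentiable, whereas functions on the manifold are
analytic. Both the comparison of the two and Hadamard's lemma rest on the fact that a complex
differentiable function of several variables is analytic, which is derived from Cauchy's formula on
a polydisc. -/

lemma norm_torusMap_sub {n : ℕ} (c : Fin n → ℂ) {R : ℝ} (hR : 0 < R) (t : Fin n → ℝ) (i : Fin n) :
    ‖torusMap c (fun _ => R) t i - c i‖ = R := by
  simp [torusMap, abs_of_pos hR]

lemma continuous_torusMap {n : ℕ} (c : Fin n → ℂ) (R : Fin n → ℝ) : Continuous (torusMap c R) := by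
  unfold torusMap; fun_prop

lemma continuous_torusMap_apply {n : ℕ} (c : Fin n → ℂ) (R : Fin n → ℝ) (i : Fin n) :
    Continuous fun t => torusMap c R t i := by
  unfold torusMap; fun_prop

/-- The Cauchy integral formula on a polydisc. -/
lemma torusIntegral_cauchy {n : ℕ} (c w : Fin n → ℂ) {R : ℝ} (hR : 0 < R) (f : (Fin n → ℂ) → ℂ)
    (hf : ∀ x : Fin n → ℂ, (∀ i, ‖x i - c i‖ ≤ R) → DifferentiableAt ℂ f x)
    (hw : ∀ i, ‖w i - c i‖ < R) :
    (∯ x in T(c, fun _ => R), (∏ i, (x i - w i)⁻¹) * f x) =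
      (2 * Real.pi * Complex.I) ^ n * f w := by
  induction n with
  | zero =>
    rw [torusIntegral_dim0]
    simp [Subsingleton.elim w c]
  | succ n ih =>
    have hint : TorusIntegrable (fun x => (∏ i, (x i - w i)⁻¹) * f x) c (fun _ => R) := by
      refine Continuous.integrableOn_Icc (Continuous.mul (continuous_finsetProd _ fun i _ =>
        Continuous.inv₀ ?_ ?_) (continuous_iff_continuousAt.2 fun t => ?_))
      · exact (continuous_torusMap_apply _ _ i).sub continuous_const
      · intro t h
        have h1 := norm_torusMap_sub c hR t i
        rw [sub_eq_zero.1 h] at h1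
        exact (hw i).ne h1
      · exact ((hf _ fun i => (norm_torusMap_sub c hR t i).le).continuousAt).comp
          (continuous_torusMap _ _).continuousAt
    rw [torusIntegral_succ hint]
    -- With the first coordinate fixed on its circle, the induction hypothesis evaluates the
    -- integral over the other `n` circles. What is left is Cauchy's formula in one variable.
    have inner : ∀ x ∈ Metric.sphere (c 0) R,
        (∯ y in T(c ∘ Fin.succ, (fun _ => R) ∘ Fin.succ),
          (∏ i, ((Fin.cons x y : Fin (n + 1) → ℂ) i - w i)⁻¹) * f (Fin.cons x y)) =
        (x - w 0)⁻¹ • ((2 * Real.pi * Complex.I) ^ n * f (Fin.cons x (w ∘ Fin.succ))) := by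
      intro x hx
      have hx' : ‖x - c 0‖ ≤ R := by
        rw [← dist_eq_norm]; exact (Metric.mem_sphere.1 hx).le
      have := ih (c ∘ Fin.succ) (w ∘ Fin.succ) (fun y => f (Fin.cons x y))
        (fun y hy => by
          refine DifferentiableAt.comp (g := f) y (hf _ ?_) ?_
          · exact Fin.cases hx' hy
          · refine differentiableAt_pi.2 fun i => ?_
            refine Fin.cases ?_ (fun j => ?_) i
            · simp
            · simp only [Fin.cons_succ]; exact differentiableAt_apply j y)
        (fun i => hw i.succ)
      rw [← this, smul_eq_mul, ← torusIntegral_const_mul]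
      congr 1
      funext y
      rw [Fin.prod_univ_succ]
      simp only [Fin.cons_zero, Fin.cons_succ, Function.comp_apply]
      ring
    rw [circleIntegral.integral_congr hR.le inner]
    have hd : DifferentiableOn ℂ
        (fun x => (2 * Real.pi * Complex.I) ^ n * f (Fin.cons x (w ∘ Fin.succ)))
        (Metric.closedBall (c 0) R) := by
      intro x hx
      refine ((DifferentiableAt.comp (g := f) x (hf _ ?_) ?_).const_mul _).differentiableWithinAt
      · refine Fin.cases ?_ fun j => (hw j.succ).le
        rw [← dist_eq_norm]; exact hx
      · refine differentiableAt_pi.2 fun i => ?_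
        refine Fin.cases ?_ (fun j => ?_) i
        · simp
        · simp
    rw [hd.circleIntegral_sub_inv_smul (by simpa [dist_eq_norm] using hw 0), smul_eq_mul,
      show (Fin.cons (w 0) (w ∘ Fin.succ) : Fin (n + 1) → ℂ) = w from Fin.cons_self_tail w]
    ring

/-- Integration over `[0, 2π]^n` as a continuous functional on bounded continuous functions. -/
def boxIntegral (n : ℕ) : BoundedContinuousFunction (Fin n → ℝ) ℂ →L[ℂ] ℂ :=
  have hi (f : BoundedContinuousFunction (Fin n → ℝ) ℂ) :
      MeasureTheory.IntegrableOn f (Set.Icc (0 : Fin n → ℝ) fun _ => 2 * Real.pi) :=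
    f.continuous.integrableOn_Icc
  LinearMap.mkContinuous
    { toFun := fun f => ∫ t in Set.Icc (0 : Fin n → ℝ) fun _ => 2 * Real.pi, f t
      map_add' := fun f g => MeasureTheory.integral_add (hi f) (hi g)
      map_smul' := fun a f => MeasureTheory.integral_smul a f }
    (MeasureTheory.volume.real (Set.Icc (0 : Fin n → ℝ) fun _ => 2 * Real.pi))
    (fun f => by
      refine le_of_le_of_eq ?_ (mul_comm _ _)
      exact MeasureTheory.norm_setIntegral_le_of_norm_le_const
        isCompact_Icc.measure_lt_top (fun t _ => f.norm_coe_le_norm t))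

/-- Cauchy's formula displays `f w` as a composite of analytic maps, with no power series
manipulated. The kernel is a product of inverses of elements `a i - w i` of the Banach algebra of
bounded continuous functions of the angles; these depend affinely on `w`, inversion in a Banach
algebra is analytic at units, and integration over the box is continuous and linear. -/
lemma analyticAt_pi_of_differentiableAt {n : ℕ} {f : (Fin n → ℂ) → ℂ} {c : Fin n → ℂ}
    (hf : ∀ᶠ x in 𝓝 c, DifferentiableAt ℂ f x) : AnalyticAt ℂ f c := by
  obtain ⟨R, hR, hball⟩ := Metric.nhds_basis_closedBall.eventually_iff.1 hf
  have hd : ∀ x : Fin n → ℂ, (∀ i, ‖x i - c i‖ ≤ R) → DifferentiableAt ℂ f x := fun x hx =>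
    hball (by
      rw [Metric.mem_closedBall, dist_pi_le_iff hR.le]
      intro i; rw [dist_eq_norm]; exact hx i)
  -- the coordinate functions on the torus, and the integrand
  let a : Fin n → BoundedContinuousFunction (Fin n → ℝ) ℂ := fun i =>
    BoundedContinuousFunction.ofNormedAddCommGroup (fun t => torusMap c (fun _ => R) t i)
      (continuous_torusMap_apply _ _ i) (‖c i‖ + R) (fun t => by
        have := norm_torusMap_sub c hR t i
        calc _ = ‖c i + (torusMap c (fun _ => R) t i - c i)‖ := by congr 1; ring
          _ ≤ _ := (norm_add_le _ _).trans (by rw [this]))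
  have hfc : Continuous fun t => f (torusMap c (fun _ => R) t) :=
    continuous_iff_continuousAt.2 fun t =>
      ((hd _ fun i => (norm_torusMap_sub c hR t i).le).continuousAt).comp
        (continuous_torusMap _ _).continuousAt
  obtain ⟨C, hC⟩ := (isCompact_closedBall c R).exists_bound_of_continuousOn
    (f := f) (fun x hx => (hball hx).continuousAt.continuousWithinAt)
  -- The part of the Cauchy integrand that does not depend on `w`: the Jacobian of the torus
  -- parametrization times `f`.
  let F : BoundedContinuousFunction (Fin n → ℝ) ℂ :=
    BoundedContinuousFunction.ofNormedAddCommGroup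
      (fun t => (∏ i : Fin n, (R * Complex.exp (t i * Complex.I) * Complex.I)) *
        f (torusMap c (fun _ => R) t))
      (Continuous.mul (by fun_prop) hfc) (R ^ n * C) (fun t => by
        rw [norm_mul]
        refine mul_le_mul ?_ (hC _ ?_) (norm_nonneg _) (by positivity)
        · simp [norm_prod, abs_of_pos hR]
        · rw [Metric.mem_closedBall, dist_pi_le_iff hR.le]
          intro i; rw [dist_eq_norm]; exact (norm_torusMap_sub c hR t i).le)
  let u : Fin n → ℂ → BoundedContinuousFunction (Fin n → ℝ) ℂ := fun i z =>
    a i - algebraMap ℂ _ z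
  have hu : ∀ i z t, u i z t = torusMap c (fun _ => R) t i - z := fun i z t => by
    change torusMap c (fun _ => R) t i - algebraMap ℂ (BoundedContinuousFunction (Fin n → ℝ) ℂ) z t = _
    simp
  -- On the torus `a i - c i` has constant modulus `R`, so its pointwise inverse is bounded by
  -- `R⁻¹`.
  have hunit : ∀ i, IsUnit (u i (c i)) := by
    intro i
    let b : BoundedContinuousFunction (Fin n → ℝ) ℂ :=
      BoundedContinuousFunction.ofNormedAddCommGroup
        (fun t => (torusMap c (fun _ => R) t i - c i)⁻¹)
        (Continuous.inv₀ ((continuous_torusMap_apply _ _ i).sub continuous_const)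
          (fun t => norm_pos_iff.1 (by rw [norm_torusMap_sub c hR]; exact hR)))
        R⁻¹ (fun t => by rw [norm_inv, norm_torusMap_sub c hR])
    refine IsUnit.of_mul_eq_one b ?_
    ext t
    change u i (c i) t * (torusMap c (fun _ => R) t i - c i)⁻¹ = 1
    rw [hu]
    exact mul_inv_cancel₀ (norm_pos_iff.1 (by rw [norm_torusMap_sub c hR]; exact hR))
  have hua : ∀ i z, AnalyticAt ℂ (u i) z := fun i z =>
    analyticAt_const.sub ((Algebra.linearMap ℂ
      (BoundedContinuousFunction (Fin n → ℝ) ℂ)).toContinuousLinearMap.analyticAt z)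
  have hana : AnalyticAt ℂ (fun w : Fin n → ℂ =>
      boxIntegral n ((∏ i, Ring.inverse (u i (w i))) * F)) c := by
    refine ((boxIntegral n).analyticAt _).comp ((Finset.analyticAt_fun_prod _ fun i _ => ?_).mul
      analyticAt_const)
    have h1 : AnalyticAt ℂ (fun w : Fin n → ℂ => u i (w i)) c :=
      AnalyticAt.comp (f := fun w : Fin n → ℂ => w i) (hua i (c i))
        ((ContinuousLinearMap.proj (R := ℂ) (φ := fun _ : Fin n => ℂ) i).analyticAt c)
    exact AnalyticAt.fun_comp (by
      obtain ⟨v, hv⟩ := hunit i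
      rw [← hv]; exact analyticAt_inverse v) h1
  -- Units form an open set, so near `c` the formal inverses are genuine ones and Cauchy's formula
  -- applies.
  have hev : ∀ᶠ w in 𝓝 c, ∀ i, ‖w i - c i‖ < R ∧ IsUnit (u i (w i)) := by
    refine eventually_all.2 fun i => ?_
    refine Eventually.and ?_ ?_
    · have : ContinuousAt (fun w : Fin n → ℂ => ‖w i - c i‖) c :=
        (((continuous_apply i).sub continuous_const).norm).continuousAt
      exact this.eventually_lt continuousAt_const (by simpa using hR)
    · have h1 : ContinuousAt (fun w : Fin n → ℂ => u i (w i)) c :=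
        ContinuousAt.comp (f := fun w : Fin n → ℂ => w i) (hua i (c i)).continuousAt
          (continuous_apply i).continuousAt
      exact h1.eventually (Units.isOpen.mem_nhds (hunit i))
  have h2 : ((2 * Real.pi * Complex.I : ℂ) ^ n) ≠ 0 :=
    pow_ne_zero _ (by simp [Real.pi_ne_zero])
  refine AnalyticAt.congr (analyticAt_const.mul hana (f := fun _ => ((2 * Real.pi * Complex.I : ℂ) ^ n)⁻¹)) ?_
  filter_upwards [hev] with w hw
  have key := torusIntegral_cauchy c w hR f hd (fun i => (hw i).1)
  rw [Pi.mul_apply, inv_mul_eq_iff_eq_mul₀ h2, ← key, torusIntegral]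
  change ∫ t in _, _ = _
  congr 1
  funext t
  have hprod : ((∏ i, Ring.inverse (u i (w i))) : BoundedContinuousFunction (Fin n → ℝ) ℂ) t =
      ∏ i, (torusMap c (fun _ => R) t i - w i)⁻¹ := by
    let ev : BoundedContinuousFunction (Fin n → ℝ) ℂ →+* ℂ :=
      { toFun := fun f => f t, map_one' := rfl, map_mul' := fun _ _ => rfl, map_zero' := rfl,
        map_add' := fun _ _ => rfl }
    change ev _ = _
    rw [map_prod]
    refine Finset.prod_congr rfl fun i _ => ?_
    have := congrArg ev (Ring.mul_inverse_cancel _ (hw i).2)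
    rw [map_mul, map_one] at this
    rw [← hu]
    exact eq_inv_of_mul_eq_one_right this
  change ((∏ i, Ring.inverse (u i (w i))) : BoundedContinuousFunction (Fin n → ℝ) ℂ) t *
    ((∏ i : Fin n, (R * Complex.exp (t i * Complex.I) * Complex.I)) *
        f (torusMap c (fun _ => R) t)) = _
  rw [hprod, smul_eq_mul]
  ring

/-- A function that is complex differentiable near a point of a finite-dimensional space is
analytic at this point. -/
lemma analyticAt_of_differentiableAt {E : Type*} [NormedAddCommGroup E] [NormedSpace ℂ E]
    [FiniteDimensional ℂ E] {f : E → ℂ} {c : E} (hf : ∀ᶠ x in 𝓝 c, DifferentiableAt ℂ f x) :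
    AnalyticAt ℂ f c := by
  let e : E ≃L[ℂ] (Fin (Module.finrank ℂ E) → ℂ) :=
    (Module.finBasis ℂ E).equivFun.toContinuousLinearEquiv
  have h : AnalyticAt ℂ (f ∘ e.symm) (e c) := by
    apply analyticAt_pi_of_differentiableAt
    have h1 : Tendsto e.symm (𝓝 (e c)) (𝓝 c) := by
      simpa using e.symm.continuous.tendsto (e c)
    filter_upwards [h1.eventually hf] with x hx
    exact hx.comp x e.symm.differentiableAt
  have h2 : f = (f ∘ e.symm) ∘ e := by ext x; simp
  rw [h2]
  exact h.comp (e.toContinuousLinearMap.analyticAt c)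

lemma analyticOnNhd_of_differentiableOn {E : Type*} [NormedAddCommGroup E] [NormedSpace ℂ E]
    [FiniteDimensional ℂ E] {f : E → ℂ} {U : Set E} (hU : IsOpen U) (hf : DifferentiableOn ℂ f U) :
    AnalyticOnNhd ℂ f U := fun x hx => analyticAt_of_differentiableAt
  (by filter_upwards [hU.mem_nhds hx] with y hy using (hf y hy).differentiableAt (hU.mem_nhds hy))

/-- The points `x` such that the segment from `A x` to `x` lies in `U`. -/
def segmentSet {E : Type*} [AddCommGroup E] [Module ℝ E] (A : E → E) (U : Set E) : Set E :=
  {x | ∀ s ∈ Set.Icc (0 : ℝ) 1, A x + s • (x - A x) ∈ U}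

/-! ### Integration along segments and Hadamard's lemma -/

section Hadamard

variable {E : Type} [NormedAddCommGroup E] [NormedSpace ℂ E]
  (A : E →L[ℂ] E) {U : Set E}

/-- The segment is compact, so the tube lemma gives one neighbourhood of `x` that works for all
parameters `s` at once. -/
lemma isOpen_segmentSet (hU : IsOpen U) : IsOpen (segmentSet A U) := by
  rw [isOpen_iff_mem_nhds]
  intro x hx
  have hc : Continuous fun p : E × ℝ => A p.1 + p.2 • (p.1 - A p.1) := by fun_prop
  obtain ⟨u, v, hu, -, hxu, hv, huv⟩ := generalized_tube_lemma (isCompact_singleton (x := x))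
    (isCompact_Icc (a := (0 : ℝ)) (b := 1)) (hU.preimage hc) (by
      rintro ⟨y, s⟩ ⟨hy, hs⟩
      obtain rfl : y = x := hy
      exact hx s hs)
  exact mem_of_superset (hu.mem_nhds (hxu rfl)) fun y hy s hs => @huv (y, s) ⟨hy, hv hs⟩

lemma hasDerivAt_segment {f : E → ℂ} {x : E} {s : ℝ}
    (hf : DifferentiableAt ℂ f (A x + s • (x - A x))) :
    HasDerivAt (fun s : ℝ => f (A x + s • (x - A x)))
      (fderiv ℂ f (A x + s • (x - A x)) (x - A x)) s := by
  have h1 : HasDerivAt (fun s : ℝ => A x + s • (x - A x)) (x - A x) s := by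
    simpa using ((hasDerivAt_id s).smul_const (x - A x)).const_add (A x)
  exact (hf.hasFDerivAt.restrictScalars ℝ).comp_hasDerivAt s h1

lemma continuousOn_segment {F : Type*} [NormedAddCommGroup F] {H : E → F} (hH : ContinuousOn H U) :
    ContinuousOn (fun p : E × ℝ => H (A p.1 + p.2 • (p.1 - A p.1)))
      (segmentSet A U ×ˢ Set.Icc (0 : ℝ) 1) :=
  hH.comp (by fun_prop) fun p hp => hp.1 p.2 hp.2

lemma continuousOn_segment_right {F : Type*} [NormedAddCommGroup F] {H : E → F}
    (hH : ContinuousOn H U) {x : E} (hx : x ∈ segmentSet A U) :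
    ContinuousOn (fun s : ℝ => H (A x + s • (x - A x))) (Set.Icc (0 : ℝ) 1) :=
  (continuousOn_segment A hH).comp (f := fun s : ℝ => (x, s)) (by fun_prop) fun _ hs => ⟨hx, hs⟩

variable [FiniteDimensional ℂ E]

/-- Differentiation under the integral sign. Analyticity of `H` makes its derivative continuous, and
compactness of a closed ball times `[0, 1]` supplies the constant dominating bound. -/
lemma differentiableOn_integral_segment {H : E → ℂ} (hU : IsOpen U)
    (hH : DifferentiableOn ℂ H U) :
    DifferentiableOn ℂ (fun x => ∫ s in (0 : ℝ)..1, H (A x + s • (x - A x))) (segmentSet A U) := by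
  intro x hx
  have hA := analyticOnNhd_of_differentiableOn hU hH
  have hD : ContinuousOn (fderiv ℂ H) U := hA.fderiv.continuousOn
  -- The chain rule: `y ↦ A y + s (y - A y)` is the linear map `A + s (1 - A)`.
  let D : E → ℝ → (E →L[ℂ] ℂ) := fun y s => (fderiv ℂ H (A y + s • (y - A y))).comp
    (A + (s : ℂ) • (ContinuousLinearMap.id ℂ E - A))
  have hDc : ContinuousOn (fun p : E × ℝ => D p.1 p.2) (segmentSet A U ×ˢ Set.Icc (0 : ℝ) 1) :=
    (continuousOn_segment A hD).clm_comp (Continuous.continuousOn (by fun_prop))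
  have : ProperSpace E := FiniteDimensional.proper ℂ E
  obtain ⟨ε, hε, hball⟩ := Metric.nhds_basis_closedBall.mem_iff.1
    ((isOpen_segmentSet A hU).mem_nhds hx)
  obtain ⟨C, hC⟩ := ((isCompact_closedBall x ε).prod
    (isCompact_Icc (a := (0 : ℝ)) (b := 1))).exists_bound_of_continuousOn
      (hDc.mono (Set.prod_mono hball subset_rfl))
  have hI : Set.uIoc (0 : ℝ) 1 ⊆ Set.Icc 0 1 := by
    rw [Set.uIoc_of_le zero_le_one]; exact Set.Ioc_subset_Icc_self
  have meas : ∀ {F : Type} [NormedAddCommGroup F] [SecondCountableTopologyEither ℝ F]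
      {g : ℝ → F}, ContinuousOn g (Set.Icc 0 1) →
      MeasureTheory.AEStronglyMeasurable g (MeasureTheory.volume.restrict (Set.uIoc (0 : ℝ) 1)) :=
    fun hg => (hg.mono hI).aestronglyMeasurable measurableSet_uIoc
  refine (intervalIntegral.hasFDerivAt_integral_of_dominated_of_fderiv_le (𝕜 := ℂ)
    (F := fun y s => H (A y + s • (y - A y))) (F' := D) (bound := fun _ => C)
    (Metric.closedBall_mem_nhds x hε) ?_ ?_ ?_ ?_ ?_ ?_).differentiableAt.differentiableWithinAt
  · filter_upwards [Metric.closedBall_mem_nhds x hε] with y hy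
    exact meas (continuousOn_segment_right A hH.continuousOn (hball hy))
  · exact ContinuousOn.intervalIntegrable (by
      rw [Set.uIcc_of_le zero_le_one]
      exact continuousOn_segment_right A hH.continuousOn hx)
  · exact meas (hDc.comp (f := fun s : ℝ => (x, s)) (by fun_prop) fun s hs => ⟨hx, hs⟩)
  · exact Eventually.of_forall fun s hs y hy => hC (y, s) ⟨hy, hI hs⟩
  · exact intervalIntegrable_const
  · refine Eventually.of_forall fun s hs y hy => ?_
    have h1 : DifferentiableAt ℂ H (A y + s • (y - A y)) :=
      (hH _ (hball hy s (hI hs))).differentiableAt (hU.mem_nhds (hball hy s (hI hs)))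
    refine h1.hasFDerivAt.comp y ?_
    have h2 : ∀ z : E, A z + s • (z - A z) = (A + (s : ℂ) • (ContinuousLinearMap.id ℂ E - A)) z :=
      fun z => by simp
    simp only [h2]
    exact ContinuousLinearMap.hasFDerivAt _

/-- Hadamard's lemma along the segments from `A x` to `x`. -/
lemma sub_eq_integral_segment {f : E → ℂ} (hU : IsOpen U) (hf : DifferentiableOn ℂ f U) {x : E}
    (hx : x ∈ segmentSet A U) :
    f x - f (A x) = ∫ s in (0 : ℝ)..1, fderiv ℂ f (A x + s • (x - A x)) (x - A x) := by
  have hD : ContinuousOn (fderiv ℂ f) U :=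
    (analyticOnNhd_of_differentiableOn hU hf).fderiv.continuousOn
  have := intervalIntegral.integral_eq_sub_of_hasDerivAt (a := (0 : ℝ)) (b := 1)
    (f := fun s : ℝ => f (A x + s • (x - A x)))
    (f' := fun s : ℝ => fderiv ℂ f (A x + s • (x - A x)) (x - A x))
    (fun s hs => by
      rw [Set.uIcc_of_le zero_le_one] at hs
      exact hasDerivAt_segment A ((hf _ (hx s hs)).differentiableAt (hU.mem_nhds (hx s hs))))
    (ContinuousOn.intervalIntegrable (by
      rw [Set.uIcc_of_le zero_le_one]
      exact (continuousOn_segment_right A hD hx).clm_apply continuousOn_const))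
  rw [this]
  simp

end Hadamard

/-! ### Cones over open subsets of projective space -/

section Cone

variable {m : ℕ}

/-- The point of `ℙ^m` with homogeneous coordinates `v` (an arbitrary point if `v = 0`). -/
def toProj (v : CSpace m) : ProjSpace m :=
  if hv : v ≠ 0 then Projectivization.mk ℂ v hv else Projectivization.mk ℂ 1 one_ne_zero

lemma toProj_of_ne_zero {v : CSpace m} (hv : v ≠ 0) : toProj v = Projectivization.mk ℂ v hv :=
  dif_pos hv

lemma mem_cone_iff {U : Set (ProjSpace m)} {v : CSpace m} :
    v ∈ cone U ↔ v ≠ 0 ∧ toProj v ∈ U := by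
  constructor
  · rintro ⟨h, hv⟩
    exact ⟨h, by rwa [toProj_of_ne_zero h]⟩
  · rintro ⟨h, hv⟩
    exact ⟨h, by rwa [toProj_of_ne_zero h] at hv⟩

lemma toProj_rep (p : ProjSpace m) : toProj p.rep = p := by
  rw [toProj_of_ne_zero p.rep_nonzero, Projectivization.mk_rep]

lemma toProj_eq_iff {v w : CSpace m} (hv : v ≠ 0) (hw : w ≠ 0) :
    toProj v = toProj w ↔ ∃ c : ℂˣ, c • w = v := by
  rw [toProj_of_ne_zero hv, toProj_of_ne_zero hw, Projectivization.mk_eq_mk_iff]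

lemma toProj_smul (c : ℂˣ) (v : CSpace m) : toProj ((c : ℂ) • v) = toProj v := by
  by_cases hv : v = 0
  · simp [hv]
  · exact (toProj_eq_iff (smul_ne_zero c.ne_zero hv) hv).2 ⟨c, rfl⟩

lemma exists_rep_eq_smul {v : CSpace m} (hv : v ≠ 0) : ∃ c : ℂˣ, (toProj v).rep = (c : ℂ) • v := by
  obtain ⟨c, hc⟩ := Projectivization.exists_smul_eq_mk_rep ℂ v hv
  exact ⟨c, by rw [toProj_of_ne_zero hv, ← hc]; rfl⟩

lemma rep_mem_cone {U : Set (ProjSpace m)} {p : ProjSpace m} : p.rep ∈ cone U ↔ p ∈ U := by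
  rw [mem_cone_iff, toProj_rep]
  exact ⟨And.right, fun h => ⟨p.rep_nonzero, h⟩⟩

lemma smul_mem_cone {U : Set (ProjSpace m)} {v : CSpace m} (hv : v ∈ cone U) (c : ℂˣ) :
    (c : ℂ) • v ∈ cone U := by
  rw [mem_cone_iff] at hv ⊢
  exact ⟨smul_ne_zero c.ne_zero hv.1, by rw [toProj_smul]; exact hv.2⟩

lemma isQuotientMap_mk' :
    IsQuotientMap (Projectivization.mk' ℂ : {v : CSpace m // v ≠ 0} → ProjSpace m) :=
  (isQuotientMap_iff _).2 ⟨⟨rfl⟩, fun p => ⟨⟨p.rep, p.rep_nonzero⟩, p.mk_rep⟩⟩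

lemma isOpen_cone {U : Set (ProjSpace m)} (hU : IsOpen U) : IsOpen (cone U) := by
  have h1 : IsOpen {v : CSpace m | v ≠ 0} := isOpen_ne
  have h2 := h1.isOpenMap_subtype_val _ (hU.preimage isQuotientMap_mk'.continuous)
  convert h2 using 1
  ext v
  constructor
  · rintro ⟨h, hv⟩
    exact ⟨⟨v, h⟩, hv, rfl⟩
  · rintro ⟨⟨v, h⟩, hv, rfl⟩
    exact ⟨h, hv⟩

/-- Open sets that are stable under scaling are cones over open subsets of `ℙ^m`. -/
lemma exists_opens_cone_eq {A : Set (CSpace m)} (hA : IsOpen A) (h0 : (0 : CSpace m) ∉ A)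
    (hs : ∀ v ∈ A, ∀ c : ℂˣ, (c : ℂ) • v ∈ A) :
    ∃ U : Opens (ProjSpace m), cone (U : Set (ProjSpace m)) = A := by
  have key : ∀ v : CSpace m, v ≠ 0 → ((toProj v).rep ∈ A ↔ v ∈ A) := by
    intro v hv
    obtain ⟨c, hc⟩ := exists_rep_eq_smul hv
    rw [hc]
    refine ⟨fun h => ?_, fun h => hs v h c⟩
    have := hs _ h c⁻¹
    rwa [smul_smul, Units.val_inv_eq_inv_val, inv_mul_cancel₀ c.ne_zero, one_smul] at this
  refine ⟨⟨{p | p.rep ∈ A}, ?_⟩, ?_⟩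
  · rw [← isQuotientMap_mk'.isOpen_preimage]
    convert hA.preimage continuous_subtype_val using 1
    ext ⟨v, hv⟩
    rw [Set.mem_preimage, Set.mem_preimage, ← key v hv, toProj_of_ne_zero hv]
    rfl
  · ext v
    rw [mem_cone_iff]
    constructor
    · rintro ⟨hv, h⟩
      exact (key v hv).1 h
    · intro h
      have hv : v ≠ 0 := fun e => h0 (e ▸ h)
      exact ⟨hv, (key v hv).2 h⟩

lemma continuousAt_toProj {v : CSpace m} (hv : v ≠ 0) : ContinuousAt toProj v := by
  intro A hA
  obtain ⟨U, hUA, hU, hvU⟩ := mem_nhds_iff.1 hA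
  refine mem_map.2 (mem_of_superset ((isOpen_cone hU).mem_nhds (mem_cone_iff.2 ⟨hv, hvU⟩)) ?_)
  exact fun w hw =>
    hUA ((mem_cone_iff (U := U)).1 hw).2

lemma tendsto_toProj (p : ProjSpace m) : Tendsto toProj (coneNhds p) (𝓝 p) := by
  intro A hA
  obtain ⟨U, hUA, hU, hvU⟩ := mem_nhds_iff.1 hA
  exact mem_coneNhds.2 ⟨⟨U, hU⟩, hvU, fun w hw =>
    hUA ((mem_cone_iff (U := U)).1 hw).2⟩

/-- A continuous scaling-invariant function on a cone is a continuous function on the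
corresponding open subset of `ℙ^m`. -/
lemma continuousOn_rep {Z : Type*} [TopologicalSpace Z] {U : Set (ProjSpace m)} (hU : IsOpen U)
    {g : CSpace m → Z} (hg : ContinuousOn g (cone U))
    (hs : ∀ v ∈ cone U, ∀ c : ℂˣ, g ((c : ℂ) • v) = g v) :
    ContinuousOn (fun p : ProjSpace m => g p.rep) U := by
  rw [isQuotientMap_mk'.continuousOn_isOpen_iff hU]
  have : ContinuousOn (fun v : {v : CSpace m // v ≠ 0} => g v.1)
      (Projectivization.mk' ℂ ⁻¹' U) :=
    hg.comp continuous_subtype_val.continuousOn fun v hv => ⟨v.2, hv⟩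
  refine this.congr fun v hv => ?_
  obtain ⟨c, hc⟩ := exists_rep_eq_smul v.2
  have e : Projectivization.mk' ℂ v = toProj v.1 := (toProj_of_ne_zero v.2).symm
  rw [Function.comp_apply, e, hc]
  exact hs _ ⟨v.2, hv⟩ c

lemma coneNhds_le_principal {U : Set (ProjSpace m)} (hU : IsOpen U) {p : ProjSpace m} (hp : p ∈ U) :
    ∀ᶠ v in coneNhds p, v ∈ cone U := mem_coneNhds.2 ⟨⟨U, hU⟩, hp, subset_rfl⟩

/-- A line is determined by the orthogonal projection onto it, whose matrix `v_i conj(v_j) / |v|²`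
is continuous in `v` and unchanged by scaling. So `ℙ^m` injects continuously into a space of
matrices. -/
instance projSpace_t2 : T2Space (ProjSpace m) := by
  let g : CSpace m → Matrix (Fin (m + 1)) (Fin (m + 1)) ℂ := fun v i j =>
    v i * star (v j) / (∑ l, v l * star (v l))
  have hne : ∀ v : CSpace m, v ≠ 0 → (∑ l, v l * star (v l)) ≠ 0 := by
    intro v hv h
    have h1 : ∀ l, v l * star (v l) = ((Complex.normSq (v l) : ℝ) : ℂ) := fun l =>
      Complex.mul_conj (v l)
    simp only [h1] at h
    rw [← Complex.ofReal_sum, Complex.ofReal_eq_zero,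
      Finset.sum_eq_zero_iff_of_nonneg fun l _ => Complex.normSq_nonneg _] at h
    exact hv (funext fun l => Complex.normSq_eq_zero.1 (h l (Finset.mem_univ l)))
  have hc : Continuous fun p : ProjSpace m => g p.rep := by
    rw [← continuousOn_univ]
    refine continuousOn_rep isOpen_univ ?_ ?_
    · refine continuousOn_pi.2 fun i => continuousOn_pi.2 fun j => ContinuousOn.div
        (Continuous.continuousOn (by fun_prop)) (Continuous.continuousOn (by fun_prop))
        fun v hv => hne v hv.1
    · intro v hv c
      ext i j
      have hcc : (c : ℂ) * star (c : ℂ) ≠ 0 := mul_ne_zero c.ne_zero (star_ne_zero.2 c.ne_zero)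
      have e : ∀ i j, ((c : ℂ) • v) i * star (((c : ℂ) • v) j) =
          ((c : ℂ) * star (c : ℂ)) * (v i * star (v j)) := by
        intro i j
        simp only [Pi.smul_apply, smul_eq_mul, star_mul']
        ring
      simp only [g, e, ← Finset.mul_sum]
      exact mul_div_mul_left _ _ hcc
  refine T2Space.of_injective_continuous (f := fun p : ProjSpace m => g p.rep) ?_ hc
  intro p q h
  -- The projection onto the line of `p` fixes `p.rep`. Since the matrices agree, so does the
  -- projection onto the line of `q`, which forces `p.rep` to be a multiple of `q.rep`.
  have h1 : ∀ i, p.rep i = (∑ l, q.rep i * star (q.rep l) / (∑ l, q.rep l * star (q.rep l)) *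
      p.rep l) := by
    intro i
    have : ∀ l, q.rep i * star (q.rep l) / (∑ l, q.rep l * star (q.rep l)) =
        p.rep i * star (p.rep l) / (∑ l, p.rep l * star (p.rep l)) := fun l =>
      (congrFun (congrFun h i) l).symm
    simp only [this]
    have e : ∀ l, p.rep i * star (p.rep l) / (∑ l, p.rep l * star (p.rep l)) * p.rep l =
        p.rep i / (∑ l, p.rep l * star (p.rep l)) * (p.rep l * star (p.rep l)) := fun l => by ring
    simp only [e, ← Finset.mul_sum]
    rw [div_mul_cancel₀ _ (hne _ p.rep_nonzero)]
  set a : ℂ := ∑ l, star (q.rep l) / (∑ l, q.rep l * star (q.rep l)) * p.rep l with ha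
  have h2 : p.rep = a • q.rep := by
    ext i
    rw [h1 i, Pi.smul_apply, smul_eq_mul, ha, Finset.sum_mul]
    refine Finset.sum_congr rfl fun l _ => by ring
  have ha0 : a ≠ 0 := fun h0 => p.rep_nonzero (by rw [h2, h0, zero_smul])
  rw [← toProj_rep p, ← toProj_rep q, toProj_eq_iff p.rep_nonzero q.rep_nonzero]
  exact ⟨Units.mk0 a ha0, h2.symm⟩

/-- The quotient map from `ℂ^{m+1} ∖ {0}` is open, because the saturation of an open set is the
union of its images under the homeomorphisms `v ↦ c v`. An open quotient of a second countable space
is second countable. -/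
instance projSpace_secondCountable : SecondCountableTopology (ProjSpace m) := by
  refine isQuotientMap_mk'.secondCountableTopology (fun A hA => ?_)
  have hA' : IsOpen (Subtype.val '' A : Set (CSpace m)) :=
    (isOpen_ne : IsOpen {v : CSpace m | v ≠ 0}).isOpenMap_subtype_val _ hA
  obtain ⟨U, hU⟩ := exists_opens_cone_eq
    (A := ⋃ c : ℂˣ, (fun v : CSpace m => (c : ℂ) • v) '' (Subtype.val '' A))
    (isOpen_iUnion fun c => (Homeomorph.smulOfNeZero (c : ℂ) c.ne_zero).isOpenMap _ hA')
    (by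
      simp only [Set.mem_iUnion, not_exists]
      rintro c ⟨_, ⟨⟨v, hv⟩, -, rfl⟩, h⟩
      exact smul_ne_zero c.ne_zero hv h)
    (by
      simp only [Set.mem_iUnion]
      rintro _ ⟨c, w, hw, rfl⟩ d
      exact ⟨d * c, w, hw, by simp [mul_smul]⟩)
  convert U.2 using 1
  ext p
  change _ ↔ p ∈ (U : Set (ProjSpace m))
  rw [← rep_mem_cone (U := (U : Set (ProjSpace m))), hU]
  simp only [Set.mem_iUnion]
  constructor
  · rintro ⟨⟨v, hv⟩, hvA, rfl⟩
    obtain ⟨c, hc⟩ := Projectivization.exists_smul_eq_mk_rep ℂ v hv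
    exact ⟨c, v, ⟨_, hvA, rfl⟩, hc⟩
  · rintro ⟨c, _, ⟨⟨v, hv⟩, hvA, rfl⟩, h⟩
    refine ⟨⟨v, hv⟩, hvA, ?_⟩
    change Projectivization.mk ℂ v hv = p
    rw [← toProj_of_ne_zero hv, ← toProj_smul c, ← toProj_rep p, ← h]

end Cone

/-! ### Affine charts -/

section Chart

variable {k : ℕ} {Y : Type} [TopologicalSpace Y] (h : Y ≃ₜ ProjSpace k)

/-- The point `(w₀ : … : 1 : … : w_k)` with `1` as the `j`-th coordinate. -/
def affIncl (j : Fin (k + 1)) (w : EuclideanSpace ℂ (Fin k)) : CSpace k :=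
  j.insertNth (α := fun _ => ℂ) 1 (fun i => w i)

/-- The affine coordinates `v_i / v_j`, `i ≠ j`. -/
def affCoord (j : Fin (k + 1)) (v : CSpace k) : EuclideanSpace ℂ (Fin k) :=
  WithLp.toLp 2 fun i => v (j.succAbove i) / v j

lemma affIncl_self (j : Fin (k + 1)) (w : EuclideanSpace ℂ (Fin k)) : affIncl j w j = 1 := by
  simp [affIncl]

lemma affIncl_ne_zero (j : Fin (k + 1)) (w : EuclideanSpace ℂ (Fin k)) : affIncl j w ≠ 0 :=
  fun e => one_ne_zero ((affIncl_self j w).symm.trans (congrFun e j))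

lemma affCoord_affIncl (j : Fin (k + 1)) (w : EuclideanSpace ℂ (Fin k)) :
    affCoord j (affIncl j w) = w := by
  ext i; simp [affCoord, affIncl]

lemma affIncl_affCoord {j : Fin (k + 1)} {v : CSpace k} (hv : v j ≠ 0) :
    affIncl j (affCoord j v) = (v j)⁻¹ • v := by
  ext i
  refine Fin.succAboveCases j ?_ (fun l => ?_) i
  · simp [affIncl, hv]
  · simp [affIncl, affCoord, div_eq_inv_mul]

lemma affCoord_smul (j : Fin (k + 1)) (c : ℂˣ) (v : CSpace k) :
    affCoord j ((c : ℂ) • v) = affCoord j v := by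
  ext i; simp [affCoord, mul_div_mul_left _ _ c.ne_zero]

lemma contDiff_affIncl (j : Fin (k + 1)) : ContDiff ℂ ω (affIncl j) := by
  refine contDiff_pi.2 fun i => ?_
  refine Fin.succAboveCases j ?_ (fun l => ?_) i
  · simpa [affIncl] using contDiff_const
  · simp only [affIncl, Fin.insertNth_apply_succAbove]
    exact (EuclideanSpace.proj (𝕜 := ℂ) l).contDiff

lemma contDiffAt_affCoord {j : Fin (k + 1)} {v : CSpace k} (hv : v j ≠ 0) :
    ContDiffAt ℂ ω (affCoord j) v := by
  refine contDiffAt_euclidean.2 fun i => ?_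
  exact ((contDiff_apply ℂ ℂ (j.succAbove i)).contDiffAt).div
    ((contDiff_apply ℂ ℂ j).contDiffAt) hv

/-- The open subset `x_j ≠ 0` of `ℙ^k`. -/
def affOpen (j : Fin (k + 1)) : Opens (ProjSpace k) :=
  (exists_opens_cone_eq (A := {v : CSpace k | v j ≠ 0})
    (isOpen_ne_fun (continuous_apply j) continuous_const) (by simp)
    (fun v hv c => mul_ne_zero c.ne_zero hv)).choose

lemma cone_affOpen (j : Fin (k + 1)) :
    cone (affOpen j : Set (ProjSpace k)) = {v : CSpace k | v j ≠ 0} :=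
  (exists_opens_cone_eq (A := {v : CSpace k | v j ≠ 0})
    (isOpen_ne_fun (continuous_apply j) continuous_const) (by simp)
    (fun v hv c => mul_ne_zero c.ne_zero hv)).choose_spec

lemma mem_affOpen {j : Fin (k + 1)} {p : ProjSpace k} : p ∈ affOpen j ↔ p.rep j ≠ 0 := by
  rw [← SetLike.mem_coe, ← rep_mem_cone, cone_affOpen]; rfl

lemma toProj_mem_affOpen {j : Fin (k + 1)} {v : CSpace k} (hv : v j ≠ 0) :
    toProj v ∈ affOpen j :=
  (mem_cone_iff.1 ((cone_affOpen j).symm ▸ hv : v ∈ cone (affOpen j : Set (ProjSpace k)))).2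

lemma exists_mem_affOpen (p : ProjSpace k) : ∃ j, p ∈ affOpen j := by
  simp only [mem_affOpen]
  by_contra! hc
  exact p.rep_nonzero (funext hc)

/-- The affine chart `x_j ≠ 0` of a space homeomorphic to `ℙ^k`. -/
def affChart (j : Fin (k + 1)) : OpenPartialHomeomorph Y (EuclideanSpace ℂ (Fin k)) where
  toFun y := affCoord j (h y).rep
  invFun w := h.symm (toProj (affIncl j w))
  source := h ⁻¹' affOpen j
  target := Set.univ
  map_source' _ _ := trivial
  map_target' w _ := by
    change h (h.symm _) ∈ affOpen j
    rw [h.apply_symm_apply]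
    exact toProj_mem_affOpen (by rw [affIncl_self]; exact one_ne_zero)
  left_inv' y hy := by
    have hy : (h y).rep j ≠ 0 := mem_affOpen.1 hy
    rw [affIncl_affCoord hy, h.symm_apply_eq]
    exact (toProj_smul (Units.mk0 _ (inv_ne_zero hy)) _).trans (toProj_rep _)
  right_inv' w _ := by
    obtain ⟨c, hc⟩ := exists_rep_eq_smul (affIncl_ne_zero j w)
    rw [h.apply_symm_apply, hc, affCoord_smul, affCoord_affIncl]
  open_source := (affOpen j).2.preimage h.continuous
  open_target := isOpen_univ
  continuousOn_toFun := by
    refine ContinuousOn.comp (g := fun p : ProjSpace k => affCoord j p.rep) (t := affOpen j)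
      (continuousOn_rep (affOpen j).2 ?_ fun v _ c => affCoord_smul j c v)
      h.continuous.continuousOn fun y hy => hy
    intro v hv
    rw [show (affOpen j).carrier = (affOpen j : Set (ProjSpace k)) from rfl, cone_affOpen] at hv
    exact (contDiffAt_affCoord hv).continuousAt.continuousWithinAt
  continuousOn_invFun := by
    refine (h.symm.continuous.comp ?_).continuousOn
    exact continuous_iff_continuousAt.2 fun w => ContinuousAt.comp
      (continuousAt_toProj (affIncl_ne_zero j w)) (contDiff_affIncl j).continuous.continuousAt

/-- The complex atlas of affine charts on a space homeomorphic to `ℙ^k`. -/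
@[reducible] def affChartedSpace : ChartedSpace (EuclideanSpace ℂ (Fin k)) Y where
  atlas := Set.range (affChart h)
  chartAt y := affChart h (exists_mem_affOpen (h y)).choose
  mem_chart_source y := (exists_mem_affOpen (h y)).choose_spec
  chart_mem_atlas _ := ⟨_, rfl⟩

/-- In coordinates the change of charts is `affCoord j ∘ affIncl i`, a quotient of affine functions
whose denominator does not vanish on the overlap. -/
lemma isManifold_affChartedSpace :
    letI := affChartedSpace h
    IsManifold 𝓘(ℂ, EuclideanSpace ℂ (Fin k)) ω Y := by
  let _ := affChartedSpace h
  refine isManifold_of_contDiffOn _ _ _ ?_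
  rintro _ _ ⟨i, rfl⟩ ⟨j, rfl⟩
  intro w hw
  have hw : h (h.symm (toProj (affIncl i w))) ∈ affOpen j := by
    simp only [modelWithCornersSelf_coe_symm, OpenPartialHomeomorph.trans_source,
      Set.preimage_id, Set.mem_inter_iff] at hw
    exact hw.1.2
  rw [h.apply_symm_apply] at hw
  have hj : affIncl i w j ≠ 0 := by
    have : affIncl i w ∈ cone (affOpen j : Set (ProjSpace k)) :=
      mem_cone_iff.2 ⟨affIncl_ne_zero i w, hw⟩
    rwa [cone_affOpen] at this
  refine ContDiffAt.contDiffWithinAt ?_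
  have e : (𝓘(ℂ, EuclideanSpace ℂ (Fin k)) ∘ ((affChart h i).symm ≫ₕ affChart h j) ∘
      (𝓘(ℂ, EuclideanSpace ℂ (Fin k))).symm) = affCoord j ∘ affIncl i := by
    funext w
    change affCoord j (h (h.symm (toProj (affIncl i w)))).rep = _
    obtain ⟨c, hc⟩ := exists_rep_eq_smul (affIncl_ne_zero i w)
    rw [h.apply_symm_apply, hc, affCoord_smul]
    rfl
  rw [e]
  exact (contDiffAt_affCoord hj).comp w (contDiff_affIncl i).contDiffAt

/-- `h` identifies holomorphic functions on open subsets of `Y` with holomorphic functions of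
degree zero on the corresponding cones. -/
def IsBiholomorphic [ChartedSpace (EuclideanSpace ℂ (Fin k)) Y] : Prop :=
  ∀ (f : Y → ℂ) (U : Opens (ProjSpace k)),
    ContMDiffOn 𝓘(ℂ, EuclideanSpace ℂ (Fin k)) 𝓘(ℂ) ω f (h ⁻¹' U) ↔
      DifferentiableOn ℂ (fun v => f (h.symm (toProj v))) (cone (U : Set (ProjSpace k)))

/-- On `x_j ≠ 0` the function on the cone is the local expression of `f` composed with `affCoord j`;
conversely the local expression is the function on the cone composed with `affIncl j`. The second
direction only yields differentiability near the point, which is upgraded to analyticity by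
`analyticAt_of_differentiableAt`. -/
lemma isBiholomorphic_affChartedSpace :
    letI := affChartedSpace h
    IsBiholomorphic h := by
  let _ := affChartedSpace h
  intro f U
  have hUo : IsOpen (h ⁻¹' (U : Set (ProjSpace k))) := U.2.preimage h.continuous
  constructor
  · intro hf v hv
    obtain ⟨hv0, hvU⟩ := mem_cone_iff.1 hv
    set y := h.symm (toProj v) with hy
    have hyv : h y = toProj v := h.apply_symm_apply _
    have hyU : y ∈ h ⁻¹' (U : Set (ProjSpace k)) := by
      rw [Set.mem_preimage, hyv]; exact hvU
    have h1 := (contMDiffAt_iff.1 ((hf y hyU).contMDiffAt (hUo.mem_nhds hyU))).2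
    set j := (exists_mem_affOpen (h y)).choose with hj
    have hjm : h y ∈ affOpen j := (exists_mem_affOpen (h y)).choose_spec
    have hvj : v j ≠ 0 := by
      rw [hyv] at hjm
      have : v ∈ cone (affOpen j : Set (ProjSpace k)) := mem_cone_iff.2 ⟨hv0, hjm⟩
      rwa [cone_affOpen] at this
    have h2 : ContDiffWithinAt ℂ ω (fun w => f (h.symm (toProj (affIncl j w)))) Set.univ
        (affCoord j (h y).rep) := by
      have e : (extChartAt 𝓘(ℂ) (f y) ∘ f ∘ (extChartAt 𝓘(ℂ, EuclideanSpace ℂ (Fin k)) y).symm) =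
        fun w => f (h.symm (toProj (affIncl j w))) := rfl
      have e2 : extChartAt 𝓘(ℂ, EuclideanSpace ℂ (Fin k)) y y = affCoord j (h y).rep := rfl
      rw [e, e2] at h1
      simpa using h1
    obtain ⟨c, hc⟩ := exists_rep_eq_smul hv0
    rw [hyv, hc, affCoord_smul] at h2
    have h3 := ((contDiffWithinAt_univ.1 h2).comp v (contDiffAt_affCoord hvj)).differentiableAt
      (by simp)
    refine (h3.congr_of_eventuallyEq ?_).differentiableWithinAt
    have ho : IsOpen {v : CSpace k | v j ≠ 0} :=
      isOpen_ne_fun (continuous_apply j) continuous_const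
    filter_upwards [ho.mem_nhds hvj] with w hw
    rw [Function.comp_apply, affIncl_affCoord hw]
    exact congrArg (fun p => f (h.symm p)) (toProj_smul (Units.mk0 _ (inv_ne_zero hw)) w).symm
  · intro hf y hy
    refine ContMDiffAt.contMDiffWithinAt (contMDiffAt_iff.2 ⟨?_, ?_⟩)
    · have h1 := continuousOn_rep U.2 hf.continuousOn fun v _ c => by rw [toProj_smul]
      have h2 : ContinuousOn f (h ⁻¹' (U : Set (ProjSpace k))) := by
        refine (h1.comp h.continuous.continuousOn fun y hy => hy).congr fun y _ => ?_
        simp [toProj_rep]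
      exact h2.continuousAt (hUo.mem_nhds hy)
    · set j := (exists_mem_affOpen (h y)).choose with hj
      have hjm : h y ∈ affOpen j := (exists_mem_affOpen (h y)).choose_spec
      have hjr := mem_affOpen.1 hjm
      change ContDiffWithinAt ℂ ω (fun w => f (h.symm (toProj (affIncl j w)))) _
        (affCoord j (h y).rep)
      refine ContDiffAt.contDiffWithinAt (AnalyticAt.contDiffAt
        (analyticAt_of_differentiableAt ?_))
      have hm : affIncl j (affCoord j (h y).rep) ∈ cone (U : Set (ProjSpace k)) := by
        rw [affIncl_affCoord hjr]
        exact smul_mem_cone (rep_mem_cone.2 hy) (Units.mk0 _ (inv_ne_zero hjr))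
      filter_upwards [(contDiff_affIncl j).continuous.continuousAt.eventually
        ((isOpen_cone U.2).mem_nhds hm)] with w hw
      exact DifferentiableAt.comp (g := fun v => f (h.symm (toProj v))) w
        ((hf _ hw).differentiableAt ((isOpen_cone U.2).mem_nhds hw))
        ((contDiff_affIncl j).differentiable (by simp) w)

end Chart

/-! ### Superfunctions in affine coordinates -/

lemma scaleOdd_oddBasis {n : ℕ} (c : ℂ) (A : Finset (Fin n)) :
    scaleOdd c (oddBasis n A) = c ^ A.card • oddBasis n A := by
  refine scaleOdd_of_mem c ?_
  rw [oddBasis, ExteriorAlgebra.basis_apply_ofCard _ rfl]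
  exact ExteriorAlgebra.ιMulti_range ℂ _ ⟨_, rfl⟩

lemma coord_scaleOdd {n : ℕ} (c : ℂ) (A : Finset (Fin n)) (w : OddAlg n) :
    (oddBasis n).coord A (scaleOdd c w) = c ^ A.card * (oddBasis n).coord A w := by
  have : (oddBasis n).coord A ∘ₗ (scaleOdd c).toLinearMap = c ^ A.card • (oddBasis n).coord A := by
    refine (oddBasis n).ext fun B => ?_
    rcases eq_or_ne B A with rfl | hBA
    · simp [scaleOdd_oddBasis]
    · simp [scaleOdd_oddBasis, hBA]
  exact LinearMap.congr_fun this w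

lemma oddBasis_ext {n : ℕ} {w w' : OddAlg n}
    (h : ∀ A, (oddBasis n).coord A w = (oddBasis n).coord A w') : w = w' :=
  (oddBasis n).ext_elem h

lemma oddBasis_singleton {n : ℕ} (a : Fin n) :
    oddBasis n {a} = ExteriorAlgebra.ι ℂ (Pi.single a 1) := by
  rw [oddBasis, ExteriorAlgebra.basis_apply_ofCard _ (Finset.card_singleton a)]
  simp only [ExteriorAlgebra.ιMulti_family, ExteriorAlgebra.ιMulti_apply, List.ofFn_succ,
    List.ofFn_zero, List.prod_singleton, Function.comp_apply, Pi.basisFun_apply]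
  congr 2
  have h := Finset.orderEmbOfFin_mem {a} (Finset.card_singleton a) 0
  exact Finset.mem_singleton.1 h

/-- Scaling acts on a monomial of length `d` in the `θ_a` by `c ^ d`, so invariance can be tested on
each coefficient and says that it has degree `-d`. This is where the twist `𝒪(-1)` comes from. -/
lemma isSuperfunction_iff {m n : ℕ} {U : Set (ProjSpace m)} {f : CSpace m → OddAlg n} :
    IsSuperfunction U f ↔
      (∀ A, DifferentiableOn ℂ (fun v => (oddBasis n).coord A (f v)) (cone U)) ∧
      ∀ v ∈ cone U, ∀ (c : ℂˣ) (A : Finset (Fin n)),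
        (c : ℂ) ^ A.card * (oddBasis n).coord A (f ((c : ℂ) • v)) = (oddBasis n).coord A (f v) := by
  constructor
  · intro hf
    refine ⟨fun A => hf.holomorphic _, fun v hv c A => ?_⟩
    rw [← coord_scaleOdd, hf.invariant v hv c]
  · rintro ⟨h1, h2⟩
    refine ⟨fun φ => ?_, fun v hv c => oddBasis_ext fun A => ?_⟩
    · have e : (fun v => φ (f v)) = fun v => ∑ A, (oddBasis n).coord A (f v) * φ (oddBasis n A) := by
        funext v
        conv_lhs => rw [← (oddBasis n).sum_repr (f v)]
        simp only [map_sum, map_smul, smul_eq_mul, Module.Basis.coord_apply]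
      rw [e]
      exact DifferentiableOn.fun_sum fun A _ => (h1 A).mul_const _
    · rw [coord_scaleOdd, h2 v hv c]

/-- A scalar function that is holomorphic and of degree zero on the cone over `U`. -/
structure IsScalarFunction {m : ℕ} (U : Set (ProjSpace m)) (F : CSpace m → ℂ) : Prop where
  holomorphic : DifferentiableOn ℂ F (cone U)
  invariant : ∀ v ∈ cone U, ∀ c : ℂˣ, F ((c : ℂ) • v) = F v

lemma IsScalarFunction.isSuperfunction {m : ℕ} (n : ℕ) {U : Set (ProjSpace m)} {F : CSpace m → ℂ}
    (hF : IsScalarFunction U F) : IsSuperfunction U (fun v => algebraMap ℂ (OddAlg n) (F v)) where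
  holomorphic φ := by
    simp only [Algebra.algebraMap_eq_smul_one, map_smul]
    exact hF.holomorphic.smul_const _
  invariant v hv c := by rw [AlgHom.commutes, hF.invariant v hv c]

/-- Here `scaleOdd (v j)⁻¹ w` is `w` with every `θ_a` replaced by `θ_a / x_j`, an expression of
total degree zero. -/
lemma isSuperfunction_scaleOdd {m n : ℕ} (j : Fin (m + 1)) (w : OddAlg n) :
    IsSuperfunction (affOpen j : Set (ProjSpace m)) (fun v => scaleOdd (v j)⁻¹ w) := by
  refine isSuperfunction_iff.2 ⟨fun A => ?_, fun v hv c A => ?_⟩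
  · simp only [coord_scaleOdd, cone_affOpen]
    exact (((differentiable_apply j).differentiableOn.inv fun v hv => hv).pow _).mul_const _
  · simp only [coord_scaleOdd, Pi.smul_apply, smul_eq_mul, mul_inv]
    rw [← mul_assoc, ← mul_pow, mul_inv_cancel_left₀ c.ne_zero]

/-- The coefficients of a superfunction with respect to the monomials in the `θ_a / x_j`. -/
def coeffFun {m n : ℕ} (j : Fin (m + 1)) (A : Finset (Fin n)) (f : CSpace m → OddAlg n) :
    CSpace m → ℂ :=
  fun v => v j ^ A.card * (oddBasis n).coord A (f v)

lemma IsSuperfunction.coeff {m n : ℕ} {U : Set (ProjSpace m)} {f : CSpace m → OddAlg n}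
    (hf : IsSuperfunction U f) (j : Fin (m + 1)) (A : Finset (Fin n)) :
    IsScalarFunction U (coeffFun j A f) where
  holomorphic := ((differentiable_apply j).pow _).differentiableOn.mul (hf.holomorphic _)
  invariant v hv c := by
    simp only [coeffFun, Pi.smul_apply, smul_eq_mul, ← (isSuperfunction_iff.1 hf).2 v hv c A]
    ring

lemma sum_coeffFun {m n : ℕ} {j : Fin (m + 1)} (f : CSpace m → OddAlg n) {v : CSpace m}
    (hv : v j ≠ 0) :
    ∑ A, algebraMap ℂ (OddAlg n) (coeffFun j A f v) * scaleOdd (v j)⁻¹ (oddBasis n A) = f v := by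
  conv_rhs => rw [← (oddBasis n).sum_repr (f v)]
  refine Finset.sum_congr rfl fun A _ => ?_
  rw [scaleOdd_oddBasis, ← Algebra.smul_def, smul_smul, coeffFun, Module.Basis.coord_apply, inv_pow]
  congr 1
  field_simp

/-- The algebra of superfunctions on `U`. -/
def superfunctions {m : ℕ} (n : ℕ) (U : Set (ProjSpace m)) : Subalgebra ℂ (CSpace m → OddAlg n) where
  carrier := {f | IsSuperfunction U f}
  mul_mem' := IsSuperfunction.mul
  add_mem' := IsSuperfunction.add
  algebraMap_mem' := isSuperfunction_const U

/-- Taking germs of superfunctions is an algebra homomorphism. -/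
def germHom {m n : ℕ} {U : Opens (ProjSpace m)} {p : ProjSpace m} (hp : p ∈ U) :
    superfunctions n (U : Set (ProjSpace m)) →ₐ[ℂ] projStalk m n p where
  toFun f := IsSuperfunction.germ f.2 hp
  map_one' := rfl
  map_mul' _ _ := rfl
  map_zero' := rfl
  map_add' _ _ := rfl
  commutes' c := Subtype.ext (germ_algebraMap p c).symm

lemma projStalk_ext {m n : ℕ} {U : Opens (ProjSpace m)} {p : ProjSpace m} (hp : p ∈ U)
    {a b : projStalk m n p} {f g : CSpace m → OddAlg n} (ha : a.1 = f) (hb : b.1 = g)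
    (h : ∀ v ∈ cone (U : Set (ProjSpace m)), f v = g v) : a = b :=
  Subtype.ext (ha.trans ((germ_eq_iff.2 ⟨U, hp, h⟩).trans hb.symm))

/-- The germs of the monomials in the `θ_a / x_j`. -/
def oddGerm {m : ℕ} (n : ℕ) {j : Fin (m + 1)} {p : ProjSpace m} (hp : p ∈ affOpen j) :
    OddAlg n →ₐ[ℂ] projStalk m n p :=
  (germHom hp).comp ((AlgHom.pi (R := ℂ) (A := fun _ : CSpace m => OddAlg n)
    fun v => scaleOdd (v j)⁻¹).codRestrict (superfunctions n (affOpen j : Set (ProjSpace m)))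
      (isSuperfunction_scaleOdd j))

/-- The expansion of a germ in monomials in the `θ_a / x_j`. -/
lemma germ_eq_sum {m n : ℕ} {U : Opens (ProjSpace m)} {f : CSpace m → OddAlg n}
    (hf : IsSuperfunction (U : Set (ProjSpace m)) f) {p : ProjSpace m} (hp : p ∈ U)
    {j : Fin (m + 1)} (hj : p ∈ affOpen j) :
    hf.germ hp = ∑ A, ((hf.coeff j A).isSuperfunction n).germ hp * oddGerm n hj (oddBasis n A) := by
  let W : Opens (ProjSpace m) := U ⊓ affOpen j
  have hW : p ∈ W := ⟨hp, hj⟩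
  let b : Finset (Fin n) → superfunctions n (W : Set (ProjSpace m)) := fun A =>
    ⟨_, ((hf.coeff j A).isSuperfunction n).mono Set.inter_subset_left⟩ *
      ⟨_, (isSuperfunction_scaleOdd j (oddBasis n A)).mono Set.inter_subset_right⟩
  have h1 : ∑ A, ((hf.coeff j A).isSuperfunction n).germ hp * oddGerm n hj (oddBasis n A) =
      germHom hW (∑ A, b A) := by
    rw [map_sum]; rfl
  rw [h1]
  refine projStalk_ext hW rfl rfl fun v hv => ?_
  have hvj : v ∈ cone (affOpen j : Set (ProjSpace m)) := cone_mono Set.inter_subset_right hv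
  rw [cone_affOpen] at hvj
  rw [← sum_coeffFun f hvj]
  simp [b]

/-- Ring homomorphisms on a stalk agree if they agree on scalar functions and on the
`θ_a / x_j`. -/
lemma projStalk_hom_ext {m n : ℕ} {R : Type*} [Ring R] {p : ProjSpace m} {j : Fin (m + 1)}
    (hj : p ∈ affOpen j) {φ ψ : projStalk m n p →+* R}
    (hs : ∀ (U : Opens (ProjSpace m)) (hp : p ∈ U) (F : CSpace m → ℂ)
      (hF : IsScalarFunction (U : Set (ProjSpace m)) F),
      φ ((hF.isSuperfunction n).germ hp) = ψ ((hF.isSuperfunction n).germ hp))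
    (ho : ∀ w, φ (oddGerm n hj (ExteriorAlgebra.ι ℂ w)) = ψ (oddGerm n hj (ExteriorAlgebra.ι ℂ w)))
    (a : projStalk m n p) : φ a = ψ a := by
  have hodd : ∀ w, φ (oddGerm n hj w) = ψ (oddGerm n hj w) := by
    intro w
    induction w using ExteriorAlgebra.induction with
    | algebraMap c =>
      have hF : IsScalarFunction ((⊤ : Opens (ProjSpace m)) : Set (ProjSpace m)) (fun _ => c) :=
        ⟨differentiableOn_const _, fun _ _ _ => rfl⟩
      have e : oddGerm n hj (algebraMap ℂ _ c) = (hF.isSuperfunction n).germ trivial := by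
        rw [AlgHom.commutes]; exact Subtype.ext (germ_algebraMap p c)
      rw [e]; exact hs _ _ _ hF
    | ι w => exact ho w
    | mul a b ha hb => rw [map_mul, map_mul, map_mul, ha, hb]
    | add a b ha hb => rw [map_add, map_add, map_add, ha, hb]
  obtain ⟨_, U, hU, f, hf, rfl⟩ := a
  change φ (hf.germ hU) = ψ (hf.germ hU)
  rw [germ_eq_sum hf hU hj, map_sum, map_sum]
  refine Finset.sum_congr rfl fun A _ => ?_
  rw [map_mul, map_mul, hs U hU _ (hf.coeff j A), hodd]

lemma even_germ_scalar {m n : ℕ} {U : Opens (ProjSpace m)} {F : CSpace m → ℂ}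
    (hF : IsScalarFunction (U : Set (ProjSpace m)) F) {p : ProjSpace m} (hp : p ∈ U) :
    (hF.isSuperfunction n).germ hp ∈ projParity m n p 0 :=
  (germ_mem_parity rfl).2 ⟨⊤, trivial, fun v _ => by
    rw [Algebra.algebraMap_eq_smul_one]
    exact Submodule.smul_mem _ _ SetLike.GradedOne.one_mem⟩

/-- The even and odd parts are built from scalars and vectors by sums and by multiplication with
pairs of vectors, so the degree bookkeeping is only needed for scalars and vectors. The target
grading is merely a family of additive submonoids, so that it applies both to exterior algebras and
to stalks. -/
lemma ringHom_mem_of_mem_extParity {R M S : Type*} [CommRing R] [AddCommGroup M] [Module R M]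
    [Ring S] (φ : ExteriorAlgebra R M →+* S) (P : ZMod 2 → AddSubmonoid S)
    (h0 : ∀ r, φ (algebraMap R _ r) ∈ P 0) (h1 : ∀ v, φ (ExteriorAlgebra.ι R v) ∈ P 1)
    (hmul : ∀ i j, ∀ a ∈ P i, ∀ b ∈ P j, a * b ∈ P (i + j)) {i : ZMod 2} {a : ExteriorAlgebra R M}
    (ha : a ∈ extParity R M i) : φ a ∈ P i := by
  have h11 : (1 : ZMod 2) + 1 = 0 := by decide
  have key : ∀ (v w : M) (x : ExteriorAlgebra R M) (i : ZMod 2), φ x ∈ P i →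
      φ (ExteriorAlgebra.ι R v * ExteriorAlgebra.ι R w * x) ∈ P i := by
    intro v w x i hx
    have := hmul _ _ _ (hmul _ _ _ (h1 v) _ (h1 w)) _ hx
    rwa [h11, zero_add, ← map_mul, ← map_mul] at this
  have h01 : ∀ i : ZMod 2, i = 0 ∨ i = 1 := by decide
  rcases h01 i with rfl | rfl
  · induction a, ha using CliffordAlgebra.even_induction with
    | algebraMap r => exact h0 r
    | add x y _ _ hx hy => rw [map_add]; exact add_mem hx hy
    | ι_mul_ι_mul v w x _ hx => exact key v w x 0 hx
  · induction a, ha using CliffordAlgebra.odd_induction with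
    | ι v => exact h1 v
    | add x y _ _ hx hy => rw [map_add]; exact add_mem hx hy
    | ι_mul_ι_mul v w x _ hx => exact key v w x 1 hx

lemma map_mem_extParity {R M N : Type*} [CommRing R] [AddCommGroup M] [Module R M]
    [AddCommGroup N] [Module R N] (φ : M →ₗ[R] N) {i : ZMod 2} {a : ExteriorAlgebra R M}
    (ha : a ∈ extParity R M i) : ExteriorAlgebra.map φ a ∈ extParity R N i := by
  refine ringHom_mem_of_mem_extParity (ExteriorAlgebra.map φ).toRingHom
    (fun i => (extParity R N i).toAddSubmonoid) (fun r => ?_) (fun v => ?_)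
    (fun i j a ha b hb =>
      (SetLike.GradedMul.mul_mem (A := extParity R N) ha hb : a * b ∈ extParity R N (i + j))) ha
  · change ExteriorAlgebra.map φ _ ∈ extParity R N 0
    rw [AlgHom.commutes, Algebra.algebraMap_eq_smul_one]
    exact Submodule.smul_mem _ _ SetLike.GradedOne.one_mem
  · change ExteriorAlgebra.map φ _ ∈ extParity R N 1
    rw [ExteriorAlgebra.map_apply_ι]
    exact CliffordAlgebra.ι_mem_evenOdd_one _ _

lemma odd_oddGerm {m n : ℕ} {j : Fin (m + 1)} {p : ProjSpace m} (hp : p ∈ affOpen j)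
    (w : Fin n → ℂ) : oddGerm n hp (ExteriorAlgebra.ι ℂ w) ∈ projParity m n p 1 :=
  (germ_mem_parity rfl).2 ⟨⊤, trivial, fun _ _ =>
    map_mem_extParity _ (CliffordAlgebra.ι_mem_evenOdd_one _ w)⟩

/-! ### Stalks of the sheaf of superfunctions as exterior algebras -/

/-- Anticommutativity gives `2 a² = 0`, and 2 is invertible. This is the relation demanded by the
universal property of the exterior algebra in `extToStalk`. -/
lemma mul_self_eq_zero_of_odd {m n : ℕ} {p : ProjSpace m} {a : projStalk m n p}
    (ha : a ∈ projParity m n p 1) : a * a = 0 := by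
  have h : a * a = -(a * a) := (projSuperspace m n).odd_comm p a ha a ha
  have h2 := add_eq_zero_iff_eq_neg.2 h
  rw [← two_smul ℂ] at h2
  have h3 := congrArg (fun x => (2 : ℂ)⁻¹ • x) h2
  simpa [smul_smul] using h3

section Stalk

variable {k : ℕ} {Y : Type} [TopologicalSpace Y] {h : Y ≃ₜ ProjSpace k}

lemma tendsto_symm_toProj (h : Y ≃ₜ ProjSpace k) (y : Y) :
    Tendsto (fun v => h.symm (toProj v)) (coneNhds (h y)) (𝓝 y) := by
  have h1 := (h.symm.continuous.tendsto (h y)).comp (tendsto_toProj (h y))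
  rwa [h.symm_apply_apply] at h1

/-- Every point near `y` is the image of a representative in the cone, so functions that agree after
pullback to the cone already agree near `y`. -/
lemma compTendsto_symm_toProj_injective (y : Y) {E : Type*} :
    Function.Injective fun g : Germ (𝓝 y) E => g.compTendsto _ (tendsto_symm_toProj h y) := by
  intro g g' e
  induction g using Germ.inductionOn with | _ f => ?_
  induction g' using Germ.inductionOn with | _ f' => ?_
  obtain ⟨U, hU, hv⟩ := mem_coneNhds.1 (Germ.coe_eq.1 e)
  refine Germ.coe_eq.2 ?_
  filter_upwards [h.continuous.continuousAt.preimage_mem_nhds (U.2.mem_nhds hU)] with y' hy'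
  have := hv (rep_mem_cone.2 hy')
  simpa [toProj_rep] using this

variable [ChartedSpace (EuclideanSpace ℂ (Fin k)) Y]

lemma IsBiholomorphic.isScalarFunction (hh : IsBiholomorphic h) {f : Y → ℂ}
    {U : Opens (ProjSpace k)}
    (hf : ContMDiffOn 𝓘(ℂ, EuclideanSpace ℂ (Fin k)) 𝓘(ℂ) ω f (h ⁻¹' U)) :
    IsScalarFunction (U : Set (ProjSpace k)) (fun v => f (h.symm (toProj v))) :=
  ⟨(hh f U).1 hf, fun v _ c => by rw [toProj_smul]⟩

lemma IsScalarFunction.apply_rep_toProj {m : ℕ} {U : Set (ProjSpace m)} {F : CSpace m → ℂ}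
    (hF : IsScalarFunction U F) {v : CSpace m} (hv : v ∈ cone U) : F (toProj v).rep = F v := by
  obtain ⟨c, hc⟩ := exists_rep_eq_smul (mem_cone_iff.1 hv).1
  rw [hc, hF.invariant v hv c]

lemma IsBiholomorphic.contMDiffOn (hh : IsBiholomorphic h) {F : CSpace k → ℂ}
    {U : Opens (ProjSpace k)} (hF : IsScalarFunction (U : Set (ProjSpace k)) F) :
    ContMDiffOn 𝓘(ℂ, EuclideanSpace ℂ (Fin k)) 𝓘(ℂ) ω (fun y => F (h y).rep) (h ⁻¹' U) := by
  refine (hh _ U).2 (hF.holomorphic.congr fun v hv => ?_)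
  rw [h.apply_symm_apply, hF.apply_rep_toProj hv]

/-- The germ of holomorphic function on `Y` given by a scalar function on a cone. -/
def IsBiholomorphic.descGerm (hh : IsBiholomorphic h) {F : CSpace k → ℂ} {U : Opens (ProjSpace k)}
    (hF : IsScalarFunction (U : Set (ProjSpace k)) F) {y : Y} (hy : h y ∈ U) : holStalk k Y y :=
  ⟨(fun y => F (h y).rep : Y → ℂ), _, (hh.contMDiffOn hF).contMDiffAt
    ((U.2.preimage h.continuous).mem_nhds hy), rfl⟩

variable [IsManifold 𝓘(ℂ, EuclideanSpace ℂ (Fin k)) ω Y]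

lemma exists_contMDiffOn (h : Y ≃ₜ ProjSpace k) {y : Y} (g : holStalk k Y y) :
    ∃ (U : Opens (ProjSpace k)) (_ : h y ∈ U) (f : Y → ℂ),
      ContMDiffOn 𝓘(ℂ, EuclideanSpace ℂ (Fin k)) 𝓘(ℂ) ω f (h ⁻¹' U) ∧ g.1 = f := by
  obtain ⟨_, f, hf, rfl⟩ := g
  obtain ⟨u, hu, huo, hyu⟩ := mem_nhds_iff.1 (contMDiffAt_iff_contMDiffAt_nhds (by simp) |>.1 hf)
  refine ⟨⟨h.symm ⁻¹' u, huo.preimage h.symm.continuous⟩, by simpa using hyu, f, ?_, rfl⟩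
  intro z hz
  have hz : z ∈ u := by simpa using hz
  exact ContMDiffAt.contMDiffWithinAt (hu hz)

/-- Germs of holomorphic functions on `Y` as germs of superfunctions. -/
def IsBiholomorphic.scalarGerm (hh : IsBiholomorphic h) (r : ℕ) (y : Y) :
    holStalk k Y y →+* projStalk k r (h y) where
  toFun g := ⟨(g.1.map (algebraMap ℂ (OddAlg r))).compTendsto _ (tendsto_symm_toProj h y), by
    obtain ⟨U, hy, f, hf, e⟩ := exists_contMDiffOn h g
    refine ⟨U, hy, _, (hh.isScalarFunction hf).isSuperfunction r, ?_⟩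
    rw [e]; rfl⟩
  map_one' := Subtype.ext (congrArg Germ.ofFun (funext fun _ => map_one (algebraMap ℂ (OddAlg r))))
  map_zero' :=
    Subtype.ext (congrArg Germ.ofFun (funext fun _ => map_zero (algebraMap ℂ (OddAlg r))))
  map_mul' := by
    rintro ⟨_, f, hf, rfl⟩ ⟨_, g, hg, rfl⟩
    exact Subtype.ext (congrArg Germ.ofFun
      (funext fun v => map_mul (algebraMap ℂ (OddAlg r)) (f _) (g _)))
  map_add' := by
    rintro ⟨_, f, hf, rfl⟩ ⟨_, g, hg, rfl⟩
    exact Subtype.ext (congrArg Germ.ofFun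
      (funext fun v => map_add (algebraMap ℂ (OddAlg r)) (f _) (g _)))

variable {r : ℕ} (hh : IsBiholomorphic h) {y : Y}

lemma scalarGerm_val {g : holStalk k Y y} {f : Y → ℂ} (e : g.1 = f) :
    (hh.scalarGerm r y g).1 = (fun v => algebraMap ℂ (OddAlg r) (f (h.symm (toProj v))) :
      CSpace k → OddAlg r) := by
  obtain ⟨_, hg⟩ := g
  subst e
  rfl

lemma scalarGerm_descGerm {F : CSpace k → ℂ} {U : Opens (ProjSpace k)}
    (hF : IsScalarFunction (U : Set (ProjSpace k)) F) (hy : h y ∈ U) :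
    hh.scalarGerm r y (hh.descGerm hF hy) = (hF.isSuperfunction r).germ hy :=
  projStalk_ext hy (scalarGerm_val hh rfl) rfl fun v hv => by
    rw [h.apply_symm_apply, hF.apply_rep_toProj hv]

lemma scalarGerm_algebraMap (c : ℂ) : hh.scalarGerm r y (algebraMap ℂ _ c) = algebraMap ℂ _ c := by
  have hF : IsScalarFunction ((⊤ : Opens (ProjSpace k)) : Set (ProjSpace k)) (fun _ => c) :=
    ⟨differentiableOn_const _, fun _ _ _ => rfl⟩
  have e : algebraMap ℂ (holStalk k Y y) c = hh.descGerm hF (Opens.mem_top (h y)) := by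
    refine Subtype.ext ?_
    change algebraMap ℂ (Germ (𝓝 y) ℂ) c = _
    rw [Algebra.algebraMap_eq_smul_one]
    refine Eq.trans (b := ((c • (1 : Y → ℂ) : Y → ℂ) : Germ _ _)) rfl ?_
    exact Germ.coe_eq.2 (Filter.Eventually.of_forall fun v => by simp)
  rw [e, scalarGerm_descGerm]
  exact Subtype.ext (germ_algebraMap _ c).symm

lemma even_scalarGerm (g : holStalk k Y y) : hh.scalarGerm r y g ∈ projParity k r (h y) 0 := by
  obtain ⟨U, hy, f, hf, e⟩ := exists_contMDiffOn h g
  have e2 : hh.scalarGerm r y g = ((hh.isScalarFunction hf).isSuperfunction r).germ hy :=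
    projStalk_ext hy (scalarGerm_val hh e) rfl fun v _ => rfl
  rw [e2]
  exact even_germ_scalar (hh.isScalarFunction hf) hy

/-- The coefficient of a germ at a monomial in the `θ_a / x_j`. -/
def coeffGerm (j : Fin (k + 1)) (A : Finset (Fin r)) (p : ProjSpace k) :
    Germ (coneNhds p) (OddAlg r) →+ Germ (coneNhds p) ℂ where
  toFun x := ((fun v => v j ^ A.card : CSpace k → ℂ) : Germ (coneNhds p) ℂ) *
    x.map ((oddBasis r).coord A)
  map_zero' := by
    have : ((0 : Germ (coneNhds p) (OddAlg r)).map ((oddBasis r).coord A)) = 0 :=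
      congrArg Germ.ofFun (funext fun _ => map_zero ((oddBasis r).coord A))
    rw [this, mul_zero]
  map_add' a b := by
    induction a using Germ.inductionOn with | _ f => ?_
    induction b using Germ.inductionOn with | _ g => ?_
    refine congrArg Germ.ofFun (funext fun v => ?_)
    change v j ^ A.card * (oddBasis r).coord A (f v + g v) = v j ^ A.card * (oddBasis r).coord A (f v)
      + v j ^ A.card * (oddBasis r).coord A (g v)
    rw [map_add, mul_add]

lemma coeffGerm_coe (j : Fin (k + 1)) (A : Finset (Fin r)) (p : ProjSpace k)
    (f : CSpace k → OddAlg r) : coeffGerm j A p f = (coeffFun j A f : Germ (coneNhds p) ℂ) := rfl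

/-- The functionals `coeffGerm j A` are dual to the monomials in the `θ_a / x_j`: the factor `v_j ^
|A|` cancels the denominators. Being of nonzero degree, that factor is not itself a superfunction,
which is why coefficients are taken among all germs along the cone. -/
lemma coeffGerm_mul {j : Fin (k + 1)} (hj : h y ∈ affOpen j) (A B : Finset (Fin r))
    (g : holStalk k Y y) :
    coeffGerm j A (h y) (hh.scalarGerm r y g * oddGerm r hj (oddBasis r B)).1 =
      if B = A then g.1.compTendsto _ (tendsto_symm_toProj h y) else 0 := by
  obtain ⟨U, hy, f, hf, e⟩ := exists_contMDiffOn h g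
  have e1 : (hh.scalarGerm r y g * oddGerm r hj (oddBasis r B)).1 =
      ((fun v => algebraMap ℂ (OddAlg r) (f (h.symm (toProj v))) * scaleOdd (v j)⁻¹ (oddBasis r B) :
        CSpace k → OddAlg r) : Germ (coneNhds (h y)) (OddAlg r)) := by
    change (hh.scalarGerm r y g).1 * (oddGerm r hj (oddBasis r B)).1 = _
    rw [scalarGerm_val hh e]; rfl
  rw [e1, coeffGerm_coe, e]
  have ev := coneNhds_le_principal (affOpen j).2 hj
  split_ifs with hBA
  · subst hBA
    refine Germ.coe_eq.2 ?_
    filter_upwards [ev] with v hv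
    rw [show (affOpen j).carrier = (affOpen j : Set (ProjSpace k)) from rfl, cone_affOpen] at hv
    have hv : v j ≠ 0 := hv
    simp only [coeffFun, scaleOdd_oddBasis, ← Algebra.smul_def, map_smul, Module.Basis.coord_apply,
      Module.Basis.repr_self, Finsupp.single_eq_same, smul_eq_mul, mul_one, Function.comp_apply]
    rw [mul_left_comm, ← mul_pow, mul_inv_cancel₀ hv, one_pow, mul_one]
  · refine Germ.coe_eq.2 (Eventually.of_forall fun v => ?_)
    simp only [coeffFun, scaleOdd_oddBasis, ← Algebra.smul_def, map_smul, Module.Basis.coord_apply,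
      Module.Basis.repr_self, smul_eq_mul, Finsupp.single_eq_of_ne' hBA, mul_zero]

lemma coeff_eq_zero {j : Fin (k + 1)} (hj : h y ∈ affOpen j) {g : Finset (Fin r) → holStalk k Y y}
    (hg : ∑ B, hh.scalarGerm r y (g B) * oddGerm r hj (oddBasis r B) = 0) (A : Finset (Fin r)) :
    g A = 0 := by
  have e := congrArg (fun x : projStalk k r (h y) => coeffGerm j A (h y) x.1) hg
  simp only [AddSubmonoidClass.coe_finsetSum, map_sum, coeffGerm_mul] at e
  rw [Finset.sum_ite_eq' Finset.univ A, if_pos (Finset.mem_univ A)] at e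
  refine Subtype.ext (compTendsto_symm_toProj_injective (h := h) y (e.trans ?_))
  exact map_zero (coeffGerm j A (h y))

/-- The exterior algebra of `𝒪^r` maps to the stalk of the sheaf of superfunctions, the standard
basis being mapped to the `θ_a / x_j`. -/
def IsBiholomorphic.extToStalk {j : Fin (k + 1)} (hj : h y ∈ affOpen j) :
    ExteriorAlgebra (holStalk k Y y) (Fin r → holStalk k Y y) →+* projStalk k r (h y) :=
  -- The stalk is not commutative, but scalar germs are even and hence central, which is all that an
  -- algebra structure requires.
  letI : Algebra (holStalk k Y y) (projStalk k r (h y)) := (hh.scalarGerm r y).toAlgebra'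
    fun g x => (projSuperspace k r).even_comm (h y) _ (even_scalarGerm hh g) x
  (ExteriorAlgebra.lift (holStalk k Y y)
    ⟨Fintype.linearCombination (holStalk k Y y)
      fun a : Fin r => oddGerm r hj (ExteriorAlgebra.ι ℂ (Pi.single a 1)), fun t => by
        have hodd : ∀ s : Finset (Fin r), ∑ a ∈ s, t a • oddGerm r hj
            (ExteriorAlgebra.ι ℂ (Pi.single a 1)) ∈ projParity k r (h y) 1 := fun s =>
          Submodule.sum_mem _ fun a _ => by
            rw [Algebra.smul_def]
            have := (projSuperspace k r).parity_mul (h y) 0 1 _ (even_scalarGerm hh (t a)) _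
              (odd_oddGerm hj (Pi.single a 1))
            rwa [zero_add] at this
        have h1 := hodd Finset.univ
        rw [← Fintype.linearCombination_apply (R := holStalk k Y y)] at h1
        exact mul_self_eq_zero_of_odd h1⟩).toRingHom

lemma extToStalk_algebraMap {j : Fin (k + 1)} (hj : h y ∈ affOpen j) (g : holStalk k Y y) :
    hh.extToStalk (r := r) hj (algebraMap _ _ g) = hh.scalarGerm r y g := by
  let _ : Algebra (holStalk k Y y) (projStalk k r (h y)) := (hh.scalarGerm r y).toAlgebra'
    fun g x => (projSuperspace k r).even_comm (h y) _ (even_scalarGerm hh g) x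
  exact AlgHom.commutes (ExteriorAlgebra.lift (holStalk k Y y) _) g

lemma extToStalk_ι {j : Fin (k + 1)} (hj : h y ∈ affOpen j) (t : Fin r → holStalk k Y y) :
    hh.extToStalk hj (ExteriorAlgebra.ι _ t) =
      ∑ a, hh.scalarGerm r y (t a) * oddGerm r hj (ExteriorAlgebra.ι ℂ (Pi.single a 1)) := by
  let _ : Algebra (holStalk k Y y) (projStalk k r (h y)) := (hh.scalarGerm r y).toAlgebra'
    fun g x => (projSuperspace k r).even_comm (h y) _ (even_scalarGerm hh g) x
  exact ExteriorAlgebra.lift_ι_apply _ _ _ t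

/-- The exterior algebra of `ℂ^r` maps to that of `𝒪^r`. -/
def constExt (R : Type*) [CommRing R] [Algebra ℂ R] (r : ℕ) :
    OddAlg r →ₐ[ℂ] ExteriorAlgebra R (Fin r → R) :=
  ExteriorAlgebra.lift ℂ ⟨((ExteriorAlgebra.ι R).restrictScalars ℂ) ∘ₗ
    (LinearMap.compLeft (Algebra.linearMap ℂ R) (Fin r)), fun _ => ExteriorAlgebra.ι_sq_zero _⟩

lemma constExt_ι (R : Type*) [CommRing R] [Algebra ℂ R] (w : Fin r → ℂ) :
    constExt R r (ExteriorAlgebra.ι ℂ w) =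
      ExteriorAlgebra.ι R (fun a => algebraMap ℂ R (w a)) :=
  ExteriorAlgebra.lift_ι_apply _ _ _ w

lemma constExt_oddBasis (R : Type*) [CommRing R] [Algebra ℂ R] (A : Finset (Fin r)) :
    constExt R r (oddBasis r A) = (Pi.basisFun R (Fin r)).ExteriorAlgebra A := by
  rw [oddBasis, ExteriorAlgebra.basis_apply_ofCard _ rfl, ExteriorAlgebra.basis_apply_ofCard _ rfl]
  simp only [ExteriorAlgebra.ιMulti_family, ExteriorAlgebra.ιMulti_apply, map_list_prod,
    List.map_ofFn]
  congr 2
  funext i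
  simp only [Function.comp_apply, constExt_ι, Pi.basisFun_apply]
  congr 1
  funext a
  simp [Pi.single_apply, apply_ite (algebraMap ℂ R)]

lemma extToStalk_constExt {j : Fin (k + 1)} (hj : h y ∈ affOpen j) (w : OddAlg r) :
    hh.extToStalk hj (constExt (holStalk k Y y) r w) = oddGerm r hj w := by
  induction w using ExteriorAlgebra.induction with
  | algebraMap c =>
    rw [AlgHom.commutes, AlgHom.commutes, IsScalarTower.algebraMap_apply ℂ (holStalk k Y y),
      extToStalk_algebraMap, scalarGerm_algebraMap]
  | ι w =>
    rw [constExt_ι, extToStalk_ι]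
    simp only [scalarGerm_algebraMap]
    conv_rhs => rw [← Finset.univ_sum_single w]
    rw [map_sum, map_sum]
    refine Finset.sum_congr rfl fun a _ => ?_
    rw [← Algebra.smul_def, ← map_smul, ← map_smul]
    congr 2
    rw [← Pi.single_smul, smul_eq_mul, mul_one]
  | mul a b ha hb => rw [map_mul, map_mul, map_mul, ha, hb]
  | add a b ha hb => rw [map_add, map_add, map_add, ha, hb]

lemma extToStalk_sum {j : Fin (k + 1)} (hj : h y ∈ affOpen j)
    (g : Finset (Fin r) → holStalk k Y y) :
    hh.extToStalk hj (∑ A, g A • (Pi.basisFun (holStalk k Y y) (Fin r)).ExteriorAlgebra A) =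
      ∑ A, hh.scalarGerm r y (g A) * oddGerm r hj (oddBasis r A) := by
  rw [map_sum]
  refine Finset.sum_congr rfl fun A _ => ?_
  rw [Algebra.smul_def, map_mul, extToStalk_algebraMap, ← constExt_oddBasis, extToStalk_constExt]

lemma germ_eq_extToStalk {j : Fin (k + 1)} (hj : h y ∈ affOpen j) {U : Opens (ProjSpace k)}
    {f : CSpace k → OddAlg r} (hf : IsSuperfunction (U : Set (ProjSpace k)) f) (hy : h y ∈ U) :
    hf.germ hy = ∑ A, hh.scalarGerm r y (hh.descGerm (hf.coeff j A) hy) *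
      oddGerm r hj (oddBasis r A) := by
  rw [germ_eq_sum hf hy hj]
  simp only [scalarGerm_descGerm]

/-- The monomial basis of the exterior algebra goes to the monomials in the `θ_a / x_j`. Those are
independent over the holomorphic germs by `coeff_eq_zero`, and they span by the expansion
`germ_eq_extToStalk`. -/
lemma extToStalk_bijective {j : Fin (k + 1)} (hj : h y ∈ affOpen j) :
    Function.Bijective (hh.extToStalk (r := r) hj) := by
  constructor
  · refine (injective_iff_map_eq_zero _).2 fun x hx => ?_
    let b := (Pi.basisFun (holStalk k Y y) (Fin r)).ExteriorAlgebra
    rw [← b.sum_repr x, extToStalk_sum] at hx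
    refine b.ext_elem fun A => ?_
    rw [coeff_eq_zero hh hj hx A, map_zero]; rfl
  · rintro ⟨_, U, hU, f, hf, rfl⟩
    exact ⟨_, (extToStalk_sum hh hj _).trans (germ_eq_extToStalk hh hj hf hU).symm⟩

lemma extToStalk_mem_parity {j : Fin (k + 1)} (hj : h y ∈ affOpen j) {i : ZMod 2}
    {a : ExteriorAlgebra (holStalk k Y y) (Fin r → holStalk k Y y)}
    (ha : a ∈ extParity (holStalk k Y y) (Fin r → holStalk k Y y) i) :
    hh.extToStalk hj a ∈ projParity k r (h y) i := by
  refine ringHom_mem_of_mem_extParity (hh.extToStalk hj)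
    (fun i => (projParity k r (h y) i).toAddSubmonoid) (fun g => ?_) (fun t => ?_)
    (fun i j a ha b hb => (projSuperspace k r).parity_mul (h y) i j a ha b hb) ha
  · rw [extToStalk_algebraMap]
    exact even_scalarGerm hh g
  · rw [extToStalk_ι]
    refine Submodule.sum_mem (projParity k r (h y) 1) fun a _ => ?_
    have := (projSuperspace k r).parity_mul (h y) 0 1 _ (even_scalarGerm hh (t a)) _
      (odd_oddGerm hj (Pi.single a 1))
    rwa [zero_add] at this

end Stalk

/-! ### Sections of the sheaf of holomorphic functions -/

/-- The local functions glue because all of them are, near a point, equal to the one function `F`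
that takes the value of the germ `s y` at `y`. -/
lemma isHolSection_of_local {k : ℕ} {Y : Type} [TopologicalSpace Y]
    [ChartedSpace (EuclideanSpace ℂ (Fin k)) Y] {W : Opens Y} {s : ∀ y : W, holStalk k Y y}
    (hs : ∀ x : W, ∃ (V : Opens Y) (_ : x.1 ∈ V) (f : Y → ℂ),
      ContMDiffOn 𝓘(ℂ, EuclideanSpace ℂ (Fin k)) 𝓘(ℂ) ω f V ∧
      ∀ y : W, y.1 ∈ V → (s y).1 = (f : Germ (𝓝 y.1) ℂ)) : IsHolSection k Y W s := by
  classical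
  let F : Y → ℂ := fun y => if hy : y ∈ W then (s ⟨y, hy⟩).1.value else 0
  have key : ∀ x : W, ∃ f : Y → ℂ, ContMDiffAt 𝓘(ℂ, EuclideanSpace ℂ (Fin k)) 𝓘(ℂ) ω f x ∧
      (s x).1 = (f : Germ (𝓝 x.1) ℂ) ∧ F =ᶠ[𝓝 x.1] f := by
    intro x
    obtain ⟨V, hx, f, hf, e⟩ := hs x
    refine ⟨f, hf.contMDiffAt (V.2.mem_nhds hx), e x hx, ?_⟩
    filter_upwards [V.2.mem_nhds hx, W.2.mem_nhds x.2] with y hyV hyW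
    simp only [F]
    rw [dif_pos (show y ∈ W from hyW), e ⟨y, hyW⟩ hyV]
    rfl
  refine ⟨F, fun y hy => ?_, fun x => ?_⟩
  · obtain ⟨f, hf, -, e⟩ := key ⟨y, hy⟩
    exact (hf.congr_of_eventuallyEq e).contMDiffWithinAt
  · obtain ⟨f, -, e1, e2⟩ := key x
    exact e1.trans (Germ.coe_eq.2 e2).symm

/-- The algebra of sections of a superspace over an open set. -/
def Superspace.sections (X : Superspace) (U : Opens X.carrier) :
    Subalgebra ℂ (∀ y : U, X.stalk y) where
  carrier := {s | X.sheaf.pred s}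
  mul_mem' := X.mul_mem U _ _
  add_mem' := X.add_mem U _ _
  algebraMap_mem' := X.algebraMap_mem U

/-! ### Superspaces isomorphic to projective superspace are split -/

/-- An isomorphism of the superspace `X` with `ℙ^{k|r}`. -/
structure Superspace.ProjIso (X : Superspace) (k r : ℕ) where
  /-- the homeomorphism of the underlying spaces -/
  homeo : X.carrier ≃ₜ ProjSpace k
  /-- the isomorphisms of the stalks -/
  iso : ∀ x, projStalk k r (homeo x) ≃ₐ[ℂ] X.stalk x
  -- One inclusion is enough: the even and odd parts are complementary on both sides, so the
  -- converse follows in `ext_mem_parity_iff`.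
  mem_parity : ∀ x i, ∀ a ∈ projParity k r (homeo x) i, iso x a ∈ X.parity x i
  pred_iff : ∀ (U : Opens X.carrier) (s : ∀ x : U, X.stalk x), X.sheaf.pred s ↔
    ∀ x : U, ∃ (W : Opens (ProjSpace k)) (_ : homeo x ∈ W) (f : CSpace k → OddAlg r)
      (hf : IsSuperfunction (W : Set (ProjSpace k)) f),
      ∀ (y : U) (hy : homeo y ∈ W), s y = iso y (hf.germ hy)

namespace Superspace.ProjIso

variable {X : Superspace} {k r : ℕ} (Φ : X.ProjIso k r)

/-- The index of an affine chart around a point. -/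
def idx (y : X.carrier) : Fin (k + 1) := (exists_mem_affOpen (Φ.homeo y)).choose

lemma mem_idx (y : X.carrier) : Φ.homeo y ∈ affOpen (Φ.idx y) :=
  (exists_mem_affOpen (Φ.homeo y)).choose_spec

/-- The open set of points mapped to `W`. -/
def preim (W : Opens (ProjSpace k)) : Opens X.carrier :=
  ⟨Φ.homeo ⁻¹' W, W.2.preimage Φ.homeo.continuous⟩

lemma pred_oddGerm {j : Fin (k + 1)} {U : Opens X.carrier} (hU : U ≤ Φ.preim (affOpen j))
    (w : OddAlg r) : X.sheaf.pred (fun y : U => Φ.iso y (oddGerm r (hU y.2) w)) :=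
  (Φ.pred_iff _ _).2 fun x =>
    ⟨affOpen j, hU x.2, _, isSuperfunction_scaleOdd j w, fun _ _ => rfl⟩

lemma isScalarFunction_ratio (i j : Fin (k + 1)) :
    IsScalarFunction (affOpen j : Set (ProjSpace k)) (fun v => v i / v j) where
  holomorphic := by
    rw [cone_affOpen]
    have h (l : Fin (k + 1)) : DifferentiableOn ℂ (fun v : CSpace k => v l) {v | v j ≠ 0} :=
      (differentiable_apply l).differentiableOn
    simp only [div_eq_mul_inv]
    exact (h i).mul ((h j).inv fun v hv => hv)
  invariant v _ c := by
    simp only [Pi.smul_apply, smul_eq_mul]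
    exact mul_div_mul_left _ _ c.ne_zero

variable [ChartedSpace (EuclideanSpace ℂ (Fin k)) X.carrier] (hh : IsBiholomorphic Φ.homeo)

include hh in
lemma descGerm_ratio_mul {i j : Fin (k + 1)} {y : X.carrier} (hi : Φ.homeo y ∈ affOpen i)
    (hj : Φ.homeo y ∈ affOpen j) : hh.descGerm (isScalarFunction_ratio i j) hj *
      hh.descGerm (isScalarFunction_ratio j i) hi = 1 := by
  refine Subtype.ext (Germ.coe_eq.2 ?_)
  filter_upwards [(Φ.preim (affOpen i)).2.mem_nhds hi, (Φ.preim (affOpen j)).2.mem_nhds hj]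
    with z hzi hzj
  have hzi := mem_affOpen.1 (show Φ.homeo z ∈ affOpen i from hzi)
  have hzj := mem_affOpen.1 (show Φ.homeo z ∈ affOpen j from hzj)
  change (Φ.homeo z).rep i / (Φ.homeo z).rep j * ((Φ.homeo z).rep j / (Φ.homeo z).rep i) = 1
  field_simp

/-- The germ of `x_i / x_j`. -/
def ratio {i j : Fin (k + 1)} {y : X.carrier} (hi : Φ.homeo y ∈ affOpen i)
    (hj : Φ.homeo y ∈ affOpen j) : (holStalk k X.carrier y)ˣ :=
  ⟨_, _, Φ.descGerm_ratio_mul hh hi hj, Φ.descGerm_ratio_mul hh hj hi⟩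

variable [IsManifold 𝓘(ℂ, EuclideanSpace ℂ (Fin k)) ω X.carrier]

/-- The change of frame `(x_i / x_j) · (θ / x_i) = θ / x_j`, that is, the cocycle of `𝒪(-1)`. -/
lemma scalarGerm_ratio_mul {i j : Fin (k + 1)} {y : X.carrier} (hi : Φ.homeo y ∈ affOpen i)
    (hj : Φ.homeo y ∈ affOpen j) (w : Fin r → ℂ) :
    hh.scalarGerm r y (Φ.ratio hh hi hj) * oddGerm r hi (ExteriorAlgebra.ι ℂ w) =
      oddGerm r hj (ExteriorAlgebra.ι ℂ w) := by
  change hh.scalarGerm r y (hh.descGerm (isScalarFunction_ratio i j) hj) * _ = _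
  rw [scalarGerm_descGerm]
  refine projStalk_ext (U := affOpen i ⊓ affOpen j) ⟨hi, hj⟩ (f := _ * _) rfl rfl fun v hv => ?_
  have hvi : v ∈ cone (affOpen i : Set (ProjSpace k)) := cone_mono Set.inter_subset_left hv
  rw [cone_affOpen] at hvi
  have hvi : v i ≠ 0 := hvi
  change algebraMap ℂ (OddAlg r) (v i / v j) * scaleOdd (v i)⁻¹ (ExteriorAlgebra.ι ℂ w) =
    scaleOdd (v j)⁻¹ (ExteriorAlgebra.ι ℂ w)
  simp only [scaleOdd, ExteriorAlgebra.map_apply_ι, LinearMap.smul_apply,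
    LinearMap.id_apply, map_smul, ← Algebra.smul_def, smul_smul]
  congr 1
  field_simp

/-- The stalks of `X` as exterior algebras. -/
def ext (y : X.carrier) :
    ExteriorAlgebra (holStalk k X.carrier y) (Fin r → holStalk k X.carrier y) ≃+* X.stalk y :=
  (RingEquiv.ofBijective _ (extToStalk_bijective hh (Φ.mem_idx y))).trans (Φ.iso y).toRingEquiv

lemma ext_apply (y : X.carrier)
    (a : ExteriorAlgebra (holStalk k X.carrier y) (Fin r → holStalk k X.carrier y)) :
    Φ.ext hh y a = Φ.iso y (hh.extToStalk (Φ.mem_idx y) a) := rfl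

lemma ext_algebraMap (y : X.carrier) (g : holStalk k X.carrier y) :
    Φ.ext hh y (algebraMap _ _ g) = Φ.iso y (hh.scalarGerm r y g) := by
  rw [ext_apply, extToStalk_algebraMap]

/-- The identification of the stalk at `y` uses a chart `idx y` chosen separately for each point,
with no continuity in `y`. Multiplying the coordinates by the inverse ratio expresses everything in
one fixed chart `j`, where sections can be recognized. -/
lemma ext_ι {j : Fin (k + 1)} {y : X.carrier} (hj : Φ.homeo y ∈ affOpen j)
    (t : Fin r → holStalk k X.carrier y) :
    Φ.ext hh y (ExteriorAlgebra.ι _ t) = Φ.iso y (∑ a, hh.scalarGerm r y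
      (((Φ.ratio hh (Φ.mem_idx y) hj)⁻¹ : (holStalk k X.carrier y)ˣ) * t a) *
        oddGerm r hj (ExteriorAlgebra.ι ℂ (Pi.single a 1))) := by
  rw [ext_apply, extToStalk_ι]
  congr 1
  refine Finset.sum_congr rfl fun a _ => ?_
  rw [← Φ.scalarGerm_ratio_mul hh (Φ.mem_idx y) hj, ← mul_assoc, ← map_mul, mul_right_comm,
    Units.inv_mul, one_mul]

lemma pred_scalarGerm {U : Opens X.carrier} {g : ∀ y : U, holStalk k X.carrier y}
    (hg : IsHolSection k X.carrier U g) :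
    X.sheaf.pred (fun y : U => Φ.iso y (hh.scalarGerm r y.1 (g y))) := by
  obtain ⟨f, hf, e⟩ := hg
  refine (Φ.pred_iff _ _).2 fun x => ?_
  let W : Opens (ProjSpace k) := ⟨Φ.homeo.symm ⁻¹' U, U.2.preimage Φ.homeo.symm.continuous⟩
  have hW : Φ.homeo ⁻¹' (W : Set (ProjSpace k)) = U := by
    ext z; change Φ.homeo.symm (Φ.homeo z) ∈ U ↔ z ∈ U; rw [Φ.homeo.symm_apply_apply]
  have hs := hh.isScalarFunction (U := W) (hW ▸ hf)
  have hx : Φ.homeo x.1 ∈ W := by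
    change x.1 ∈ Φ.homeo ⁻¹' (W : Set (ProjSpace k))
    rw [hW]; exact x.2
  refine ⟨W, hx, _, hs.isSuperfunction r, fun y hy => ?_⟩
  congr 1
  exact projStalk_ext hy (scalarGerm_val hh (e y)) rfl fun v _ => rfl

/-- In one direction the coefficient functional at the singleton `{a}` recovers `g y a` from a local
superfunction. In the other, the sum is built from sections by products and sums. -/
lemma pred_sum_iff {j : Fin (k + 1)} {U : Opens X.carrier} (hU : U ≤ Φ.preim (affOpen j))
    (g : ∀ y : U, Fin r → holStalk k X.carrier y) :
    X.sheaf.pred (fun y : U => Φ.iso y (∑ a, hh.scalarGerm r y.1 (g y a) *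
      oddGerm r (hU y.2) (ExteriorAlgebra.ι ℂ (Pi.single a 1)))) ↔
    ∀ a, IsHolSection k X.carrier U (fun y => g y a) := by
  constructor
  · intro hp a
    refine isHolSection_of_local fun x => ?_
    obtain ⟨W, hx, f, hf, e⟩ := (Φ.pred_iff _ _).1 hp x
    refine ⟨Φ.preim W, hx, _, hh.contMDiffOn (hf.coeff j {a}), fun y hy => ?_⟩
    have hj : Φ.homeo y.1 ∈ affOpen j := hU y.2
    have hy' : Φ.homeo y.1 ∈ W := hy
    have h1 : ∑ b, hh.scalarGerm r y.1 (g y b) *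
        oddGerm r hj (ExteriorAlgebra.ι ℂ (Pi.single b 1)) = hf.germ hy' :=
      (Φ.iso y).injective (e y hy)
    have h2 := congrArg (fun x : projStalk k r (Φ.homeo y.1) => coeffGerm j {a} _ x.1) h1
    simp only [← oddBasis_singleton, AddSubmonoidClass.coe_finsetSum, map_sum, coeffGerm_mul,
      Finset.singleton_inj] at h2
    rw [Finset.sum_ite_eq' Finset.univ a, if_pos (Finset.mem_univ a)] at h2
    refine compTendsto_symm_toProj_injective (h := Φ.homeo) y.1 (h2.trans ?_)
    refine Germ.coe_eq.2 (mem_coneNhds.2 ⟨W, hy', fun v hv => ?_⟩)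
    change coeffFun j {a} f v = coeffFun j {a} f (Φ.homeo (Φ.homeo.symm (toProj v))).rep
    rw [Φ.homeo.apply_symm_apply, (hf.coeff j {a}).apply_rep_toProj hv]
  · intro hg
    have : (fun y : U => Φ.iso y (∑ a, hh.scalarGerm r y.1 (g y a) *
        oddGerm r (hU y.2) (ExteriorAlgebra.ι ℂ (Pi.single a 1)))) =
        ∑ a, (fun y : U => Φ.iso y (hh.scalarGerm r y.1 (g y a))) *
          (fun y : U => Φ.iso y (oddGerm r (hU y.2) (ExteriorAlgebra.ι ℂ (Pi.single a 1)))) := by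
      funext y
      simp [map_sum]
    rw [this]
    exact (X.sections U).sum_mem fun a _ => (X.sections U).mul_mem
      (Φ.pred_scalarGerm hh (hg a)) (Φ.pred_oddGerm hU _)

/-- The sheaf `𝒪(-1)^r`, generated by the odd coordinates. -/
def cotangent : LocallyFreeSheaf k X.carrier r where
  stalk y := Fin r → holStalk k X.carrier y
  sheaf :=
    { pred := fun {U} s => X.sheaf.pred (U := U)
        (fun y : U => Φ.ext hh y.1 (ExteriorAlgebra.ι _ (s y)))
      res := fun i s hs => X.sheaf.res i _ hs
      locality := fun {U} s hs => X.sheaf.locality (U := U) _ hs }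
  frame x := by
    let j := Φ.idx x
    -- At `y` the standard vector `e_a` stands for `θ_a / x_i` with `i = idx y`. The frame is to
    -- consist of the `θ_a / x_j` for the fixed `j`, hence the rescaling by the unit `x_i / x_j`.
    refine ⟨Φ.preim (affOpen j), Φ.mem_idx x, fun y => (Pi.basisFun _ (Fin r)).unitsSMul
      fun _ => Φ.ratio hh (Φ.mem_idx y.1) y.2, fun W hW s => ?_⟩
    have e := Φ.pred_sum_iff hh hW (fun y a =>
      ((Φ.ratio hh (Φ.mem_idx y.1) (hW y.2))⁻¹ : (holStalk k X.carrier y.1)ˣ) * s y a)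
    have h1 := funext fun y : W => Φ.ext_ι hh (hW y.2) (s y)
    refine Iff.trans (iff_of_eq (congrArg (fun t => X.sheaf.pred (U := W) t) h1)) (e.trans ?_)
    refine forall_congr' fun a => iff_of_eq (congrArg _ (funext fun y => ?_))
    refine Eq.trans ?_ (Module.Basis.repr_unitsSMul (Pi.basisFun _ (Fin r))
      (fun _ => Φ.ratio hh (Φ.mem_idx y.1) (hW y.2)) (s y) a).symm
    rw [Pi.basisFun_repr, Units.smul_def, smul_eq_mul]

end Superspace.ProjIso

/-! ### Parity and sections under the identification with the exterior algebra -/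

namespace Superspace.ProjIso

variable {X : Superspace} {k r : ℕ} (Φ : X.ProjIso k r)
  [ChartedSpace (EuclideanSpace ℂ (Fin k)) X.carrier]
  [IsManifold 𝓘(ℂ, EuclideanSpace ℂ (Fin k)) ω X.carrier] (hh : IsBiholomorphic Φ.homeo)

lemma ext_mem_parity_iff {y : X.carrier} {i : ZMod 2}
    {a : ExteriorAlgebra (holStalk k X.carrier y) (Fin r → holStalk k X.carrier y)} :
    Φ.ext hh y a ∈ X.parity y i ↔
      a ∈ extParity (holStalk k X.carrier y) (Fin r → holStalk k X.carrier y) i := by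
  have hmem : ∀ {i : ZMod 2} {a : ExteriorAlgebra (holStalk k X.carrier y)
      (Fin r → holStalk k X.carrier y)},
      a ∈ extParity (holStalk k X.carrier y) (Fin r → holStalk k X.carrier y) i →
      Φ.ext hh y a ∈ X.parity y i := fun ha =>
    Φ.mem_parity y _ _ (extToStalk_mem_parity hh (Φ.mem_idx y) ha)
  refine ⟨fun ha => ?_, hmem⟩
  -- For the converse, split `a` into its components: the component of the wrong parity has an image
  -- that is both even and odd, hence zero.
  have hz : ∀ x, x ∈ X.parity y 0 → x ∈ X.parity y 1 → x = 0 := fun x =>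
    Submodule.disjoint_def.1 (X.parity_isCompl y).disjoint x
  obtain ⟨a₀, h₀, a₁, h₁, rfl⟩ := Submodule.mem_sup.1
    ((CliffordAlgebra.evenOdd_isCompl (0 : QuadraticForm (holStalk k X.carrier y)
      (Fin r → holStalk k X.carrier y))).sup_eq_top ▸ Submodule.mem_top : a ∈ _)
  rw [map_add] at ha
  have h01 : ∀ i : ZMod 2, i = 0 ∨ i = 1 := by decide
  rcases h01 i with rfl | rfl
  · have h2 : Φ.ext hh y a₁ = 0 := hz _
      (by simpa using Submodule.sub_mem _ ha (hmem h₀)) (hmem h₁)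
    rw [(Φ.ext hh y).injective (h2.trans (map_zero _).symm), add_zero]
    exact h₀
  · have h2 : Φ.ext hh y a₀ = 0 := hz _ (hmem h₀)
      (by simpa using Submodule.sub_mem _ ha (hmem h₁))
    rw [(Φ.ext hh y).injective (h2.trans (map_zero _).symm), zero_add]
    exact h₁

/-- The generators of the algebra of sections of the exterior algebra of the sheaf
`Φ.cotangent`. -/
abbrev extGenerators (W : Opens X.carrier) :
    Set (∀ y : W, (Φ.cotangent hh).extStalk y.1) :=
  {a | ∃ f : ∀ y : W, holStalk k X.carrier y, IsHolSection k X.carrier W f ∧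
    a = fun y : W => algebraMap (holStalk k X.carrier y) ((Φ.cotangent hh).extStalk y) (f y)} ∪
  {a | ∃ t : ∀ y : W, (Φ.cotangent hh).stalk y.1, (Φ.cotangent hh).sheaf.pred (U := W) t ∧
    a = fun y : W => ExteriorAlgebra.ι (holStalk k X.carrier y) (t y)}

lemma pred_of_mem_closure {W : Opens X.carrier} {a : ∀ y : W, (Φ.cotangent hh).extStalk y.1}
    (ha : a ∈ Subring.closure (Φ.extGenerators hh W)) :
    X.sheaf.pred (fun y : W => Φ.ext hh y.1 (a y)) := by
  induction ha using Subring.closure_induction with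
  | mem a ha =>
    rcases ha with ⟨f, hf, rfl⟩ | ⟨t, ht, rfl⟩
    · have := Φ.pred_scalarGerm hh hf
      convert! this using 2 with y
      exact Φ.ext_algebraMap hh y.1 (f y)
    -- By construction a family in `cotangent` is a section exactly when its image in the stalks of
    -- `X` is one.
    · exact ht
  | zero =>
    convert! (X.sections W).zero_mem using 2 with y
    exact map_zero (Φ.ext hh y.1)
  | one =>
    convert! (X.sections W).one_mem using 2 with y
    exact map_one (Φ.ext hh y.1)
  | add a b _ _ ha hb =>
    convert! (X.sections W).add_mem ha hb using 2 with y
    exact map_add (Φ.ext hh y.1) _ _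
  | neg a _ ha =>
    convert! (X.sections W).neg_mem ha using 2 with y
    exact map_neg (Φ.ext hh y.1) _
  | mul a b _ _ ha hb =>
    convert! (X.sections W).mul_mem ha hb using 2 with y
    exact map_mul (Φ.ext hh y.1) _ _

lemma ext_symm_algebraMap {y : X.carrier} (g : holStalk k X.carrier y) :
    (Φ.ext hh y).symm (Φ.iso y (hh.scalarGerm r y g)) = algebraMap _ _ g :=
  (RingEquiv.symm_apply_eq _).2 (Φ.ext_algebraMap hh y g).symm

/-- Over a single chart the constants and the `θ_a / x_j` correspond to generators, and these
produce all monomials. -/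
lemma oddGerm_mem_closure {j : Fin (k + 1)} {W : Opens X.carrier}
    (hW : W ≤ Φ.preim (affOpen j)) (w : OddAlg r) :
    (fun y : W => ((Φ.ext hh y.1).symm (Φ.iso y (oddGerm r (hW y.2) w)) :
      (Φ.cotangent hh).extStalk y.1)) ∈ Subring.closure (Φ.extGenerators hh W) := by
  induction w using ExteriorAlgebra.induction with
  | algebraMap c =>
    refine Subring.subset_closure (Or.inl ⟨fun y => algebraMap ℂ _ c, ?_, ?_⟩)
    · refine ⟨fun _ => c, contMDiffOn_const, fun x => ?_⟩
      change algebraMap ℂ (Germ (𝓝 x.1) ℂ) c = _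
      rw [Algebra.algebraMap_eq_smul_one]
      refine Eq.trans (b := ((c • (1 : X.carrier → ℂ) : X.carrier → ℂ) : Germ _ _)) rfl ?_
      exact Germ.coe_eq.2 (Filter.Eventually.of_forall fun v => by simp)
    · funext y
      refine Eq.trans ?_ (Φ.ext_symm_algebraMap hh (algebraMap ℂ _ c))
      rw [scalarGerm_algebraMap, AlgHom.commutes]
  | ι w =>
    have h1 : ∀ y : W, Φ.ext hh y.1 (ExteriorAlgebra.ι (holStalk k X.carrier y.1)
        (fun a => Φ.ratio hh (Φ.mem_idx y.1) (hW y.2) * algebraMap ℂ _ (w a))) =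
          Φ.iso y (oddGerm r (hW y.2) (ExteriorAlgebra.ι ℂ w)) := by
      intro y
      rw [Φ.ext_ι hh (hW y.2)]
      congr 1
      simp only [Units.inv_mul_cancel_left]
      have hj : Φ.homeo y.1 ∈ affOpen j := hW y.2
      exact ((extToStalk_ι hh hj _).symm.trans (congrArg _ (constExt_ι _ w).symm)).trans
        (extToStalk_constExt hh hj _)
    refine Subring.subset_closure (Or.inr ⟨fun y a =>
      Φ.ratio hh (Φ.mem_idx y.1) (hW y.2) * algebraMap ℂ _ (w a), ?_, ?_⟩)
    · exact (congrArg (X.sheaf.pred (U := W)) (funext h1)).mpr (Φ.pred_oddGerm hW _)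
    · funext y
      exact (RingEquiv.symm_apply_eq _).2 (h1 y).symm
  | mul a b ha hb =>
    convert! Subring.mul_mem _ ha hb using 2 with y
    refine Eq.trans ?_ (map_mul (Φ.ext hh y.1).symm _ _)
    rw [← map_mul, ← map_mul]
  | add a b ha hb =>
    convert! Subring.add_mem _ ha hb using 2 with y
    refine Eq.trans ?_ (map_add (Φ.ext hh y.1).symm _ _)
    rw [← map_add, ← map_add]

/-- Locally, inside one chart, a section is a finite sum of holomorphic coefficients times monomials
in the `θ_a / x_j`, hence in the subring generated by functions and sections of `cotangent`.
Conversely that subring maps to sections, and being a section is local. -/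
lemma pred_iff_isExtSection {U : Opens X.carrier} (s : ∀ y : U, X.stalk y) :
    X.sheaf.pred s ↔
      (Φ.cotangent hh).IsExtSection U (fun y => (Φ.ext hh y.1).symm (s y)) := by
  constructor
  · intro hs x
    obtain ⟨V, hx, f, hf, e⟩ := (Φ.pred_iff _ _).1 hs x
    let j := Φ.idx x.1
    let W : Opens X.carrier := U ⊓ Φ.preim V ⊓ Φ.preim (affOpen j)
    have hWU : W ≤ U := inf_le_left.trans inf_le_left
    have hWV : W ≤ Φ.preim V := inf_le_left.trans inf_le_right
    have hWj : W ≤ Φ.preim (affOpen j) := inf_le_right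
    refine ⟨W, ⟨⟨x.2, hx⟩, Φ.mem_idx x.1⟩, hWU, ?_⟩
    have key : (fun y : W => (Φ.ext hh y.1).symm (s ⟨y.1, hWU y.2⟩)) = ∑ A,
        (fun y : W => algebraMap (holStalk k X.carrier y.1)
          (ExteriorAlgebra (holStalk k X.carrier y.1) (Fin r → holStalk k X.carrier y.1))
          (hh.descGerm (hf.coeff j A) (hWV y.2))) *
        (fun y : W => (Φ.ext hh y.1).symm (Φ.iso y (oddGerm r (hWj y.2) (oddBasis r A)))) := by
      funext y
      rw [e ⟨y.1, hWU y.2⟩ (hWV y.2), germ_eq_extToStalk hh (hWj y.2) hf (hWV y.2), map_sum,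
        map_sum, Finset.sum_apply]
      refine Finset.sum_congr rfl fun A _ => ?_
      rw [map_mul, map_mul, ext_symm_algebraMap]
      rfl
    rw [key]
    refine Subring.sum_mem _ fun A _ => Subring.mul_mem _ (Subring.subset_closure (Or.inl
      ⟨fun y => hh.descGerm (hf.coeff j A) (hWV y.2), ?_, rfl⟩)) (Φ.oddGerm_mem_closure hh hWj _)
    exact ⟨_, (hh.contMDiffOn (hf.coeff j A)).mono hWV, fun _ => rfl⟩
  · intro hs
    refine X.sheaf.locality _ fun x => ?_
    obtain ⟨W, hx, hWU, hW⟩ := hs x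
    refine ⟨W, hx, CategoryTheory.homOfLE hWU, ?_⟩
    have := Φ.pred_of_mem_closure hh hW
    convert! this using 2 with y
    exact ((Φ.ext hh y.1).apply_symm_apply _).symm

/-- The splitting of a superspace isomorphic to projective superspace. -/
def splittingIso : X.SplittingIso (Φ.cotangent hh) where
  iso x := (Φ.ext hh x).symm
  map_algebraMap x c := by
    refine (RingEquiv.symm_apply_eq _).2 ?_
    refine Eq.trans ?_ (Φ.ext_algebraMap hh x _).symm
    rw [scalarGerm_algebraMap, AlgEquiv.commutes]
  map_parity x i a := by
    refine Iff.trans ?_ (Φ.ext_mem_parity_iff hh)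
    exact iff_of_eq (congrArg (· ∈ X.parity x i) ((Φ.ext hh x).apply_symm_apply a).symm)
  map_section U s := Φ.pred_iff_isExtSection hh s

end Superspace.ProjIso

/-- A superspace isomorphic to `ℙ^{k|r}` is split. -/
theorem Superspace.ProjIso.isSplit {X : Superspace} {k r : ℕ} (Φ : X.ProjIso k r) : X.IsSplit := by
  refine ⟨Φ.homeo.symm.t2Space, Φ.homeo.secondCountableTopology, k, affChartedSpace Φ.homeo,
    isManifold_affChartedSpace Φ.homeo, r, ?_⟩
  let _ := affChartedSpace Φ.homeo
  have := isManifold_affChartedSpace Φ.homeo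
  exact ⟨Φ.cotangent (isBiholomorphic_affChartedSpace Φ.homeo), ⟨Φ.splittingIso _⟩⟩

/-! ### Pulling back superfunctions along linear maps -/

section Pull

variable {m n k r : ℕ} (A : CSpace k →L[ℂ] CSpace m) (B : (Fin n → ℂ) →ₗ[ℂ] (Fin r → ℂ))

lemma exists_cone_eq_preimage (U : Opens (ProjSpace m)) :
    ∃ W : Opens (ProjSpace k), cone (W : Set (ProjSpace k)) = A ⁻¹' cone (U : Set (ProjSpace m)) :=
  exists_opens_cone_eq ((isOpen_cone U.2).preimage A.continuous)
    (fun h => (mem_cone_iff.1 h).1 (map_zero A)) fun v hv c => by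
      rw [Set.mem_preimage, map_smul]; exact smul_mem_cone hv c

/-- The preimage of an open subset of `ℙ^m` under the rational map `ℙ^k ⇢ ℙ^m` defined by a
linear map. -/
def pullOpens (U : Opens (ProjSpace m)) : Opens (ProjSpace k) :=
  (exists_cone_eq_preimage A U).choose

lemma cone_pullOpens (U : Opens (ProjSpace m)) :
    cone (pullOpens A U : Set (ProjSpace k)) = A ⁻¹' cone (U : Set (ProjSpace m)) :=
  (exists_cone_eq_preimage A U).choose_spec

lemma mem_pullOpens {U : Opens (ProjSpace m)} {p : ProjSpace k} :
    p ∈ pullOpens A U ↔ A p.rep ∈ cone (U : Set (ProjSpace m)) := by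
  rw [← SetLike.mem_coe, ← rep_mem_cone, cone_pullOpens]; rfl

/-- The linear map `A` maps the point `p` of `ℙ^k` to the point `p'` of `ℙ^m`. -/
def MapsPoint (p : ProjSpace k) (p' : ProjSpace m) : Prop := A p.rep ≠ 0 ∧ toProj (A p.rep) = p'

variable {A}

lemma MapsPoint.mem_pullOpens {p : ProjSpace k} {p' : ProjSpace m} (h : MapsPoint A p p')
    {U : Opens (ProjSpace m)} (hU : p' ∈ U) : p ∈ pullOpens A U :=
  (SuperGeometry.mem_pullOpens A).2 (mem_cone_iff.2 ⟨h.1, h.2 ▸ hU⟩)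

lemma MapsPoint.tendsto {p : ProjSpace k} {p' : ProjSpace m} (h : MapsPoint A p p') :
    Tendsto A (coneNhds p) (coneNhds p') := by
  intro S hS
  obtain ⟨U, hU, hUS⟩ := mem_coneNhds.1 hS
  refine mem_coneNhds.2 ⟨pullOpens A U, h.mem_pullOpens hU, fun v hv => hUS ?_⟩
  rwa [cone_pullOpens] at hv

lemma map_scaleOdd (c : ℂ) (w : OddAlg n) :
    scaleOdd c (ExteriorAlgebra.map B w) = ExteriorAlgebra.map B (scaleOdd c w) := by
  have : (scaleOdd c).comp (ExteriorAlgebra.map B) = (ExteriorAlgebra.map B).comp (scaleOdd c) := by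
    apply ExteriorAlgebra.hom_ext
    ext i
    simp [scaleOdd]
  exact DFunLike.congr_fun this w

variable (A) in
lemma IsSuperfunction.pull {U : Opens (ProjSpace m)} {f : CSpace m → OddAlg n}
    (hf : IsSuperfunction (U : Set (ProjSpace m)) f) :
    IsSuperfunction (pullOpens A U : Set (ProjSpace k))
      (fun v => ExteriorAlgebra.map B (f (A v))) where
  holomorphic φ := by
    rw [cone_pullOpens]
    exact (hf.holomorphic (φ ∘ₗ (ExteriorAlgebra.map B).toLinearMap)).comp
      A.differentiable.differentiableOn fun v hv => hv
  invariant v hv c := by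
    rw [cone_pullOpens] at hv
    rw [map_scaleOdd, map_smul, hf.invariant _ hv]

/-- Pulling back germs of superfunctions along a linear map of even and odd coordinates. -/
def pull {p : ProjSpace k} {p' : ProjSpace m} (h : MapsPoint A p p') :
    projStalk m n p' →ₐ[ℂ] projStalk k r p where
  toFun g := ⟨(g.1.compTendsto A h.tendsto).map (ExteriorAlgebra.map B), by
    obtain ⟨_, U, hU, f, hf, rfl⟩ := g
    exact ⟨pullOpens A U, h.mem_pullOpens hU, _, hf.pull A B, rfl⟩⟩
  map_one' := Subtype.ext (Germ.coe_eq.2 (Eventually.of_forall fun _ => map_one _))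
  map_mul' := by
    rintro ⟨_, U, hU, f, hf, rfl⟩ ⟨_, V, hV, g, hg, rfl⟩
    exact Subtype.ext (Germ.coe_eq.2 (Eventually.of_forall fun _ => map_mul _ _ _))
  map_zero' := Subtype.ext (Germ.coe_eq.2 (Eventually.of_forall fun _ => map_zero _))
  map_add' := by
    rintro ⟨_, U, hU, f, hf, rfl⟩ ⟨_, V, hV, g, hg, rfl⟩
    exact Subtype.ext (Germ.coe_eq.2 (Eventually.of_forall fun _ => map_add _ _ _))
  commutes' c := by
    refine Subtype.ext ?_
    change Germ.map _ ((algebraMap ℂ (Germ (coneNhds p') (OddAlg n)) c).compTendsto _ h.tendsto) =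
      algebraMap ℂ (Germ (coneNhds p) (OddAlg r)) c
    rw [germ_algebraMap, germ_algebraMap]
    exact Germ.coe_eq.2 (Eventually.of_forall fun _ => AlgHom.commutes _ _)

variable {p : ProjSpace k} {p' : ProjSpace m} (h : MapsPoint A p p')

lemma pull_val {g : projStalk m n p'} {f : CSpace m → OddAlg n} (hg : g.1 = f) :
    (pull B h g).1 = ((fun v => ExteriorAlgebra.map B (f (A v)) : CSpace k → OddAlg r) :
      Germ (coneNhds p) (OddAlg r)) := by
  change Germ.map _ (g.1.compTendsto _ _) = _
  rw [hg]; rfl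

lemma pull_mem_parity {i : ZMod 2} {g : projStalk m n p'} (hg : g ∈ projParity m n p' i) :
    pull B h g ∈ projParity k r p i := by
  obtain ⟨_, U, hU, f, hf, rfl⟩ := g
  obtain ⟨V, hV, hfV⟩ := (germ_mem_parity rfl).1 hg
  refine (germ_mem_parity rfl).2 ⟨pullOpens A V, h.mem_pullOpens hV, fun v hv => ?_⟩
  rw [cone_pullOpens] at hv
  exact map_mem_extParity B (hfV _ hv)

/-- Pullback reverses the composition of the even maps and keeps that of the odd maps, so the
one-sided inverses `A' ∘ A = 1` and `B ∘ B' = 1` are exactly what makes this composite trivial. -/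
lemma pull_pull_of_inverse {A' : CSpace m →L[ℂ] CSpace k} {B' : (Fin r → ℂ) →ₗ[ℂ] (Fin n → ℂ)}
    (h' : MapsPoint A' p' p) (hA : ∀ v, A' (A v) = v) (hB : ∀ w, B (B' w) = w)
    (g : projStalk k r p) : pull B h (pull B' h' g) = g := by
  obtain ⟨_, U, hU, f, hf, rfl⟩ := g
  refine Subtype.ext (Germ.coe_eq.2 (Eventually.of_forall fun v => ?_))
  change ExteriorAlgebra.map B (ExteriorAlgebra.map B' (f (A' (A v)))) = f v
  have e : B ∘ₗ B' = LinearMap.id := LinearMap.ext hB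
  rw [← AlgHom.comp_apply, ExteriorAlgebra.map_comp_map, e, ExteriorAlgebra.map_id, hA]
  rfl

end Pull

/-- The map of projective spaces induced by a linear map is continuous where it is defined. -/
lemma continuousOn_toProj_comp {m k : ℕ} (A : CSpace m →L[ℂ] CSpace k) :
    ContinuousOn (fun p : ProjSpace m => toProj (A p.rep)) {p | A p.rep ≠ 0} := by
  have e : {p : ProjSpace m | A p.rep ≠ 0} = pullOpens A ⊤ := by
    ext p
    rw [SetLike.mem_coe, mem_pullOpens, mem_cone_iff]
    exact (and_iff_left trivial).symm
  rw [e]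
  refine continuousOn_rep (g := fun v => toProj (A v)) (pullOpens A ⊤).2 (fun v hv => ?_)
    fun v _ c => by rw [map_smul, toProj_smul]
  have hv := (cone_pullOpens A ⊤).subset hv
  exact ((continuousAt_toProj (mem_cone_iff.1 hv).1).comp
    A.continuous.continuousAt).continuousWithinAt

/-! ### Hadamard's lemma for functions of degree zero -/

section Hadamard

variable {m : ℕ} {U : Opens (ProjSpace m)} {F : CSpace m → ℂ}
  (hF : IsScalarFunction (U : Set (ProjSpace m)) F) (A : CSpace m →L[ℂ] CSpace m)

lemma exists_cone_eq_segmentSet (U : Opens (ProjSpace m)) :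
    ∃ W : Opens (ProjSpace m), cone (W : Set (ProjSpace m)) =
      segmentSet A (cone (U : Set (ProjSpace m))) := by
  refine exists_opens_cone_eq (isOpen_segmentSet A (isOpen_cone U.2)) (fun h => ?_)
    fun v hv c s hs => ?_
  · exact (mem_cone_iff.1 (h 0 ⟨le_rfl, zero_le_one⟩)).1 (by simp)
  · have := smul_mem_cone (hv s hs) c
    rwa [smul_add, smul_comm, smul_sub, ← map_smul] at this

include hF in
-- Differentiating `F(c v) = F(v)`: the derivative is homogeneous of degree `-1`.
lemma IsScalarFunction.fderiv_smul {v : CSpace m} (hv : v ∈ cone (U : Set (ProjSpace m))) (c : ℂˣ) :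
    (c : ℂ) • fderiv ℂ F ((c : ℂ) • v) = fderiv ℂ F v := by
  rw [← fderiv_comp_smul]
  refine Filter.EventuallyEq.fderiv_eq ?_
  filter_upwards [(isOpen_cone U.2).mem_nhds hv] with w hw using hF.invariant w hw c

/-- The coefficients in Hadamard's lemma. -/
def hadamardCoeff (F : CSpace m → ℂ) (j b : Fin (m + 1)) (x : CSpace m) : ℂ :=
  x j * ∫ s in (0 : ℝ)..1, fderiv ℂ F (A x + s • (x - A x)) (Pi.single b 1)

include hF in
-- The integrand has degree `-1` and the segment from `A x` to `x` scales with `x`, so the factor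
-- `x_j` brings the total degree to zero.
lemma IsScalarFunction.hadamardCoeff {W : Opens (ProjSpace m)}
    (hW : cone (W : Set (ProjSpace m)) = segmentSet A (cone (U : Set (ProjSpace m))))
    (j b : Fin (m + 1)) :
    IsScalarFunction (W : Set (ProjSpace m)) (hadamardCoeff A F j b) where
  holomorphic := by
    rw [hW]
    refine (differentiable_apply j).differentiableOn.mul (differentiableOn_integral_segment
      (H := fun y => fderiv ℂ F y (Pi.single b 1)) A (isOpen_cone U.2) ?_)
    exact ((analyticOnNhd_of_differentiableOn (isOpen_cone U.2)
      hF.holomorphic).fderiv.differentiableOn).clm_apply (differentiableOn_const _)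
  invariant v hv c := by
    rw [hW] at hv
    simp only [SuperGeometry.hadamardCoeff, Pi.smul_apply, smul_eq_mul]
    rw [mul_comm (c : ℂ), mul_assoc, ← intervalIntegral.integral_const_mul]
    congr 1
    refine intervalIntegral.integral_congr fun s hs => ?_
    rw [Set.uIcc_of_le zero_le_one] at hs
    have e : A ((c : ℂ) • v) + s • ((c : ℂ) • v - A ((c : ℂ) • v)) =
        (c : ℂ) • (A v + s • (v - A v)) := by
      rw [map_smul, ← smul_sub, smul_add, smul_comm (c : ℂ) s]
    simp only [e]
    rw [← hF.fderiv_smul (hv s hs) c]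
    rfl

include hF in
-- The fundamental theorem of calculus along the segment, with the derivative expanded in
-- coordinates. Dividing by `x_j` turns the linear forms `(x - A x)_b` into functions of degree
-- zero, which are generators of the ideal sheaf when those forms lie in `I`.
lemma IsScalarFunction.eq_add_sum {x : CSpace m}
    (hx : x ∈ segmentSet A (cone (U : Set (ProjSpace m)))) {j : Fin (m + 1)} (hj : x j ≠ 0) :
    F x = F (A x) +
      ∑ b, (x - A x) b / x j * SuperGeometry.hadamardCoeff A F j b x := by
  have h1 := sub_eq_integral_segment A (isOpen_cone U.2) hF.holomorphic hx
  have hD : ContinuousOn (fderiv ℂ F) (cone (U : Set (ProjSpace m))) :=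
    (analyticOnNhd_of_differentiableOn (isOpen_cone U.2) hF.holomorphic).fderiv.continuousOn
  rw [← sub_eq_iff_eq_add', h1]
  have h2 : ∀ (D : CSpace m →L[ℂ] ℂ) (y : CSpace m), D y = ∑ b, y b * D (Pi.single b 1) := by
    intro D y
    conv_lhs => rw [pi_eq_sum_univ' y]
    simp
  simp only [h2 _ (x - A x)]
  rw [intervalIntegral.integral_finsetSum]
  · refine Finset.sum_congr rfl fun b _ => ?_
    rw [intervalIntegral.integral_const_mul, SuperGeometry.hadamardCoeff]
    field_simp
  · intro b _
    refine ContinuousOn.intervalIntegrable ?_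
    rw [Set.uIcc_of_le zero_le_one]
    exact continuousOn_const.mul
      ((continuousOn_segment_right A hD hx).clm_apply continuousOn_const)

end Hadamard

/-! ### Linear subvarieties -/

section Linear

variable {m n : ℕ}

/-- The linear form `ℓ` as a polynomial. -/
def linPoly : Module.Dual ℂ (CSpace m) →ₗ[ℂ] MvPolynomial (Fin (m + 1)) ℂ :=
  ∑ a, (LinearMap.applyₗ (Pi.single a 1 : CSpace m)).smulRight (MvPolynomial.X a)

lemma linPoly_apply (ℓ : Module.Dual ℂ (CSpace m)) :
    linPoly ℓ = ∑ a, ℓ (Pi.single a 1) • MvPolynomial.X a := by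
  simp [linPoly]

lemma eval_linPoly (ℓ : Module.Dual ℂ (CSpace m)) (v : CSpace m) :
    MvPolynomial.eval v (linPoly ℓ) = ℓ v := by
  conv_rhs => rw [pi_eq_sum_univ' v]
  simp [linPoly_apply, MvPolynomial.smul_eval, mul_comm]

lemma isHomogeneous_linPoly (ℓ : Module.Dual ℂ (CSpace m)) : (linPoly ℓ).IsHomogeneous 1 := by
  rw [linPoly_apply]
  refine MvPolynomial.IsHomogeneous.sum _ _ _ fun a _ => ?_
  rw [MvPolynomial.smul_eq_C_mul]
  exact MvPolynomial.isHomogeneous_C_mul_X _ _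

variable (m n) in
/-- The even linear superpolynomials. -/
def evenLin : Module.Dual ℂ (CSpace m) →ₗ[ℂ] SuperPoly m n :=
  (TensorProduct.mk ℂ (MvPolynomial (Fin (m + 1)) ℂ) (OddAlg n)).flip 1 ∘ₗ linPoly

variable (m n) in
/-- The odd linear superpolynomials. -/
def oddLin : (Fin n → ℂ) →ₗ[ℂ] SuperPoly m n :=
  TensorProduct.mk ℂ (MvPolynomial (Fin (m + 1)) ℂ) (OddAlg n) 1 ∘ₗ ExteriorAlgebra.ι ℂ

lemma evenLin_apply (ℓ : Module.Dual ℂ (CSpace m)) : evenLin m n ℓ = linPoly ℓ ⊗ₜ 1 := rfl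

lemma oddLin_apply (w : Fin n → ℂ) : oddLin m n w = 1 ⊗ₜ ExteriorAlgebra.ι ℂ w := rfl

lemma superEval_evenLin (v : CSpace m) (ℓ : Module.Dual ℂ (CSpace m)) :
    superEval v (evenLin m n ℓ) = algebraMap ℂ _ (ℓ v) := by
  rw [evenLin_apply, superEval_tmul, eval_linPoly, Algebra.algebraMap_eq_smul_one]

lemma superEval_oddLin (v : CSpace m) (w : Fin n → ℂ) :
    superEval v (oddLin m n w) = ExteriorAlgebra.ι ℂ w := by
  rw [oddLin_apply, superEval_tmul, map_one, one_smul]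

lemma evenLin_mem_homogeneousPart (ℓ : Module.Dual ℂ (CSpace m)) :
    evenLin m n ℓ ∈ homogeneousPart m n 1 :=
  Submodule.subset_span ⟨1, 0, rfl, _, isHomogeneous_linPoly ℓ, 1,
    show 1 ∈ (LinearMap.range (ExteriorAlgebra.ι ℂ) : Submodule ℂ (OddAlg n)) ^ 0 from
      Submodule.one_le.1 (pow_zero _).ge, rfl⟩

lemma oddLin_mem_homogeneousPart (w : Fin n → ℂ) : oddLin m n w ∈ homogeneousPart m n 1 :=
  Submodule.subset_span ⟨0, 1, rfl, 1, MvPolynomial.isHomogeneous_one _ _, _,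
    show _ ∈ (LinearMap.range (ExteriorAlgebra.ι ℂ) : Submodule ℂ (OddAlg n)) ^ 1 from
      by rw [pow_one]; exact LinearMap.mem_range_self _ w, rfl⟩

lemma evenLin_mem_polyParity (ℓ : Module.Dual ℂ (CSpace m)) :
    evenLin m n ℓ ∈ polyParity m n 0 :=
  Submodule.subset_span ⟨_, 1, SetLike.GradedOne.one_mem, rfl⟩

lemma oddLin_mem_polyParity (w : Fin n → ℂ) : oddLin m n w ∈ polyParity m n 1 :=
  Submodule.subset_span ⟨_, _, CliffordAlgebra.ι_mem_evenOdd_one _ w, rfl⟩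

lemma exists_linPoly_eq {p : MvPolynomial (Fin (m + 1)) ℂ} (hp : p.IsHomogeneous 1) :
    ∃ ℓ, linPoly ℓ = p := by
  have hle : Submodule.span ℂ (Set.range (MvPolynomial.X : _ → MvPolynomial (Fin (m + 1)) ℂ)) ≤
      LinearMap.range linPoly := by
    refine Submodule.span_le.2 ?_
    rintro _ ⟨a, rfl⟩
    exact ⟨LinearMap.proj a, by simp [linPoly_apply, Pi.single_apply, ite_smul]⟩
  rw [← MvPolynomial.homogeneousSubmodule_one_eq_span_X] at hle
  exact hle hp

/-- In total degree one, a monomial is either a variable `x_i` with no `θ`, or a constant times one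
`θ_a`. -/
lemma exists_eq_evenLin_add_oddLin {P : SuperPoly m n} (hP : P ∈ homogeneousPart m n 1) :
    ∃ ℓ w, P = evenLin m n ℓ + oddLin m n w := by
  induction hP using Submodule.span_induction with
  | mem P hP =>
    obtain ⟨i, j, hij, p, hp, w, hw, rfl⟩ := hP
    obtain ⟨rfl, rfl⟩ | ⟨rfl, rfl⟩ : i = 1 ∧ j = 0 ∨ i = 0 ∧ j = 1 := by omega
    · have hw : w ∈ (LinearMap.range (ExteriorAlgebra.ι ℂ) : Submodule ℂ (OddAlg n)) ^ 0 := hw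
      rw [pow_zero] at hw
      obtain ⟨c, rfl⟩ := Submodule.mem_one.1 hw
      have hp : p.IsHomogeneous 1 := hp
      obtain ⟨ℓ, rfl⟩ := exists_linPoly_eq hp
      refine ⟨c • ℓ, 0, ?_⟩
      rw [map_zero, add_zero, map_smul, evenLin_apply, Algebra.algebraMap_eq_smul_one,
        TensorProduct.tmul_smul]
    · have hw : w ∈ (LinearMap.range (ExteriorAlgebra.ι ℂ) : Submodule ℂ (OddAlg n)) ^ 1 := hw
      rw [pow_one] at hw
      obtain ⟨w, rfl⟩ := hw
      have hp : p.IsHomogeneous 0 := hp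
      obtain ⟨c, rfl⟩ : ∃ c, p = MvPolynomial.C c := ⟨_, MvPolynomial.totalDegree_eq_zero_iff_eq_C.1
        (Nat.le_zero.1 hp.totalDegree_le)⟩
      refine ⟨0, c • w, ?_⟩
      rw [map_zero, zero_add, map_smul, oddLin_apply, TensorProduct.smul_tmul',
        MvPolynomial.smul_eq_C_mul, mul_one]
  | zero => exact ⟨0, 0, by simp⟩
  | add P P' _ _ h h' =>
    obtain ⟨ℓ, w, rfl⟩ := h
    obtain ⟨ℓ', w', rfl⟩ := h'
    exact ⟨ℓ + ℓ', w + w', by rw [map_add, map_add, add_add_add_comm]⟩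
  | smul c P _ h =>
    obtain ⟨ℓ, w, rfl⟩ := h
    exact ⟨c • ℓ, c • w, by rw [map_smul, map_smul, smul_add]⟩

lemma lTensor_involute_of_mem {i : ZMod 2} {P : SuperPoly m n} (hP : P ∈ polyParity m n i) {c : ℂ}
    (hc : ∀ w ∈ extParity ℂ (Fin n → ℂ) i, CliffordAlgebra.involute w = c • w) :
    LinearMap.lTensor (MvPolynomial (Fin (m + 1)) ℂ)
      (CliffordAlgebra.involute : OddAlg n →ₐ[ℂ] OddAlg n).toLinearMap P = c • P := by
  induction hP using Submodule.span_induction with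
  | mem P hP =>
    obtain ⟨p, w, hw, rfl⟩ := hP
    rw [LinearMap.lTensor_tmul, AlgHom.toLinearMap_apply, hc w hw, TensorProduct.tmul_smul]
  | zero => rw [map_zero, smul_zero]
  | add P P' _ _ h h' => rw [map_add, h, h', smul_add]
  | smul a P _ h => rw [map_smul, h, smul_comm]

/-- The grade involution on the odd variables acts as `+1` on the even part and as `-1` on the odd
part, so `2 P = 0` on the intersection. -/
lemma disjoint_polyParity : Disjoint (polyParity m n 0) (polyParity m n 1) := by
  refine Submodule.disjoint_def.2 fun P h0 h1 => ?_
  have e0 := lTensor_involute_of_mem (c := 1) h0 fun w hw => by rw [involute_even hw, one_smul]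
  have e1 := lTensor_involute_of_mem (c := -1) h1 fun w hw => by
    rw [involute_odd hw, neg_smul, one_smul]
  have : (2 : ℂ) • P = 0 := by
    rw [← one_add_one_eq_two, add_smul]
    nth_rewrite 1 [← e0]
    rw [e1, ← add_smul, neg_add_cancel, zero_smul]
  exact (smul_eq_zero.1 this).resolve_left two_ne_zero

/-- The even and odd components of the elements of a graded ideal lie in it. -/
lemma IsParityGraded.mem_of_add_mem {I : TwoSidedIdeal (SuperPoly m n)} (hI : IsParityGraded I)
    {P Q : SuperPoly m n} (hP : P ∈ polyParity m n 0) (hQ : Q ∈ polyParity m n 1)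
    (h : P + Q ∈ I) : P ∈ I ∧ Q ∈ I := by
  obtain ⟨P₀, h₀, P₁, h₁, k₀, k₁, e⟩ := hI _ h
  have key : P - P₀ = P₁ - Q := by
    rw [sub_eq_sub_iff_add_eq_add, e, add_comm]
  have z := Submodule.disjoint_def.1 disjoint_polyParity (P - P₀)
    (Submodule.sub_mem _ hP k₀) (key ▸ Submodule.sub_mem _ k₁ hQ)
  exact ⟨sub_eq_zero.1 z ▸ h₀, sub_eq_zero.1 (key ▸ z) ▸ h₁⟩

end Linear

/-- A linear parametrization of the subvariety of `ℙ^{m|n}` defined by the ideal `I`. -/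
structure LinearParam {m n : ℕ} (I : TwoSidedIdeal (SuperPoly m n)) (k r : ℕ) where
  /-- the inclusion of the even coordinates -/
  incl : CSpace k →L[ℂ] CSpace m
  /-- a left inverse of the inclusion -/
  proj : CSpace m →L[ℂ] CSpace k
  proj_incl : ∀ v, proj (incl v) = v
  /-- the restriction of the odd coordinates -/
  oddRes : (Fin n → ℂ) →ₗ[ℂ] (Fin r → ℂ)
  /-- a right inverse of the restriction -/
  oddLift : (Fin r → ℂ) →ₗ[ℂ] (Fin n → ℂ)
  oddRes_oddLift : ∀ w, oddRes (oddLift w) = w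
  -- These three conditions say that `I` is cut out by the parametrization: everything in `I`
  -- vanishes on it, and every linear form that vanishes on it, even or odd, is in `I`.
  map_eval_eq_zero : ∀ P ∈ I, ∀ v, ExteriorAlgebra.map oddRes (superEval (incl v) P) = 0
  evenLin_mem : ∀ ℓ, (∀ v, ℓ (incl v) = 0) → evenLin m n ℓ ∈ I
  oddLin_mem : ∀ w, oddRes w = 0 → oddLin m n w ∈ I

/-! ### Linear coordinates adapted to the ideal -/

section Existence

variable {m n : ℕ} {I : TwoSidedIdeal (SuperPoly m n)}

/-- An ideal of the superpolynomial algebra as a subspace. -/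
def idealSubmodule (I : TwoSidedIdeal (SuperPoly m n)) : Submodule ℂ (SuperPoly m n) :=
  (TwoSidedIdeal.asIdeal I).restrictScalars ℂ

/-- The even linear forms in the ideal `I`. -/
def evenForms (I : TwoSidedIdeal (SuperPoly m n)) : Submodule ℂ (Module.Dual ℂ (CSpace m)) :=
  (idealSubmodule I).comap (evenLin m n)

/-- The odd linear forms in the ideal `I`. -/
def oddForms (I : TwoSidedIdeal (SuperPoly m n)) : Submodule ℂ (Fin n → ℂ) :=
  (idealSubmodule I).comap (oddLin m n)

/-- A point of the zero locus is represented by a nonzero vector killed by all even linear forms of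
`I`. -/
lemma zeroLocus_eq_empty (h : (evenForms I).dualCoannihilator = ⊥) : zeroLocus I = ∅ := by
  refine Set.eq_empty_of_forall_notMem fun p hp => p.rep_nonzero ?_
  refine (Submodule.mem_bot ℂ).1 (h ▸ (Submodule.mem_dualCoannihilator _).2 fun ℓ hℓ => ?_)
  have := hp _ hℓ _ p.rep_nonzero p.mk_rep
  rwa [superEval_evenLin, ExteriorAlgebra.algebraMap_leftInverse] at this

/-- The even coordinates are those of the common kernel `L` of the even forms, the odd ones those of
the quotient by the odd forms in `I`. Gradedness and generation in degree one enter here: the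
evaluation is an algebra homomorphism, so its vanishing on `I` need only be tested on generators,
and each generator splits into an even and an odd form that both lie in `I`. -/
lemma exists_linearParam (hI : IsParityGraded I) (hI1 : HasDegree I 1)
    (h : (evenForms I).dualCoannihilator ≠ ⊥) : ∃ k r, Nonempty (LinearParam I k r) := by
  let L := (evenForms I).dualCoannihilator
  have hL : 0 < Module.finrank ℂ L := by
    rw [Nat.pos_iff_ne_zero]
    exact fun e => h (Submodule.finrank_eq_zero.1 e)
  -- `CSpace k` has dimension `k + 1`; the truncated subtraction is harmless because `L ≠ 0`.
  let k := Module.finrank ℂ L - 1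
  let e : L ≃ₗ[ℂ] CSpace k := LinearEquiv.ofFinrankEq _ _ (by
    rw [Module.finrank_fin_fun]; omega)
  let i : CSpace k →ₗ[ℂ] CSpace m := L.subtype ∘ₗ e.symm.toLinearMap
  have hi : LinearMap.ker i = ⊥ :=
    LinearMap.ker_eq_bot.2 (L.injective_subtype.comp e.symm.injective)
  obtain ⟨π, hπ⟩ := i.exists_leftInverse_of_injective hi
  let e' : ((Fin n → ℂ) ⧸ oddForms I) ≃ₗ[ℂ]
      (Fin (Module.finrank ℂ ((Fin n → ℂ) ⧸ oddForms I)) → ℂ) :=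
    LinearEquiv.ofFinrankEq _ _ (by rw [Module.finrank_fin_fun])
  let q := e'.toLinearMap ∘ₗ (oddForms I).mkQ
  have hq : LinearMap.range q = ⊤ :=
    LinearMap.range_eq_top.2 (e'.surjective.comp (Submodule.mkQ_surjective _))
  obtain ⟨σ, hσ⟩ := q.exists_rightInverse_of_surjective hq
  have hq0 : ∀ w, q w = 0 ↔ w ∈ oddForms I := fun w => by
    simp only [q, LinearMap.comp_apply, LinearEquiv.coe_coe, map_eq_zero_iff _ e'.injective,
      Submodule.mkQ_apply, Submodule.Quotient.mk_eq_zero]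
  refine ⟨k, _, ⟨i.toContinuousLinearMap, π.toContinuousLinearMap,
    fun v => LinearMap.congr_fun hπ v, q, σ, fun w => LinearMap.congr_fun hσ w,
    fun P hP v => ?_, fun ℓ hℓ => ?_, fun w hw => (hq0 w).1 hw⟩⟩
  · obtain ⟨N, G, hG, rfl⟩ := hI1
    have hle : TwoSidedIdeal.span (Set.range G) ≤
        TwoSidedIdeal.ker ((ExteriorAlgebra.map q).comp (superEval (i v))) := by
      refine TwoSidedIdeal.span_le.2 ?_
      rintro _ ⟨α, rfl⟩
      rw [SetLike.mem_coe, TwoSidedIdeal.mem_ker]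
      have hα : G α ∈ TwoSidedIdeal.span (Set.range G) := TwoSidedIdeal.subset_span ⟨α, rfl⟩
      obtain ⟨ℓ, w, hGα⟩ := exists_eq_evenLin_add_oddLin (hG α)
      rw [hGα] at hα ⊢
      obtain ⟨hℓ, hw⟩ := hI.mem_of_add_mem (evenLin_mem_polyParity ℓ) (oddLin_mem_polyParity w) hα
      have hℓ0 : ℓ (i v) = 0 := (Submodule.mem_dualCoannihilator _).1 (e.symm v).2 ℓ hℓ
      rw [AlgHom.comp_apply, map_add, superEval_evenLin, superEval_oddLin, hℓ0, map_zero, zero_add,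
        ExteriorAlgebra.map_apply_ι, (hq0 w).2 hw, map_zero]
    exact TwoSidedIdeal.mem_ker _ |>.1 (hle hP)
  -- A form vanishing on the common kernel of `evenForms I` belongs to `evenForms I`, by double
  -- annihilation in finite dimension.
  · have : ℓ ∈ L.dualAnnihilator := (Submodule.mem_dualAnnihilator _).2 fun x hx => by
      have := hℓ (e ⟨x, hx⟩)
      simpa [i] using this
    rw [Subspace.dualCoannihilator_dualAnnihilator_eq] at this
    exact this

end Existence

/-! ### Linear subvarieties are projective superspaces -/

/-- The stalk of the ideal sheaf of a subvariety of projective superspace. -/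
abbrev stalkIdeal {m n : ℕ} (I : TwoSidedIdeal (SuperPoly m n)) (p : ProjSpace m) :
    TwoSidedIdeal (projStalk m n p) :=
  TwoSidedIdeal.span (fracGerms I p)

namespace LinearParam

variable {m n k r : ℕ} {I : TwoSidedIdeal (SuperPoly m n)} (D : LinearParam I k r)

/-- The projection of the even coordinates to the linear subspace. -/
def retr : CSpace m →L[ℂ] CSpace m := D.incl.comp D.proj

lemma retr_apply (v : CSpace m) : D.retr v = D.incl (D.proj v) := rfl

lemma retr_incl (v : CSpace k) : D.retr (D.incl v) = D.incl v := by
  rw [retr_apply, D.proj_incl]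

/-- The coordinates of `x - retr x`. -/
def coordForm (b : Fin (m + 1)) : Module.Dual ℂ (CSpace m) :=
  LinearMap.proj b ∘ₗ (LinearMap.id - D.retr.toLinearMap)

lemma coordForm_apply (b : Fin (m + 1)) (v : CSpace m) : D.coordForm b v = (v - D.retr v) b := rfl

lemma coordForm_mem (b : Fin (m + 1)) : evenLin m n (D.coordForm b) ∈ I :=
  D.evenLin_mem _ fun v => by rw [coordForm_apply, retr_incl, sub_self]; rfl

/-- The coordinates of `x - retr x` are forms in `I`, so they vanish at points of the zero locus.
Conversely, at a point in the image of `incl` the elements of `I` die after restricting the odd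
coordinates, and the constant term is unaffected by that restriction. -/
lemma mem_zeroLocus {p : ProjSpace m} : p ∈ zeroLocus I ↔ D.retr p.rep = p.rep := by
  constructor
  · intro hp
    have : p.rep - D.retr p.rep = 0 := funext fun b => by
      have := hp _ (D.coordForm_mem b) _ p.rep_nonzero p.mk_rep
      rwa [superEval_evenLin, ExteriorAlgebra.algebraMap_leftInverse] at this
    exact (sub_eq_zero.1 this).symm
  · rintro hp P hP v hv rfl
    obtain ⟨c, hc⟩ := exists_rep_eq_smul hv
    rw [← toProj_of_ne_zero hv, hc, map_smul] at hp
    have hv' : D.incl (D.proj v) = v := smul_right_injective _ c.ne_zero hp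
    have h1 := D.map_eval_eq_zero P hP (D.proj v)
    rw [hv'] at h1
    have h2 : (ExteriorAlgebra.algebraMapInv (R := ℂ) (M := Fin r → ℂ)).comp
        (ExteriorAlgebra.map D.oddRes) = ExteriorAlgebra.algebraMapInv := by
      apply ExteriorAlgebra.hom_ext
      ext i
      simp [ExteriorAlgebra.algebraMapInv]
    rw [← h2, AlgHom.comp_apply, h1, map_zero]

lemma proj_rep_ne_zero {p : ProjSpace m} (hp : p ∈ zeroLocus I) : D.proj p.rep ≠ 0 := fun h =>
  p.rep_nonzero (by rw [← D.mem_zeroLocus.1 hp, retr_apply, h, map_zero])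

lemma incl_ne_zero {v : CSpace k} (hv : v ≠ 0) : D.incl v ≠ 0 := fun h =>
  hv (by rw [← D.proj_incl v, h, map_zero])

lemma toProj_incl_mem {v : CSpace k} (hv : v ≠ 0) : toProj (D.incl v) ∈ zeroLocus I := by
  obtain ⟨c, hc⟩ := exists_rep_eq_smul (D.incl_ne_zero hv)
  rw [D.mem_zeroLocus, hc, map_smul, retr_incl]

lemma toProj_incl_toProj_proj {p : ProjSpace m} (hp : p ∈ zeroLocus I) :
    toProj (D.incl (toProj (D.proj p.rep)).rep) = p := by
  obtain ⟨c, hc⟩ := exists_rep_eq_smul (D.proj_rep_ne_zero hp)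
  rw [hc, map_smul, toProj_smul, ← retr_apply, D.mem_zeroLocus.1 hp, toProj_rep]

lemma toProj_proj_toProj_incl (p : ProjSpace k) :
    toProj (D.proj (toProj (D.incl p.rep)).rep) = p := by
  obtain ⟨c, hc⟩ := exists_rep_eq_smul (D.incl_ne_zero p.rep_nonzero)
  rw [hc, map_smul, toProj_smul, D.proj_incl, toProj_rep]

/-- The underlying space of a linear subvariety is a projective space. -/
def homeo : zeroLocus I ≃ₜ ProjSpace k where
  toFun p := toProj (D.proj p.1.rep)
  invFun p := ⟨toProj (D.incl p.rep), D.toProj_incl_mem p.rep_nonzero⟩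
  left_inv p := Subtype.ext (D.toProj_incl_toProj_proj p.2)
  right_inv := D.toProj_proj_toProj_incl
  continuous_toFun := (continuousOn_toProj_comp D.proj).comp_continuous continuous_subtype_val
    fun p => D.proj_rep_ne_zero p.2
  continuous_invFun := by
    refine Continuous.subtype_mk ?_ _
    rw [← continuousOn_univ]
    exact (continuousOn_toProj_comp D.incl).mono fun p _ => D.incl_ne_zero p.rep_nonzero

lemma mapsPoint_proj (x : zeroLocus I) : MapsPoint D.proj x.1 (D.homeo x) :=
  ⟨D.proj_rep_ne_zero x.2, rfl⟩

lemma mapsPoint_incl (x : zeroLocus I) : MapsPoint D.incl (D.homeo x) x.1 :=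
  ⟨D.incl_ne_zero (Projectivization.rep_nonzero _), D.toProj_incl_toProj_proj x.2⟩

/-- Restriction of germs to the subvariety. -/
def restrict (x : zeroLocus I) : projStalk m n x.1 →ₐ[ℂ] projStalk k r (D.homeo x) :=
  pull D.oddRes (D.mapsPoint_incl x)

/-- Extension of germs from the subvariety. -/
def extend (x : zeroLocus I) : projStalk k r (D.homeo x) →ₐ[ℂ] projStalk m n x.1 :=
  pull D.oddLift (D.mapsPoint_proj x)

lemma restrict_extend (x : zeroLocus I) (a : projStalk k r (D.homeo x)) :
    D.restrict x (D.extend x a) = a :=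
  pull_pull_of_inverse _ _ _ D.proj_incl D.oddRes_oddLift a

/-- The numerators of the generating fractions already vanish identically when restricted to the
linear parametrization, and the kernel of a ring homomorphism is an ideal. -/
lemma restrict_eq_zero {x : zeroLocus I} {a : projStalk m n x.1}
    (ha : a ∈ stalkIdeal I x.1) : D.restrict x a = 0 := by
  have hle : stalkIdeal I x.1 ≤ TwoSidedIdeal.ker (D.restrict x) := by
    refine TwoSidedIdeal.span_le.2 ?_
    rintro g ⟨d, i, P, hPI, hP, hPi, Q, hQ, hp, e⟩
    rw [SetLike.mem_coe, TwoSidedIdeal.mem_ker]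
    refine Subtype.ext ((pull_val D.oddRes (D.mapsPoint_incl x) e).trans
      (Germ.coe_eq.2 (Eventually.of_forall fun v => ?_)))
    change ExteriorAlgebra.map D.oddRes (superFrac P Q (D.incl v)) = 0
    rw [superFrac, map_smul, D.map_eval_eq_zero P hPI, smul_zero]
  exact (TwoSidedIdeal.mem_ker _).1 (hle ha)

end LinearParam

/-! ### Linear forms divided by a coordinate, as elements of the ideal sheaf -/

section IdealSheaf

variable {m n : ℕ} {I : TwoSidedIdeal (SuperPoly m n)} {p : ProjSpace m}

lemma isScalarFunction_div (ℓ : Module.Dual ℂ (CSpace m)) (j : Fin (m + 1)) :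
    IsScalarFunction (affOpen j : Set (ProjSpace m)) (fun v => ℓ v / v j) where
  holomorphic := by
    rw [cone_affOpen]
    simp only [div_eq_mul_inv]
    exact (LinearMap.toContinuousLinearMap ℓ).differentiable.differentiableOn.mul
      ((differentiable_apply j).differentiableOn.inv fun v hv => hv)
  invariant v _ c := by
    simp only [map_smul, Pi.smul_apply, smul_eq_mul]
    exact mul_div_mul_left _ _ c.ne_zero

lemma germ_div_mem {ℓ : Module.Dual ℂ (CSpace m)} (hℓ : evenLin m n ℓ ∈ I) {j : Fin (m + 1)}
    (hj : p ∈ affOpen j) :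
    ((isScalarFunction_div ℓ j).isSuperfunction n).germ hj ∈ stalkIdeal I p := by
  refine TwoSidedIdeal.subset_span ⟨1, 0, _, hℓ, evenLin_mem_homogeneousPart ℓ,
    evenLin_mem_polyParity ℓ, MvPolynomial.X j, MvPolynomial.isHomogeneous_X _ _, ?_, ?_⟩
  · rw [MvPolynomial.eval_X]; exact mem_affOpen.1 hj
  · refine Germ.coe_eq.2 (Eventually.of_forall fun v => ?_)
    change algebraMap ℂ (OddAlg n) (ℓ v / v j) = superFrac _ _ v
    rw [superFrac, superEval_evenLin, MvPolynomial.eval_X, Algebra.smul_def, ← map_mul,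
      div_eq_inv_mul]

lemma oddGerm_mem {w : Fin n → ℂ} (hw : oddLin m n w ∈ I) {j : Fin (m + 1)}
    (hj : p ∈ affOpen j) :
    oddGerm n hj (ExteriorAlgebra.ι ℂ w) ∈ stalkIdeal I p := by
  refine TwoSidedIdeal.subset_span ⟨1, 1, _, hw, oddLin_mem_homogeneousPart w,
    oddLin_mem_polyParity w, MvPolynomial.X j, MvPolynomial.isHomogeneous_X _ _, ?_, ?_⟩
  · rw [MvPolynomial.eval_X]; exact mem_affOpen.1 hj
  · refine Germ.coe_eq.2 (Eventually.of_forall fun v => ?_)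
    change scaleOdd (v j)⁻¹ (ExteriorAlgebra.ι ℂ w) = superFrac _ _ v
    rw [superFrac, superEval_oddLin, MvPolynomial.eval_X]
    simp [scaleOdd]

end IdealSheaf

/-! ### The quotient sheaf as the structure sheaf of `ℙ^{k|r}` -/

namespace LinearParam

variable {m n k r : ℕ} {I : TwoSidedIdeal (SuperPoly m n)} (D : LinearParam I k r)

/-- Extending the restriction of `F` gives `F ∘ retr`, so Hadamard's lemma writes the difference as
a combination of the fractions `(x - retr x)_b / x_j`, which lie in the ideal sheaf. -/
lemma scalar_sub_mem (x : zeroLocus I) {U : Opens (ProjSpace m)} (hU : x.1 ∈ U)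
    {F : CSpace m → ℂ} (hF : IsScalarFunction (U : Set (ProjSpace m)) F) :
    (hF.isSuperfunction n).germ hU - D.extend x (D.restrict x ((hF.isSuperfunction n).germ hU)) ∈
      stalkIdeal I x.1 := by
  obtain ⟨j, hj⟩ := exists_mem_affOpen x.1
  obtain ⟨W, hW⟩ := exists_cone_eq_segmentSet D.retr U
  -- At a point of the zero locus the segment from `retr x` to `x` degenerates to the point itself.
  have hx : x.1 ∈ W := by
    rw [← SetLike.mem_coe, ← rep_mem_cone, hW]
    intro s _
    rw [D.mem_zeroLocus.1 x.2, sub_self, smul_zero, add_zero]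
    exact rep_mem_cone.2 hU
  let V : Opens (ProjSpace m) := W ⊓ affOpen j
  have hV : x.1 ∈ V := ⟨hx, hj⟩
  let b : Fin (m + 1) → superfunctions n (V : Set (ProjSpace m)) := fun b =>
    ⟨_, ((isScalarFunction_div (D.coordForm b) j).isSuperfunction n).mono Set.inter_subset_right⟩ *
      ⟨_, ((hF.hadamardCoeff D.retr hW j b).isSuperfunction n).mono Set.inter_subset_left⟩
  have key : (hF.isSuperfunction n).germ hU =
      D.extend x (D.restrict x ((hF.isSuperfunction n).germ hU)) + germHom hV (∑ a, b a) := by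
    refine projStalk_ext hV rfl (g := (fun v => ExteriorAlgebra.map D.oddLift
      (ExteriorAlgebra.map D.oddRes (algebraMap ℂ _ (F (D.retr v))))) +
        (∑ a, b a : superfunctions n (V : Set (ProjSpace m))).1) rfl fun v hv => ?_
    have hvW : v ∈ segmentSet D.retr (cone (U : Set (ProjSpace m))) :=
      hW.subset (cone_mono Set.inter_subset_left hv)
    have hvj : v j ≠ 0 :=
      (cone_affOpen j).subset (cone_mono Set.inter_subset_right hv)
    rw [hF.eq_add_sum D.retr hvW hvj, map_add, map_sum, Pi.add_apply, AlgHom.commutes,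
      AlgHom.commutes]
    simp [b, coordForm_apply]
  rw [sub_eq_iff_eq_add'.2 key, map_sum]
  refine sum_mem fun a _ => ?_
  rw [map_mul]
  exact TwoSidedIdeal.mul_mem_right _ _ _ (germ_div_mem (D.coordForm_mem a) hj)

/-- With `R = retr` and `w' = oddLift (oddRes w)`, the difference `w / x_j - w' / (R x)_j` equals
`(w - w') / x_j` minus `((x_j - (R x)_j) / x_j) · w' / (R x)_j`. Each term contains a linear form
from `I`: the odd form `w - w'`, killed by `oddRes`, and the even form `x_j - (R x)_j`. -/
lemma odd_sub_mem (x : zeroLocus I) {j : Fin (m + 1)} (hj : x.1 ∈ affOpen j) (w : Fin n → ℂ) :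
    oddGerm n hj (ExteriorAlgebra.ι ℂ w) -
      D.extend x (D.restrict x (oddGerm n hj (ExteriorAlgebra.ι ℂ w))) ∈
        stalkIdeal I x.1 := by
  let w' := D.oddLift (D.oddRes w)
  -- Both denominators, `x_j` and the `j`-th coordinate of `retr x`, have to be nonzero.
  let V : Opens (ProjSpace m) := affOpen j ⊓ pullOpens D.retr (affOpen j)
  have hV : x.1 ∈ V := ⟨hj, (mem_pullOpens _).2 (by
    rw [D.mem_zeroLocus.1 x.2]; exact rep_mem_cone.2 hj)⟩
  have key : oddGerm n hj (ExteriorAlgebra.ι ℂ w) =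
      D.extend x (D.restrict x (oddGerm n hj (ExteriorAlgebra.ι ℂ w))) +
      (oddGerm n hj (ExteriorAlgebra.ι ℂ (w - w')) -
        ((isScalarFunction_div (D.coordForm j) j).isSuperfunction n).germ hj *
        D.extend x (D.restrict x (oddGerm n hj (ExteriorAlgebra.ι ℂ w)))) := by
    let X : CSpace m → OddAlg n := fun v => ExteriorAlgebra.map D.oddLift
      (ExteriorAlgebra.map D.oddRes (scaleOdd (D.retr v j)⁻¹ (ExteriorAlgebra.ι ℂ w)))
    refine projStalk_ext hV rfl (g := X + ((fun v => scaleOdd (v j)⁻¹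
      (ExteriorAlgebra.ι ℂ (w - w'))) -
        (fun v => algebraMap ℂ _ (D.coordForm j v / v j)) * X)) rfl fun v hv => ?_
    have hvj : v j ≠ 0 := (cone_affOpen j).subset (cone_mono Set.inter_subset_left hv)
    have hvj' : D.retr v j ≠ 0 :=
      (cone_affOpen j).subset ((cone_pullOpens D.retr _).subset
        (cone_mono Set.inter_subset_right hv))
    have hs : ∀ (c : ℂ) (u : Fin n → ℂ), scaleOdd c (ExteriorAlgebra.ι ℂ u) =
        c • ExteriorAlgebra.ι ℂ u := fun c u => by simp [scaleOdd]
    have hX : X v = (D.retr v j)⁻¹ • ExteriorAlgebra.ι ℂ w' := by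
      simp only [X, hs, map_smul, ExteriorAlgebra.map_apply_ι, w']
    have e : (v j)⁻¹ • ExteriorAlgebra.ι ℂ w' = (D.retr v j)⁻¹ • ExteriorAlgebra.ι ℂ w' -
        ((v j - D.retr v j) / v j * (D.retr v j)⁻¹) • ExteriorAlgebra.ι ℂ w' := by
      rw [← sub_smul]
      congr 1
      field_simp
      ring
    change scaleOdd (v j)⁻¹ (ExteriorAlgebra.ι ℂ w) = X v + (scaleOdd (v j)⁻¹
      (ExteriorAlgebra.ι ℂ (w - w')) - algebraMap ℂ _ ((v j - D.retr v j) / v j) * X v)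
    rw [hX, hs, hs, map_sub, smul_sub, e, ← Algebra.smul_def, smul_smul]
    abel
  rw [sub_eq_iff_eq_add'.2 key]
  refine sub_mem (oddGerm_mem (D.oddLin_mem _ ?_) hj)
    (TwoSidedIdeal.mul_mem_right _ _ _ (germ_div_mem (D.coordForm_mem j) hj))
  rw [map_sub, D.oddRes_oddLift, sub_self]

/-- Germs on the subvariety. -/
def quot (_ : LinearParam I k r) (x : zeroLocus I) :
    projStalk m n x.1 →ₐ[ℂ] (stalkIdeal I x.1).ringCon.Quotient :=
  (stalkIdeal I x.1).ringCon.mkₐ (α := ℂ)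

lemma quot_eq_iff {x : zeroLocus I} {a b : projStalk m n x.1} :
    D.quot x a = D.quot x b ↔ a - b ∈ stalkIdeal I x.1 :=
  (projIdealSheaf I).mk'_eq a b

lemma quot_surjective (x : zeroLocus I) : Function.Surjective (D.quot x) :=
  RingCon.mkₐ_surjective (α := ℂ) _

/-- Both sides are ring homomorphisms in `a`, so it is enough to compare them on scalar functions
and on the `θ / x_j`, which are the two preceding lemmas. -/
lemma quot_extend_restrict (x : zeroLocus I) (a : projStalk m n x.1) :
    D.quot x (D.extend x (D.restrict x a)) = D.quot x a := by
  obtain ⟨j, hj⟩ := exists_mem_affOpen x.1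
  refine (projStalk_hom_ext hj (φ := (D.quot x).toRingHom)
    (ψ := ((D.quot x).comp ((D.extend x).comp (D.restrict x))).toRingHom)
    (fun U hp F hF => ?_) (fun w => ?_) a).symm
  · exact D.quot_eq_iff.2 (D.scalar_sub_mem x hp hF)
  · exact D.quot_eq_iff.2 (D.odd_sub_mem x hj w)

/-- Restriction descends to the quotient, since it kills the ideal, and is inverse to extension on
both sides. -/
lemma bijective_quot_extend (x : zeroLocus I) :
    Function.Bijective ((D.quot x).comp (D.extend x)) := by
  constructor
  · intro a b hab
    have h1 := D.restrict_eq_zero (D.quot_eq_iff.1 hab)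
    rw [map_sub, sub_eq_zero] at h1
    exact ((D.restrict_extend x a).symm.trans h1).trans (D.restrict_extend x b)
  · intro c
    obtain ⟨a, rfl⟩ := D.quot_surjective x c
    exact ⟨D.restrict x a, D.quot_extend_restrict x a⟩

/-- The stalks of the structure sheaf of a linear subvariety. -/
def stalkEquiv (x : zeroLocus I) :
    projStalk k r (D.homeo x) ≃ₐ[ℂ] (stalkIdeal I x.1).ringCon.Quotient :=
  AlgEquiv.ofBijective _ (D.bijective_quot_extend x)

/-- A section of the quotient is locally the class of a superfunction on an open subset of `ℙ^m`;
pulling it back along `incl` gives the superfunction on `ℙ^k`. In the other direction a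
superfunction on `ℙ^k` is extended to an open subset of `ℙ^m` by pulling back along `proj`. -/
lemma pred_iff (U : Opens (projSubvariety I).carrier) (s : ∀ x : U, (projSubvariety I).stalk x) :
    (projSubvariety I).sheaf.pred s ↔
    ∀ x : U, ∃ (W : Opens (ProjSpace k)) (_ : D.homeo x.1 ∈ W) (f : CSpace k → OddAlg r)
      (hf : IsSuperfunction (W : Set (ProjSpace k)) f),
      ∀ (y : U) (hy : D.homeo y.1 ∈ W), s y = D.stalkEquiv y.1 (hf.germ hy) := by
  constructor
  · intro hs x
    obtain ⟨V, hxV, _, O, t, ht, e⟩ := hs x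
    obtain ⟨hxO, -⟩ := e ⟨x.1, hxV⟩
    obtain ⟨O', hxO', i', f, hf, e'⟩ := ht ⟨x.1.1, hxO⟩
    let V' : Opens (ProjSpace k) := ⟨D.homeo.symm ⁻¹' V.1, V.2.preimage D.homeo.symm.continuous⟩
    have hV' : ∀ y : zeroLocus I, D.homeo y ∈ V' ↔ y ∈ V := fun y => by
      change D.homeo.symm (D.homeo y) ∈ V.1 ↔ y ∈ V.1
      rw [D.homeo.symm_apply_apply]
    refine ⟨pullOpens D.incl O' ⊓ V', ⟨(D.mapsPoint_incl x.1).mem_pullOpens hxO', (hV' _).2 hxV⟩, _,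
      (hf.pull D.incl D.oddRes).mono Set.inter_subset_left, fun y hy => ?_⟩
    have hyO' : y.1.1 ∈ O' := by
      have h1 := (mem_cone_iff.1 ((mem_pullOpens D.incl).1 hy.1)).2
      rwa [(D.mapsPoint_incl y.1).2] at h1
    obtain ⟨hyO, ey⟩ := e ⟨y.1, (hV' _).1 hy.2⟩
    refine ey.trans ?_
    have e2 : t ⟨y.1.1, hyO⟩ = hf.germ hyO' := Subtype.ext (e' ⟨y.1.1, hyO'⟩)
    rw [e2]
    exact (D.quot_extend_restrict y.1 (hf.germ hyO')).symm
  · intro h x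
    obtain ⟨W, hxW, f, hf, e⟩ := h x
    let V : Opens (projSubvariety I).carrier :=
      U ⊓ ⟨D.homeo ⁻¹' W, W.2.preimage D.homeo.continuous⟩
    refine ⟨V, ⟨x.2, hxW⟩, CategoryTheory.homOfLE inf_le_left, pullOpens D.proj W,
      fun y => (hf.pull D.proj D.oddLift).germ y.2,
      TopCat.PrelocalPredicate.sheafifyOf ⟨_, hf.pull D.proj D.oddLift, fun _ => rfl⟩, fun y => ?_⟩
    exact ⟨(D.mapsPoint_proj y.1).mem_pullOpens y.2.2, e ⟨y.1, y.2.1⟩ y.2.2⟩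

/-- A linear subvariety of projective superspace is a projective superspace. -/
def projIso : (projSubvariety I).ProjIso k r where
  homeo := D.homeo
  iso := D.stalkEquiv
  mem_parity x _ _ ha := ⟨_, pull_mem_parity D.oddLift (D.mapsPoint_proj x) ha, rfl⟩
  pred_iff := D.pred_iff

end LinearParam

/-- An empty superspace is split. -/
lemma Superspace.isSplit_of_isEmpty (X : Superspace) [IsEmpty X.carrier] : X.IsSplit := by
  let _ : ChartedSpace (EuclideanSpace ℂ (Fin 0)) X.carrier := ChartedSpace.empty _ _
  let T : LocallyFreeSheaf 0 X.carrier 0 :=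
    { stalk := fun x => holStalk 0 X.carrier x
      sheaf :=
        { pred := fun _ => True
          res := fun _ _ _ => trivial
          locality := fun _ _ => trivial }
      frame := fun x => isEmptyElim x }
  refine ⟨inferInstance, inferInstance, 0, inferInstance, ?_, 0, T, ⟨⟨fun x => isEmptyElim x,
    fun x => isEmptyElim x, fun x => isEmptyElim x, fun U s => ?_⟩⟩⟩
  · exact isManifold_of_contDiffOn _ _ _ fun e e' he => False.elim he
  -- Over an empty space every family is a section, since being a section is a local condition.
  · exact ⟨fun _ x => isEmptyElim x.1, fun _ => X.sheaf.locality _ fun x => isEmptyElim x.1⟩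

/-- Linear subvarieties of projective superspace are split. -/
theorem isSplit_projSubvariety {m n : ℕ} (I : TwoSidedIdeal (SuperPoly m n))
    (hI : IsParityGraded I) (hI1 : HasDegree I 1) : (projSubvariety I).IsSplit := by
  by_cases h : (evenForms I).dualCoannihilator = ⊥
  · have : IsEmpty (projSubvariety I).carrier :=
      Set.isEmpty_coe_sort.2 (zeroLocus_eq_empty h)
    exact Superspace.isSplit_of_isEmpty _
  · obtain ⟨k, r, ⟨D⟩⟩ := exists_linearParam hI hI1 h
    exact D.projIso.isSplit

end SuperGeometry

end

theorem mainTheorem11 (m n : ℕ) (I : TwoSidedIdeal (SuperGeometry.SuperPoly m n))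
    (hgraded : SuperGeometry.IsParityGraded I) (hlinear : SuperGeometry.HasDegree I 1) :
    (SuperGeometry.projSubvariety I).IsSplit := by
  exact SuperGeometry.isSplit_projSubvariety I hgraded hlinear
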